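/- Let $k$ be an algebraically closed field of characteristic $2$, let $W(k)$ be its ring of Witt vectors and $K_0=\mathrm{Frac}(W(k))$. For $c\ge 1$ let $K_c=K_0(\zeta_{2^c})$, where $\zeta_{2^c}$ is a primitive $2^c$-th root of unity; in particular $K_1=K_0$. For a finite Galois extension $L/K_0$ with group $G$ and normalized valuation $v_L$, let $G_i=\{g\in G: v_L(g\pi_L-\pi_L)\ge i+1\}$ ($i\in\mathbb R_{\ge 0}$, $\pi_L$ a uniformizer of $L$) be the ramification groups in the lower numbering, let $G^i=G_{\psi(i)}$ be those in the upper numbering, where $\psi$ is the inverse of $\varphi(u)=\int_0^u \frac{dt}{[G_0:G_t]}$ on $[0,\infty)$, and define the conductor by $h_{L/K_0}=\sup\{i\ge 0: G^i\ne\{\mathrm{id}\}\}$. Let $c\ge 1$ and $0\le n<2^c$ be integers, let $b\in W(k)$ with $b\equiv 1\pmod 2$, put $a=2^nb\in K_0=K_1$ and $K=K_c(\sqrt[2^c]{a})$. Then $K/K_1$ is a finite Galois extension, and the following hold. (i) If $n$ is odd, then $h_{K/K_1}=c+1$. (ii) Suppose $n$ is even. (a) If $c=1$ and $b\equiv 1\pmod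 4$, then $K=K_1$. (b) If $c=1$ and $b\equiv 3\pmod 4$, then $h_{K/K_1}=1$. (c) If $4\mid n$, $c>1$ and $b\equiv 1\pmod 4$, then $h_{K/K_1}=c-1$. (d) If $4\mid n$, $c>1$ and $b\equiv 3\pmod 4$, then $h_{K/K_1}=c$. (e) If $4\nmid n$, $c>1$ and $b\equiv 1\pmod 4$, then $h_{K/K_1}=c$. (f) If $4\nmid n$, $c=2$ and $b\equiv 3\pmod 4$, then $h_{K/K_1}=1$. (g) If $4\nmid n$, $c>2$ and $b\equiv 3\pmod 4$, then $h_{K/K_1}=c-\tfrac12$. Here congruences are taken in $W(k)$. -/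

import Mathlib

noncomputable section

namespace Ramification

/-! Throughout this namespace `A` is (in the intended use) a complete discrete valuation ring with
fraction field `K`, and `L / K` is a finite Galois extension with group `Gal(L/K)`.  The valuation
ring `𝒪_L` of `L` is the integral closure of `A` in `L`; it is again a discrete valuation ring. -/

section

variable (A K L : Type*) [CommRing A] [Field K] [Field L] [Algebra A K] [Algebra K L] [Algebra A L]
  [IsScalarTower A K L]

/-- The maximal ideal of the (local) valuation ring `𝒪_L`, i.e. its Jacobson radical.  For the
normalized valuation `v_L` and `x` in `𝒪_L`, one has `v_L x ≥ m` iff `x ∈ maxIdeal A L ^ m`. -/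
def maxIdeal : Ideal (integralClosure A L) := Ideal.jacobson ⊥

/-- The lower numbering ramification group `G_i`, for real `i ≥ 0`: those `g` with
`v_L (g π - π) ≥ i + 1` for the uniformizers `π` (the irreducible elements of `𝒪_L`).  As `v_L`
takes integer values, `v_L ≥ i + 1` means `v_L ≥ ⌈i⌉ + 1`. -/
def lowerGroup (i : ℝ) : Subgroup Gal(L/K) where
  carrier := {g | ∀ π : integralClosure A L, Irreducible π → g • π - π ∈ maxIdeal A L ^ (⌈i⌉₊ + 1)}
  one_mem' := by
    intro π _
    simp
  mul_mem' := by
    intro g h hg hh π hπ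
    have h1 := hg (h • π) ((MulEquiv.irreducible_iff
      (MulSemiringAction.toRingEquiv Gal(L/K) (integralClosure A L) h)).mpr hπ)
    have h2 := hh π hπ
    have h3 := add_mem h1 h2
    rwa [sub_add_sub_cancel, ← mul_smul] at h3
  inv_mem' := by
    intro g hg π hπ
    have h1 := hg (g⁻¹ • π) ((MulEquiv.irreducible_iff
      (MulSemiringAction.toRingEquiv Gal(L/K) (integralClosure A L) g⁻¹)).mpr hπ)
    rw [smul_inv_smul] at h1
    rw [← neg_mem_iff, neg_sub]
    exact h1

/-- The Herbrand function `φ_{L/K}(u) = ∫_0^u dt / [G_0 : G_t]`, a strictly increasing bijection of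
`[0, ∞)` onto itself. -/
def phi (u : ℝ) : ℝ :=
  ∫ t in (0 : ℝ)..u, (Nat.card (lowerGroup A K L t) : ℝ) / Nat.card (lowerGroup A K L 0)

/-- `ψ_{L/K} : [0, ∞) → [0, ∞)`, the inverse of `φ_{L/K}`. -/
def psi : ℝ → ℝ := Function.invFunOn (phi A K L) (Set.Ici 0)

/-- The upper numbering ramification group `G^i = G_{ψ(i)}`, for real `i ≥ 0`. -/
def upperGroup (i : ℝ) : Subgroup Gal(L/K) := lowerGroup A K L (psi A K L i)

/-- The conductor `h_{L/K}`: the supremum of the `i ≥ 0` with `G^i` nontrivial (so `0` if `L = K`). -/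
def conductor : ℝ := sSup {i : ℝ | 0 ≤ i ∧ upperGroup A K L i ≠ ⊥}

end

/-- `K_0 = Frac (W(k))` for `k` of characteristic `2`; it equals `K_1 = K_0(ζ_2)` as `ζ_2 = -1`. -/
abbrev WittField (k : Type*) [Field k] [CharP k 2] : Type _ := FractionRing (WittVector 2 k)

end Ramification

end

/-! Extend the dyadic valuation to an algebraic closure, multiplicatively, with `v 2 = 1/2`. The
residue field is algebraically closed, so a finite extension `L` is totally ramified and its
valuation ring is `A[π]` for any uniformizer `π`. For an embedding `σ` nontrivial on `L`, define its
upper index `h` on `L` by `∏ max (v (z - π)) (v (σ π - π)) = 2 ^ (-(h + 1))`, the product being over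
the conjugates `z` of `π`. This is the classical identity `φ(u) + 1 = (1/e) ∑ min (i_G g) (u + 1)`,
and the conductor is the largest upper index (`IsDyadic.conductor_eq`). As conjugates replace group
elements, the definition also serves non-Galois fields such as `K(2 ^ (1 / 2 ^ c))`.

Herbrand's theorem (`IsDyadic.herbrand_eq`) shows that each break of a subfield is a break of the
larger field and that restricting `σ` to a subfield does not lower its index. So the largest break
of a compositum is the maximum of the largest breaks of its factors (`UpperLE.sup`), and a break `≥
h` of a compositum with a factor whose breaks are `< h` comes from the other factor
(`UpperGE.of_sup`).

It remains to treat a few model extensions. The `2 ^ c`-th roots of unity have largest break `c - 1`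
(for `c ≥ 2`), and adding a `2 ^ (c - 1)`-th root of a unit does not raise it. A `2 ^ c`-th root of
`2` gives `c + 1` (for `c ≥ 1`), and a `2 ^ (c - 2)`-th root of `1 + i`, where `i ^ 2 = -1`, gives
`c - 1/2` (for `c ≥ 3`). Upper bounds come from Fontaine's criterion `UpperLE.of_forall` together
with a Hensel-type lifting of approximate `2 ^ n`-th roots, `IsDyadic.exists_pow_two_pow_eq`. Lower
bounds come from the derivative of an Eisenstein polynomial, `UpperGE.of_eisenstein`.

Finally, `b ≡ 1` mod `4` makes `b` the square of a unit, and `b ≡ 3` makes `-b` one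
(`IsDyadic.exists_sq_eq`). Splitting the radicand into a power of `2`, a sign and a unit leaves one
dominant model in each case. The exceptional half-integer arises because for odd `m` one has `-2 ^
(2 * m) = (-4) ^ m` and `-4 = (1 + i) ^ 4`. -/

set_option linter.unusedSectionVars false

/-! ### The dyadic valuation on an algebraic closure of the fraction field of `W(k)`. -/

namespace Ramification

open Polynomial NNReal
open scoped WithZero

/-- A Galois invariant valuation on an algebraic extension `Ω` of `K` which restricts to the
normalized dyadic valuation of the fraction field `K` of `A`, where `2` is a uniformizer of `A` and
the residue field of `A` is algebraically closed. -/
structure IsDyadic (A K : Type*) {Ω : Type*} [CommRing A] [Field K] [Field Ω] [Algebra A K]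
    [Algebra K Ω] [Algebra A Ω] (v : Valuation Ω ℝ≥0) : Prop where
  map_equiv : ∀ (σ : Ω ≃ₐ[K] Ω) (x : Ω), v (σ x) = v x
  le_one_iff : ∀ x : K, v (algebraMap K Ω x) ≤ 1 ↔ ∃ a : A, algebraMap A K a = x
  map_two : v 2 = 2⁻¹
  exists_zpow : ∀ x : K, x ≠ 0 → ∃ n : ℤ, v (algebraMap K Ω x) = 2 ^ n
  exists_eval_lt_one : ∀ p : A[X], p.Monic → p.natDegree ≠ 0 →
    ∃ a : A, v (algebraMap A Ω (p.eval a)) < 1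

section Witt

variable (k : Type*) [Field k] [CharP k 2]

lemma wittVector_two_irreducible : Irreducible (2 : WittVector 2 k) := by
  simpa using WittVector.irreducible 2 (k := k)

/-- A prime characteristic `p` would either be `2`, although `2` is irreducible and so nonzero, or
be odd and vanish in `k` through the constant coefficient. -/
instance : CharZero (WittVector 2 k) := by
  obtain ⟨p, hpc⟩ := CharP.exists (WittVector 2 k)
  rcases CharP.char_is_prime_or_zero (WittVector 2 k) p with hp | rfl
  swap
  · exact CharP.charP_to_charZero _
  exfalso
  have h0 : (p : WittVector 2 k) = 0 := CharP.cast_eq_zero _ p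
  by_cases h2 : p = 2
  · subst h2
    exact (wittVector_two_irreducible k).ne_zero (by exact_mod_cast h0)
  · have h1 : (WittVector.constantCoeff (p : WittVector 2 k)) = (p : k) := map_natCast _ _
    rw [h0, map_zero] at h1
    have := (CharP.cast_eq_zero_iff k 2 p).mp h1.symm
    exact h2 ((Nat.prime_dvd_prime_iff_eq Nat.prime_two hp).mp this).symm

variable [IsAlgClosed k]

/-- The dyadic absolute value on the fraction field of `W(k)`. -/
noncomputable def wittAbv : AbsoluteValue (WittField k) ℝ :=
  (IsDiscreteValuationRing.maximalIdeal (WittVector 2 k)).adicAbv (K := WittField k)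
    (b := 2) one_lt_two

lemma wittAbv_add_le_max (x y : WittField k) :
    wittAbv k (x + y) ≤ max (wittAbv k x) (wittAbv k y) :=
  IsDedekindDomain.HeightOneSpectrum.isNonarchimedean_adicAbv _ _ x y

lemma wittAbv_two : wittAbv k 2 = 2⁻¹ := by
  have h := (IsDiscreteValuationRing.maximalIdeal (WittVector 2 k)).adicAbv_of_algebraMap
    (K := WittField k) (b := 2) one_lt_two 2
  rw [map_ofNat] at h
  rw [wittAbv, h]
  have h2 := (IsDiscreteValuationRing.maximalIdeal (WittVector 2 k)).intValuation_singleton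
    (wittVector_two_irreducible k).ne_zero
    ((IsDiscreteValuationRing.irreducible_iff_uniformizer _).mp (wittVector_two_irreducible k))
  have h3 : WithZeroMulInt.toNNReal (e := 2) two_ne_zero (WithZero.exp (-1)) = 2⁻¹ := by
    rw [WithZeroMulInt.toNNReal_neg_apply two_ne_zero WithZero.exp_ne_zero, ← zpow_neg_one]
    congr
  change ((WithZeroMulInt.toNNReal (e := 2) two_ne_zero _ : ℝ≥0) : ℝ) = _
  rw [h2, h3]
  simp

lemma wittAbv_le_one_iff (x : WittField k) :
    wittAbv k x ≤ 1 ↔ ∃ a : WittVector 2 k, algebraMap _ _ a = x := by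
  constructor
  · intro h
    refine IsDiscreteValuationRing.exists_lift_of_le_one ?_
    have : (WithZeroMulInt.toNNReal (e := 2) two_ne_zero
      ((IsDiscreteValuationRing.maximalIdeal (WittVector 2 k)).valuation (WittField k) x)) ≤ 1 := h
    rwa [WithZeroMulInt.toNNReal_le_one_iff one_lt_two] at this
  · rintro ⟨a, rfl⟩
    exact IsDedekindDomain.HeightOneSpectrum.adicAbv_coe_le_one _ _ _

lemma wittAbv_unit (u : (WittVector 2 k)ˣ) : wittAbv k (algebraMap _ _ (u : WittVector 2 k)) = 1 := by
  refine le_antisymm ((wittAbv_le_one_iff k _).mpr ⟨_, rfl⟩) ?_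
  have h1 : wittAbv k (algebraMap _ _ ((u⁻¹ : (WittVector 2 k)ˣ) : WittVector 2 k)) ≤ 1 :=
    (wittAbv_le_one_iff k _).mpr ⟨_, rfl⟩
  have h2 : wittAbv k (algebraMap _ _ (u : WittVector 2 k)) *
      wittAbv k (algebraMap _ _ ((u⁻¹ : (WittVector 2 k)ˣ) : WittVector 2 k)) = 1 := by
    rw [← map_mul, ← map_mul, Units.mul_inv, map_one, map_one]
  nlinarith [(wittAbv k).nonneg (algebraMap _ _ (u : WittVector 2 k))]

lemma exists_wittAbv_eq_pow (a : WittVector 2 k) (ha : a ≠ 0) :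
    ∃ n : ℕ, wittAbv k (algebraMap _ _ a) = 2⁻¹ ^ n ∧ (2 : WittVector 2 k) ^ n ∣ a := by
  obtain ⟨m, u, rfl⟩ := WittVector.exists_eq_pow_p_mul' a ha
  refine ⟨m, ?_, ⟨u, by simp⟩⟩
  rw [map_mul, map_mul, wittAbv_unit, map_pow, map_pow, mul_one, map_natCast]
  norm_num [wittAbv_two]

lemma exists_wittAbv_eq_zpow (x : WittField k) (hx : x ≠ 0) :
    ∃ n : ℤ, wittAbv k x = 2 ^ n := by
  obtain ⟨a, b, hb, rfl⟩ := IsFractionRing.div_surjective (WittVector 2 k) x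
  have hb0 : b ≠ 0 := nonZeroDivisors.ne_zero hb
  have ha0 : a ≠ 0 := by rintro rfl; simp at hx
  obtain ⟨m, hm, -⟩ := exists_wittAbv_eq_pow k a ha0
  obtain ⟨n, hn, -⟩ := exists_wittAbv_eq_pow k b hb0
  refine ⟨n - m, ?_⟩
  rw [map_div₀, hm, hn, zpow_sub₀ two_ne_zero]
  simp [field]

lemma wittAbv_le_pow_iff (a : WittVector 2 k) (n : ℕ) :
    wittAbv k (algebraMap _ _ a) ≤ 2⁻¹ ^ n ↔ (2 : WittVector 2 k) ^ n ∣ a := by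
  constructor
  · intro h
    by_cases ha : a = 0
    · simp [ha]
    obtain ⟨m, hm, hd⟩ := exists_wittAbv_eq_pow k a ha
    rw [hm, pow_le_pow_iff_right_of_lt_one₀ (by norm_num) (by norm_num)] at h
    exact (pow_dvd_pow _ h).trans hd
  · rintro ⟨c, rfl⟩
    have := (wittAbv_le_one_iff k (algebraMap _ _ c)).mpr ⟨_, rfl⟩
    rw [map_mul, map_mul, map_pow, map_pow, map_ofNat, wittAbv_two]
    exact mul_le_of_le_one_right (by positivity) this

/-- Completeness is what makes the spectral norm multiplicative on the algebraic closure. -/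
lemma completeSpace_wittField :
    @CompleteSpace (WittField k) (wittAbv k).toNormedField.toMetricSpace.toUniformSpace := by
  let := (wittAbv k).toNormedField
  refine Metric.complete_of_convergent_controlled_sequences (fun n ↦ (2⁻¹ : ℝ) ^ n)
    (fun n ↦ by positivity) fun u hu ↦ ?_
  have hnorm : ∀ x : WittField k, ‖x‖ = wittAbv k x := fun _ ↦ rfl
  -- Subtracting the first term makes the sequence integral, so that the `2`-adic completeness of
  -- `W(k)` applies.
  have h0 : ∀ n, ∃ a : WittVector 2 k, algebraMap _ _ a = u n - u 0 := fun n ↦ by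
    rw [← wittAbv_le_one_iff, ← hnorm, ← dist_eq_norm]
    simpa using (hu 0 n 0 (by simp) le_rfl).le
  choose a ha using h0
  have hmod : ∀ N n : ℕ, N ≤ n → (2 : WittVector 2 k) ^ N ∣ a N - a n := fun N n h ↦ by
    rw [← wittAbv_le_pow_iff, map_sub, ha, ha, sub_sub_sub_cancel_right, ← hnorm, ← dist_eq_norm]
    exact (hu N N n le_rfl h).le
  have hideal : ∀ (n : ℕ) (x : WittVector 2 k),
      x ∈ (Ideal.span {((2 : ℕ) : WittVector 2 k)} ^ n • ⊤ : Ideal (WittVector 2 k)) ↔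
        (2 : WittVector 2 k) ^ n ∣ x := fun n x ↦ by
    simp [Ideal.span_singleton_pow, Ideal.mem_span_singleton]
  obtain ⟨l, hl⟩ := IsPrecomplete.prec
    (inferInstance : IsPrecomplete (Ideal.span {((2 : ℕ) : WittVector 2 k)}) (WittVector 2 k))
    (f := a) (fun {m n} h ↦ by rw [SModEq.sub_mem, hideal]; exact hmod m n h)
  refine ⟨u 0 + algebraMap _ _ l, ?_⟩
  rw [tendsto_iff_dist_tendsto_zero]
  refine squeeze_zero (fun _ ↦ dist_nonneg) (fun n ↦ ?_)
    (tendsto_pow_atTop_nhds_zero_of_lt_one (r := (2⁻¹ : ℝ)) (by norm_num) (by norm_num))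
  have h1 := hl n
  rw [SModEq.sub_mem, hideal, ← wittAbv_le_pow_iff, map_sub, ha] at h1
  rw [dist_eq_norm, hnorm, ← sub_sub]
  exact h1

/-- Lift a root of the reduction of `p` by a Teichmüller representative. -/
lemma wittVector_exists_two_dvd_eval (p : (WittVector 2 k)[X]) (hp : p.Monic)
    (h0 : p.natDegree ≠ 0) : ∃ a : WittVector 2 k, 2 ∣ p.eval a := by
  let φ : WittVector 2 k →+* k := WittVector.constantCoeff
  obtain ⟨r, hr⟩ := IsAlgClosed.exists_root (p.map φ) (by
    rw [hp.degree_map, degree_eq_natDegree hp.ne_zero]; exact_mod_cast h0)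
  refine ⟨WittVector.teichmuller 2 r, ?_⟩
  have h1 : φ (p.eval (WittVector.teichmuller 2 r)) = 0 := by
    rw [← eval₂_at_apply, ← eval_map]
    have : φ (WittVector.teichmuller 2 r) = r := WittVector.teichmuller_coeff_zero 2 r
    rw [this]; exact hr
  have := (WittVector.mem_span_p_iff_coeff_zero_eq_zero (p := 2) _).mpr h1
  simpa [Ideal.mem_span_singleton] using this

/-- The valuation is the spectral norm; its Galois invariance is built in, since it depends only on
the minimal polynomial. -/
theorem exists_isDyadic_wittField :
    ∃ v : Valuation (AlgebraicClosure (WittField k)) ℝ≥0,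
      IsDyadic (WittVector 2 k) (WittField k) v := by
  let : NormedField (WittField k) := (wittAbv k).toNormedField
  have hnorm : ∀ x : WittField k, ‖x‖ = wittAbv k x := fun _ ↦ rfl
  let : NontriviallyNormedField (WittField k) := NontriviallyNormedField.ofNormNeOne
    ⟨2, two_ne_zero, by rw [hnorm, wittAbv_two]; norm_num⟩
  have : IsUltrametricDist (WittField k) :=
    IsUltrametricDist.isUltrametricDist_of_isNonarchimedean_norm (wittAbv_add_le_max k)
  have : CompleteSpace (WittField k) := completeSpace_wittField k
  let N := spectralMulAlgNorm (WittField k) (AlgebraicClosure (WittField k))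
  let v : Valuation (AlgebraicClosure (WittField k)) ℝ≥0 :=
    { toFun := fun x ↦ ⟨N x, apply_nonneg N x⟩
      map_zero' := Subtype.ext (map_zero N)
      map_one' := Subtype.ext (map_one N)
      map_mul' := fun x y ↦ Subtype.ext (map_mul N x y)
      map_add_le_max' := fun x y ↦ by
        have := isNonarchimedean_spectralNorm (K := WittField k)
          (L := AlgebraicClosure (WittField k)) x y
        exact_mod_cast this }
  have hv : ∀ x : WittField k, (v (algebraMap _ _ x) : ℝ) = wittAbv k x := fun x ↦
    spectralNorm_extends x
  refine ⟨v, ?_, ?_, ?_, ?_, ?_⟩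
  · intro σ x
    ext
    exact (spectralNorm_eq_of_equiv σ x).symm
  · intro x
    rw [← wittAbv_le_one_iff, ← hv]; norm_cast
  · ext
    have := hv 2
    rw [map_ofNat] at this
    rw [this, wittAbv_two]; simp
  · intro x hx
    obtain ⟨n, hn⟩ := exists_wittAbv_eq_zpow k x hx
    refine ⟨n, ?_⟩
    ext
    rw [hv, hn]; simp
  · intro p hp h0
    obtain ⟨a, ha⟩ := wittVector_exists_two_dvd_eval k p hp h0
    refine ⟨a, ?_⟩
    rw [← pow_one (2 : WittVector 2 k), ← wittAbv_le_pow_iff] at ha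
    rw [← NNReal.coe_lt_coe, IsScalarTower.algebraMap_apply _ (WittField k), hv]
    refine ha.trans_lt ?_
    norm_num

end Witt

end Ramification

/-! ### Conjugates, integrality and triviality of the residue extension. -/

namespace Ramification

open Polynomial NNReal

section Conj

variable (K : Type*) {Ω : Type*} [Field K] [Field Ω] [Algebra K Ω]

open Classical in
/-- The finite set of conjugates of `x` over `K`. -/
noncomputable def conj (x : Ω) : Finset Ω := ((minpoly K x).aroots Ω).toFinset

variable [IsAlgClosed Ω] [Algebra.IsAlgebraic K Ω] [CharZero K] {x z : Ω}

lemma mem_conj_iff_aeval : z ∈ conj K x ↔ aeval z (minpoly K x) = 0 := by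
  classical
  rw [conj, Multiset.mem_toFinset, mem_aroots]
  exact and_iff_right (minpoly.ne_zero (Algebra.IsIntegral.isIntegral x))

lemma mem_conj_iff : z ∈ conj K x ↔ ∃ σ : Ω ≃ₐ[K] Ω, σ x = z := by
  have : IsAlgClosure K Ω := ⟨inferInstance, inferInstance⟩
  have : Normal K Ω := IsAlgClosure.normal K Ω
  rw [mem_conj_iff_aeval]
  constructor
  · intro h
    obtain ⟨σ, hσ⟩ := minpoly.exists_algEquiv_of_root' (Algebra.IsAlgebraic.isAlgebraic x) h
    exact ⟨σ, hσ⟩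
  · rintro ⟨σ, rfl⟩
    simp [aeval_algHom_apply]

lemma self_mem_conj (x : Ω) : x ∈ conj K x := (mem_conj_iff K).mpr ⟨1, rfl⟩

lemma map_minpoly_eq_prod_conj (x : Ω) :
    (minpoly K x).map (algebraMap K Ω) = ∏ z ∈ conj K x, (X - C z) := by
  classical
  have hs : (minpoly K x).Separable :=
    (minpoly.irreducible (Algebra.IsIntegral.isIntegral x)).separable
  have h1 := (IsAlgClosed.splits ((minpoly K x).map (algebraMap K Ω))).eq_prod_roots_of_monic
    ((minpoly.monic (Algebra.IsIntegral.isIntegral x)).map _)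
  rw [h1, Finset.prod, conj, Multiset.toFinset_val, Multiset.dedup_eq_self.mpr]
  exact nodup_roots hs.map

lemma aeval_minpoly_eq_prod_conj (x β : Ω) :
    aeval β (minpoly K x) = ∏ z ∈ conj K x, (β - z) := by
  rw [← eval_map_algebraMap, map_minpoly_eq_prod_conj, eval_prod]
  simp

lemma card_conj (x : Ω) : (conj K x).card = (minpoly K x).natDegree := by
  rw [← natDegree_map (algebraMap K Ω), map_minpoly_eq_prod_conj,
    natDegree_prod_of_monic _ _ fun z _ ↦ monic_X_sub_C z]
  simp

open Classical in
lemma aeval_derivative_minpoly_eq_prod_conj (x : Ω) :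
    aeval x (derivative (minpoly K x)) = ∏ z ∈ (conj K x).erase x, (x - z) := by
  rw [← eval_map_algebraMap, ← derivative_map, map_minpoly_eq_prod_conj,
    ← Finset.mul_prod_erase _ _ (self_mem_conj K x), derivative_mul]
  simp [eval_prod]

end Conj

variable {A K Ω : Type*} [CommRing A] [Field K] [Field Ω] [Algebra A K]
    [Algebra K Ω] [Algebra A Ω] [IsScalarTower A K Ω]

variable {v : Valuation Ω ℝ≥0}

namespace IsDyadic

lemma map_algebraMap_le_one (hv : IsDyadic A K v) (a : A) : v (algebraMap A Ω a) ≤ 1 := by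
  rw [IsScalarTower.algebraMap_apply A K Ω, hv.le_one_iff]
  exact ⟨a, rfl⟩

lemma map_aeval_le_one (hv : IsDyadic A K v) (g : A[X]) {x : Ω} (hx : v x ≤ 1) :
    v (aeval x g) ≤ 1 := by
  rw [aeval_eq_sum_range]
  refine v.map_sum_le fun i _ ↦ ?_
  rw [Algebra.smul_def, map_mul, map_pow]
  exact mul_le_one' (hv.map_algebraMap_le_one _) (pow_le_one' hx _)

lemma map_aeval_sub_aeval_le (hv : IsDyadic A K v) (g : A[X]) {x y : Ω} (hx : v x ≤ 1)
    (hy : v y ≤ 1) : v (aeval x g - aeval y g) ≤ v (x - y) := by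
  rw [aeval_eq_sum_range, aeval_eq_sum_range, ← Finset.sum_sub_distrib]
  refine v.map_sum_le fun i _ ↦ ?_
  rw [← smul_sub, Algebra.smul_def, map_mul]
  refine (mul_le_of_le_one_left' (hv.map_algebraMap_le_one _)).trans ?_
  rw [← geom_sum₂_mul, map_mul]
  refine mul_le_of_le_one_left' (v.map_sum_le fun j _ ↦ ?_)
  rw [map_mul, map_pow, map_pow]
  exact mul_le_one' (pow_le_one' hx _) (pow_le_one' hy _)

section AlgClosed

variable [IsAlgClosed Ω] [Algebra.IsAlgebraic K Ω] [CharZero K]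

lemma map_conj (hv : IsDyadic A K v) {x z : Ω} (hz : z ∈ conj K x) : v z = v x := by
  obtain ⟨σ, rfl⟩ := (mem_conj_iff K).mp hz
  exact hv.map_equiv σ x

lemma map_coeff_prod_le_one {s : Finset Ω} (hs : ∀ z ∈ s, v z ≤ 1) (i : ℕ) :
    v ((∏ z ∈ s, (X - C z)).coeff i) ≤ 1 := by
  revert i
  refine Finset.prod_induction _ (fun p : Polynomial Ω ↦ ∀ i, v (p.coeff i) ≤ 1) ?_ ?_ ?_
  · intro p q hp hq i
    rw [coeff_mul]
    refine v.map_sum_le fun j _ ↦ ?_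
    rw [map_mul]
    exact mul_le_one' (hp _) (hq _)
  · intro i
    rw [coeff_one]
    split_ifs <;> simp
  · intro z hz i
    rw [coeff_sub]
    refine v.map_sub_le ?_ ?_
    · rw [coeff_X]; split_ifs <;> simp
    · rw [coeff_C]; split_ifs <;> simp [hs z hz]

/-- The coefficients are symmetric functions of the conjugates, all of which have the same valuation
as `x`. -/
lemma exists_map_eq_minpoly [IsDomain A] [IsFractionRing A K] (hv : IsDyadic A K v) {x : Ω}
    (hx : v x ≤ 1) : ∃ P : A[X], P.Monic ∧ P.map (algebraMap A K) = minpoly K x := by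
  have h : minpoly K x ∈ lifts (algebraMap A K) := by
    rw [lifts_iff_coeff_lifts]
    intro i
    obtain ⟨a, ha⟩ := (hv.le_one_iff ((minpoly K x).coeff i)).mp (by
      rw [← coeff_map, map_minpoly_eq_prod_conj]
      exact map_coeff_prod_le_one (fun z hz ↦ (hv.map_conj hz).trans_le hx) i)
    exact ⟨a, ha⟩
  obtain ⟨P, hP, -, hm⟩ := lifts_and_degree_eq_and_monic h
    (minpoly.monic (Algebra.IsIntegral.isIntegral x))
  exact ⟨P, hm, hP⟩

lemma isIntegral_iff [IsDomain A] [IsFractionRing A K] (hv : IsDyadic A K v) {x : Ω} :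
    IsIntegral A x ↔ v x ≤ 1 := by
  constructor
  · rintro ⟨p, hp, hx⟩
    by_contra! h
    have hd : p.natDegree ≠ 0 := by
      intro h0
      rw [hp.natDegree_eq_zero.mp h0] at hx
      simp at hx
    have hxn : x ≠ 0 := by rintro rfl; simp at h
    rw [eval₂_eq_sum_range, Finset.sum_range_succ, hp.coeff_natDegree, map_one, one_mul] at hx
    have h1 : v (∑ i ∈ Finset.range p.natDegree, algebraMap A Ω (p.coeff i) * x ^ i) <
        v (x ^ p.natDegree) := by
      refine v.map_sum_lt (v.ne_zero_iff.mpr (pow_ne_zero _ hxn)) fun i hi ↦ ?_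
      rw [map_mul, map_pow, map_pow]
      refine (mul_le_of_le_one_left' (hv.map_algebraMap_le_one _)).trans_lt ?_
      exact pow_lt_pow_right₀ h (Finset.mem_range.mp hi)
    have h2 := v.map_add_eq_of_lt_right h1
    rw [hx, map_zero] at h2
    rw [← h2] at h1
    exact not_lt_zero h1
  · intro h
    obtain ⟨P, hP, hPx⟩ := hv.exists_map_eq_minpoly h
    refine ⟨P, hP, ?_⟩
    rw [← aeval_def, ← aeval_map_algebraMap K, hPx, minpoly.aeval]

lemma map_pow_natDegree (hv : IsDyadic A K v) (x : Ω) :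
    v x ^ (minpoly K x).natDegree = v (algebraMap K Ω ((minpoly K x).coeff 0)) := by
  rw [← coeff_map, map_minpoly_eq_prod_conj, coeff_zero_eq_eval_zero, eval_prod, map_prod,
    ← card_conj, ← Finset.prod_const]
  refine Finset.prod_congr rfl fun z hz ↦ ?_
  simp [hv.map_conj hz]

/-- The product of the conjugates of `x` is, up to sign, in `K`, so the value group of `L` has
denominators dividing `[L : K]`. -/
lemma exists_pow_finrank_eq (hv : IsDyadic A K v) (L : IntermediateField K Ω)
    [FiniteDimensional K L] {x : Ω} (hx : x ∈ L) (hx0 : x ≠ 0) :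
    ∃ n : ℤ, v x ^ Module.finrank K L = 2 ^ n := by
  have h1 : (minpoly K x).natDegree ∣ Module.finrank K L := by
    have := minpoly.degree_dvd (K := K) (x := (⟨x, hx⟩ : L)) (Algebra.IsIntegral.isIntegral _)
    rwa [← minpoly.algebraMap_eq (algebraMap L Ω).injective] at this
  obtain ⟨m, hm⟩ := h1
  have h0 : (minpoly K x).coeff 0 ≠ 0 :=
    minpoly.coeff_zero_ne_zero (Algebra.IsIntegral.isIntegral x) hx0
  obtain ⟨n, hn⟩ := hv.exists_zpow _ h0
  refine ⟨n * m, ?_⟩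
  rw [hm, pow_mul, hv.map_pow_natDegree, hn, zpow_mul, zpow_natCast]

/-- The residue field does not grow: the minimal polynomial has a small value at some `a` in `A`, so
some factor `a - z` is small, and an automorphism carrying `x` to `z` fixes `a`. -/
lemma exists_map_sub_lt_one [IsDomain A] [IsFractionRing A K] (hv : IsDyadic A K v) {x : Ω}
    (hx : v x ≤ 1) : ∃ a : A, v (x - algebraMap A Ω a) < 1 := by
  obtain ⟨P, hP, hPx⟩ := hv.exists_map_eq_minpoly hx
  have hd : P.natDegree ≠ 0 := by
    rw [← hP.natDegree_map (algebraMap A K), hPx]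
    exact (minpoly.natDegree_pos (Algebra.IsIntegral.isIntegral x)).ne'
  obtain ⟨a, ha⟩ := hv.exists_eval_lt_one P hP hd
  have h1 : algebraMap A Ω (P.eval a) = ∏ z ∈ conj K x, (algebraMap A Ω a - z) := by
    rw [← aeval_minpoly_eq_prod_conj, ← hPx, aeval_map_algebraMap, aeval_algebraMap_apply]
    rfl
  rw [h1, map_prod] at ha
  obtain ⟨z, hz, hlt⟩ : ∃ z ∈ conj K x, v (algebraMap A Ω a - z) < 1 := by
    by_contra! h
    exact absurd ha (not_lt.mpr (Finset.one_le_prod' h))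
  obtain ⟨σ, rfl⟩ := (mem_conj_iff K).mp hz
  refine ⟨a, ?_⟩
  rw [v.map_sub_swap, ← hv.map_equiv σ, map_sub, IsScalarTower.algebraMap_apply A K Ω,
    AlgEquiv.commutes, ← IsScalarTower.algebraMap_apply]
  exact hlt

end AlgClosed

end IsDyadic
end Ramification

/-! ### Uniformizers of totally ramified extensions. -/

namespace Ramification

open Polynomial NNReal

variable {A K Ω : Type*} [CommRing A] [IsDomain A] [IsDiscreteValuationRing A] [Field K] [Field Ω]
    [Algebra A K] [IsFractionRing A K] [Algebra K Ω] [Algebra A Ω] [IsScalarTower A K Ω]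
    [IsAlgClosed Ω] [Algebra.IsAlgebraic K Ω] [CharZero K]

variable {v : Valuation Ω ℝ≥0}

/-- `π` is a uniformizer of the totally ramified extension `L` of `K`. -/
structure IsUniformizer (v : Valuation Ω ℝ≥0) (L : IntermediateField K Ω) (π : Ω) : Prop where
  mem : π ∈ L
  pow_finrank : v π ^ Module.finrank K L = 2⁻¹

namespace IsDyadic

variable (L : IntermediateField K Ω) [FiniteDimensional K L]

lemma algebraMap_mem (L : IntermediateField K Ω) (a : A) : algebraMap A Ω a ∈ L := by
  rw [IsScalarTower.algebraMap_apply A K Ω]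
  exact L.algebraMap_mem _

lemma aeval_mem {L : IntermediateField K Ω} (g : A[X]) {x : Ω} (hx : x ∈ L) :
    aeval x g ∈ L := by
  rw [aeval_eq_sum_range]
  refine sum_mem fun i _ ↦ ?_
  rw [Algebra.smul_def]
  exact mul_mem (algebraMap_mem L _) (pow_mem hx i)

lemma two_ne_zero (hv : IsDyadic A K v) : (2 : Ω) ≠ 0 := by
  intro h; have := hv.map_two; simp [h] at this

/-- The first `n` digits of the `π`-adic expansion, with digits in `A` because the residue extension
is trivial. -/
lemma exists_map_sub_aeval_le (hv : IsDyadic A K v) {π : Ω} (hπ : π ∈ L) (h1 : v π < 1)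
    (hval : ∀ x ∈ L, x ≠ 0 → ∃ j : ℤ, v x = v π ^ j) (n : ℕ) {x : Ω} (hx : x ∈ L)
    (hx1 : v x ≤ 1) : ∃ g ∈ degreeLT A n, v (x - aeval π g) ≤ v π ^ n := by
  induction n with
  | zero => exact ⟨0, zero_mem _, by simpa using hx1⟩
  | succ n ih =>
    obtain ⟨g, hg, hgx⟩ := ih
    -- This is impossible: `v 2` would be a power of `0`, hence `0` or `1`.
    by_cases hπ0 : π = 0
    · obtain ⟨j, hj⟩ := hval 2 (ofNat_mem L 2) hv.two_ne_zero
      rw [hv.map_two, hπ0, map_zero] at hj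
      by_cases hj0 : j = 0
      · rw [hj0, zpow_zero] at hj
        have : (2 : ℝ≥0)⁻¹ ≠ 1 := by norm_num
        exact absurd hj this
      · rw [zero_zpow j hj0] at hj
        exact absurd hj (by norm_num)
    have hp : π ^ n ≠ 0 := pow_ne_zero _ hπ0
    set t := (x - aeval π g) / π ^ n with ht
    have htL : t ∈ L := div_mem (sub_mem hx (aeval_mem g hπ)) (pow_mem hπ n)
    have hvp : 0 < v π := (v.pos_iff).mpr hπ0
    have ht1 : v t ≤ 1 := by
      rw [ht, map_div₀, map_pow]
      exact div_le_one_of_le₀ hgx (by positivity)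
    obtain ⟨a, ha⟩ := hv.exists_map_sub_lt_one ht1
    refine ⟨g + C a * X ^ n, ?_, ?_⟩
    · refine add_mem (degreeLT_mono (Nat.le_succ n) hg) ?_
      rw [mem_degreeLT]
      exact (degree_C_mul_X_pow_le n a).trans_lt (by exact_mod_cast Nat.lt_succ_self n)
    · have h2 : x - aeval π (g + C a * X ^ n) = π ^ n * (t - algebraMap A Ω a) := by
        rw [ht]; simp [field]; ring
      rw [h2, map_mul, map_pow, pow_succ]
      gcongr
      by_cases h0 : t - algebraMap A Ω a = 0
      · simp [h0]
      · obtain ⟨j, hj⟩ := hval _ (sub_mem htL (algebraMap_mem L a)) h0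
        rw [hj] at ha ⊢
        have : 0 < j := by
          by_contra! hneg
          exact absurd ha (not_lt.mpr (one_le_zpow_of_nonpos₀ hvp h1.le hneg))
        calc v π ^ j ≤ v π ^ (1 : ℤ) := zpow_le_zpow_right_of_le_one₀ hvp h1.le this
          _ = v π := zpow_one _

lemma two_mem_jacobson (hv : IsDyadic A K v) : Ideal.span {(2 : A)} ≤ Ideal.jacobson ⊥ := by
  rw [Ideal.span_singleton_le_iff_mem, IsLocalRing.jacobson_eq_maximalIdeal ⊥ bot_ne_top,
    IsLocalRing.mem_maximalIdeal, mem_nonunits_iff]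
  rintro ⟨u, hu⟩
  have h1 : v (algebraMap A Ω (u : A)) * v (algebraMap A Ω ((u⁻¹ : Aˣ) : A)) = 1 := by
    rw [← map_mul, ← map_mul, Units.mul_inv, map_one, map_one]
  rw [hu, map_ofNat, hv.map_two] at h1
  have h2 := hv.map_algebraMap_le_one (Ω := Ω) ((u⁻¹ : Aˣ) : A)
  have : (2⁻¹ : ℝ≥0) * v (algebraMap A Ω ((u⁻¹ : Aˣ) : A)) ≤ 2⁻¹ := mul_le_of_le_one_right' h2
  rw [h1] at this
  exact absurd this (not_le.mpr (by norm_num [inv_lt_one₀]))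

/-- Since `v π ^ e = v 2`, an expansion to `e` digits is exact modulo `2`. Nakayama's lemma for the
integral closure, which is finite over `A`, removes the error term. -/
lemma exists_aeval_eq_of_pow_eq (hv : IsDyadic A K v) {π : Ω} (hπ : π ∈ L) {e : ℕ}
    (he : v π ^ e = 2⁻¹) (hval : ∀ x ∈ L, x ≠ 0 → ∃ j : ℤ, v x = v π ^ j) {x : Ω} (hx : x ∈ L)
    (hx1 : v x ≤ 1) : ∃ g ∈ degreeLT A e, aeval π g = x := by
  have h1 : v π < 1 := by
    by_contra! h
    have := one_le_pow₀ h (n := e)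
    rw [he] at this
    exact absurd this (not_le.mpr (by norm_num [inv_lt_one₀]))
  have : Algebra.IsSeparable K L := inferInstance
  have hfin : Module.Finite A (integralClosure A L) :=
    IsIntegralClosure.finite A K L (integralClosure A L)
  let ι : L →ₐ[A] Ω := L.val.restrictScalars A
  let B : Submodule A Ω := (Subalgebra.toSubmodule (integralClosure A L)).map ι.toLinearMap
  have hBfg : B.FG := Submodule.FG.map _ (Module.Finite.iff_fg.mp hfin)
  have hB : ∀ y, y ∈ B ↔ y ∈ L ∧ v y ≤ 1 := by
    intro y
    constructor
    · rintro ⟨z, hz, rfl⟩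
      refine ⟨z.2, hv.isIntegral_iff.mp ?_⟩
      exact IsIntegral.map ι hz
    · rintro ⟨hy, hy1⟩
      refine ⟨⟨y, hy⟩, ?_, rfl⟩
      exact (isIntegral_algHom_iff ι ι.injective).mp (hv.isIntegral_iff.mpr hy1)
  let M : Submodule A Ω := (degreeLT A e).map (aeval π).toLinearMap
  have hBM : B ≤ M := by
    refine Submodule.le_of_le_smul_of_le_jacobson_bot hBfg hv.two_mem_jacobson ?_
    intro y hy
    obtain ⟨hyL, hy1⟩ := (hB y).mp hy
    obtain ⟨g, hg, hgy⟩ := hv.exists_map_sub_aeval_le L hπ h1 hval e hyL hy1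
    rw [he] at hgy
    have h2 : (2 : Ω) ≠ 0 := hv.two_ne_zero
    have : y = aeval π g + (2 : A) • ((y - aeval π g) / 2) := by
      rw [Algebra.smul_def, map_ofNat]; field_simp; ring
    rw [this]
    refine Submodule.add_mem_sup ⟨g, hg, rfl⟩ (Submodule.smul_mem_smul
      (Ideal.mem_span_singleton_self _) ((hB _).mpr ⟨?_, ?_⟩))
    · exact div_mem (sub_mem hyL (aeval_mem g hπ)) (ofNat_mem L 2)
    · rw [map_div₀, hv.map_two]
      exact div_le_one_of_le₀ hgy (by positivity)
  obtain ⟨g, hg, hgx⟩ := hBM ((hB x).mpr ⟨hx, hx1⟩)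
  exact ⟨g, hg, hgx⟩

end IsDyadic

namespace IsUniformizer

variable {L : IntermediateField K Ω} [FiniteDimensional K L] {π : Ω}

lemma map_pos (h : IsUniformizer v L π) : 0 < v π := by
  by_contra! h0
  have h1 := h.pow_finrank
  rw [le_zero_iff.mp h0, zero_pow Module.finrank_pos.ne'] at h1
  exact absurd h1 (by norm_num)

lemma map_lt_one (h : IsUniformizer v L π) : v π < 1 := by
  by_contra! h0
  have := one_le_pow₀ h0 (n := Module.finrank K L)
  rw [h.pow_finrank] at this
  exact absurd this (not_le.mpr (by norm_num [inv_lt_one₀]))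

lemma exists_eq_zpow (hv : IsDyadic A K v) (h : IsUniformizer v L π) {x : Ω} (hx : x ∈ L)
    (hx0 : x ≠ 0) : ∃ j : ℤ, v x = v π ^ j := by
  obtain ⟨n, hn⟩ := hv.exists_pow_finrank_eq L hx hx0
  refine ⟨-n, ?_⟩
  have h1 : v x ^ Module.finrank K L = (v π ^ (-n)) ^ Module.finrank K L := by
    rw [hn, ← zpow_natCast, ← zpow_mul, mul_comm, zpow_mul, zpow_natCast, h.pow_finrank, inv_zpow,
      zpow_neg, inv_inv]
  exact (pow_left_inj₀ zero_le zero_le Module.finrank_pos.ne').mp h1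

lemma exists_aeval_eq (hv : IsDyadic A K v) (h : IsUniformizer v L π) {x : Ω} (hx : x ∈ L)
    (hx1 : v x ≤ 1) : ∃ g : A[X], aeval π g = x := by
  obtain ⟨g, -, hg⟩ := hv.exists_aeval_eq_of_pow_eq L h.mem h.pow_finrank
    (fun x hx hx0 ↦ h.exists_eq_zpow hv hx hx0) hx hx1
  exact ⟨g, hg⟩

/-- A power of `2` makes any element of `L` integral, so `1, π, …, π ^ (e - 1)` span `L` over `K`.
-/
lemma finrank_le_of_aeval {e : ℕ} (hv : IsDyadic A K v)
    (h : ∀ x ∈ L, v x ≤ 1 → ∃ g ∈ degreeLT A e, aeval π g = x) :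
    Module.finrank K L ≤ e := by
  have hspan : L.toSubmodule ≤ (degreeLT K e).map (aeval π).toLinearMap := by
    intro x hx
    obtain ⟨n, hn⟩ : ∃ n : ℕ, v (2 ^ n * x) ≤ 1 := by
      obtain ⟨n, hn⟩ := exists_nat_ge (v x)
      refine ⟨n, ?_⟩
      rw [map_mul, map_pow, hv.map_two, inv_pow, inv_mul_le_iff₀ (by positivity), mul_one]
      exact hn.trans (by exact_mod_cast Nat.lt_two_pow_self.le)
    obtain ⟨g, hg, hgx⟩ := h _ (mul_mem (pow_mem (ofNat_mem L 2) n) hx) hn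
    refine ⟨C ((2 ^ n)⁻¹ : K) * g.map (algebraMap A K), ?_, ?_⟩
    · rw [mem_degreeLT] at hg
      rw [SetLike.mem_coe, mem_degreeLT]
      rw [degree_C_mul (by simp)]
      exact degree_map_le.trans_lt hg
    · have h2 : (2 : Ω) ^ n ≠ 0 := pow_ne_zero _ hv.two_ne_zero
      rw [AlgHom.toLinearMap_apply, map_mul, aeval_C, aeval_map_algebraMap, hgx, map_inv₀, map_pow,
        map_ofNat]
      exact inv_mul_cancel_left₀ h2 x
  have : Module.Finite K (degreeLT K e) := Module.Finite.equiv (degreeLTEquiv K e).symm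
  calc Module.finrank K L = Module.finrank K L.toSubmodule := rfl
    _ ≤ Module.finrank K ((degreeLT K e).map (aeval π).toLinearMap) :=
      Submodule.finrank_mono hspan
    _ ≤ Module.finrank K (degreeLT K e) := Submodule.finrank_map_le _ _
    _ = e := by rw [(degreeLTEquiv K e).finrank_eq]; simp

end IsUniformizer

theorem IsDyadic.exists_isUniformizer (hv : IsDyadic A K v) (L : IntermediateField K Ω)
    [FiniteDimensional K L] : ∃ π, IsUniformizer v L π := by
  classical
  set d := Module.finrank K L with hd
  have hd0 : d ≠ 0 := Module.finrank_pos.ne'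
  -- Take `π` with the least positive exponent `n`. Division with remainder then shows that `v π`
  -- generates the value group of `L`; the goal is `n = 1`.
  have hex : ∃ n : ℕ, 0 < n ∧ ∃ π ∈ L, v π ^ d = 2⁻¹ ^ n :=
    ⟨d, hd0.bot_lt, 2, ofNat_mem L 2, by rw [hv.map_two]⟩
  obtain ⟨hn0, π, hπ, hπn⟩ := Nat.find_spec hex
  have hmin := fun m ↦ Nat.find_min hex (m := m)
  set n := Nat.find hex
  have hpos : 0 < v π := by
    by_contra! h0
    rw [le_zero_iff.mp h0, zero_pow hd0] at hπn
    exact absurd hπn.symm (by positivity)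
  have hval : ∀ x ∈ L, x ≠ 0 → ∃ j : ℤ, v x = v π ^ j := by
    intro x hx hx0
    obtain ⟨m, hm⟩ := hv.exists_pow_finrank_eq L hx hx0
    have hmod : v (x * π ^ ((-m) / (n : ℤ) * (-1))) ^ d = 2⁻¹ ^ ((-m) % (n : ℤ)) := by
      have h1 : (v π ^ ((-m) / (n : ℤ) * (-1))) ^ d = 2 ^ ((-m) / (n : ℤ) * n) := by
        rw [← zpow_natCast, ← zpow_mul, mul_comm, zpow_mul, zpow_natCast, hπn, ← zpow_natCast,
          ← zpow_mul, inv_zpow', mul_neg_one, mul_neg, neg_neg, mul_comm]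
      rw [map_mul, map_zpow₀, mul_pow, hm, h1, ← zpow_add₀ (by norm_num), inv_zpow']
      congr 1
      have := Int.emod_add_mul_ediv (-m) n
      linarith
    have hnn : 0 ≤ (-m) % (n : ℤ) := Int.emod_nonneg _ (by exact_mod_cast hn0.ne')
    have hlt : (-m) % (n : ℤ) < n := Int.emod_lt_of_pos _ (by exact_mod_cast hn0)
    have hr0 : (-m) % (n : ℤ) = 0 := by
      by_contra hne
      refine hmin ((-m) % (n : ℤ)).toNat (by omega) ⟨by omega,
        x * π ^ ((-m) / (n : ℤ) * (-1)), mul_mem hx (zpow_mem hπ _), ?_⟩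
      rw [hmod, ← zpow_natCast, Int.toNat_of_nonneg hnn]
    rw [hr0, zpow_zero] at hmod
    have h1 : v (x * π ^ ((-m) / (n : ℤ) * (-1))) = 1 :=
      (pow_eq_one_iff_of_nonneg zero_le hd0).mp hmod
    refine ⟨(-m) / (n : ℤ), ?_⟩
    rw [map_mul, map_zpow₀, mul_neg_one, zpow_neg] at h1
    exact eq_of_mul_inv_eq_one h1
  obtain ⟨j, hj⟩ := hval 2 (ofNat_mem L 2) hv.two_ne_zero
  have hπ1 : v π < 1 := by
    rw [← pow_lt_one_iff_of_nonneg zero_le hd0, hπn]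
    exact pow_lt_one₀ (by positivity) (by norm_num [inv_lt_one₀]) hn0.ne'
  have hj0 : 0 ≤ j := by
    by_contra! h
    have := one_le_zpow_of_nonpos₀ hpos hπ1.le h.le
    rw [← hj, hv.map_two] at this
    exact absurd this (not_le.mpr (by norm_num [inv_lt_one₀]))
  obtain ⟨e, rfl⟩ := Int.eq_ofNat_of_zero_le hj0
  rw [hv.map_two, zpow_natCast] at hj
  -- Here `v 2 = v π ^ e`, so `d = n * e`, while `d ≤ e` because the residue extension is trivial.
  have hle := IsUniformizer.finrank_le_of_aeval (L := L) hv fun x hx hx1 ↦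
    hv.exists_aeval_eq_of_pow_eq L hπ hj.symm hval hx hx1
  have hde : d = n * e := by
    have h2 : (2⁻¹ : ℝ≥0) ^ d = 2⁻¹ ^ (n * e) := by
      conv_lhs => rw [hj]
      rw [← pow_mul, mul_comm, pow_mul, hπn, pow_mul]
    exact pow_right_injective₀ (by positivity) (by norm_num) h2
  have he0 : 0 < e := hd0.bot_lt.trans_le hle
  have hn1 : n = 1 := by nlinarith
  exact ⟨π, hπ, by rw [← hd, hπn, hn1, pow_one]⟩
namespace IsUniformizer

variable {L : IntermediateField K Ω} [FiniteDimensional K L] {π : Ω}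

lemma adjoin_eq (hv : IsDyadic A K v) (h : IsUniformizer v L π) :
    IntermediateField.adjoin K {π} = L := by
  refine le_antisymm (IntermediateField.adjoin_simple_le_iff.mpr h.mem) fun x hx ↦ ?_
  obtain ⟨n, hn⟩ : ∃ n : ℕ, v (2 ^ n * x) ≤ 1 := by
    obtain ⟨n, hn⟩ := exists_nat_ge (v x)
    refine ⟨n, ?_⟩
    rw [map_mul, map_pow, hv.map_two, inv_pow, inv_mul_le_iff₀ (by positivity), mul_one]
    exact hn.trans (by exact_mod_cast Nat.lt_two_pow_self.le)
  have h2 : (2 : Ω) ^ n ≠ 0 := pow_ne_zero _ hv.two_ne_zero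
  obtain ⟨g, hg⟩ := h.exists_aeval_eq hv (mul_mem (pow_mem (ofNat_mem L 2) n) hx) hn
  have h3 : x = ((2 : Ω) ^ n)⁻¹ * aeval π g := by
    rw [hg]
    exact (inv_mul_cancel_left₀ h2 x).symm
  rw [h3]
  exact mul_mem (inv_mem (pow_mem (ofNat_mem _ 2) n))
    (IsDyadic.aeval_mem g (IntermediateField.mem_adjoin_simple_self K π))

lemma natDegree_minpoly (hv : IsDyadic A K v) (h : IsUniformizer v L π) :
    (minpoly K π).natDegree = Module.finrank K L := by
  rw [← IntermediateField.adjoin.finrank (Algebra.IsIntegral.isIntegral π), h.adjoin_eq hv]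

end IsUniformizer

/-- Eisenstein's criterion in terms of values: the ramification caused by `x` alone forces
`P.natDegree` to divide the degree of `x`. -/
lemma IsDyadic.minpoly_eq_of_pow_natDegree (hv : IsDyadic A K v) {x : Ω} {P : K[X]}
    (hP : P.Monic) (hx : aeval x P = 0) (hvx : v x ^ P.natDegree = 2⁻¹) : minpoly K x = P := by
  have hint : IsIntegral K x := Algebra.IsIntegral.isIntegral x
  have hd0 : P.natDegree ≠ 0 := by
    intro h
    rw [h, pow_zero] at hvx
    exact absurd hvx (by norm_num)
  have hx0 : x ≠ 0 := by
    rintro rfl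
    rw [map_zero, zero_pow hd0] at hvx
    exact absurd hvx (by norm_num)
  obtain ⟨n, hn⟩ := hv.exists_zpow _ (minpoly.coeff_zero_ne_zero hint hx0)
  rw [← hv.map_pow_natDegree] at hn
  have h1 : (2 : ℝ≥0) ^ (n * P.natDegree) = 2 ^ (-((minpoly K x).natDegree : ℤ)) := by
    rw [zpow_mul, ← hn, zpow_natCast, ← pow_mul, mul_comm, pow_mul, hvx, zpow_neg, zpow_natCast,
      inv_pow]
  have h2 : n * P.natDegree = -((minpoly K x).natDegree : ℤ) :=
    zpow_right_injective₀ (by norm_num) (by norm_num) h1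
  have h3 : P.natDegree ∣ (minpoly K x).natDegree := by
    rw [← Int.natCast_dvd_natCast]
    exact ⟨-n, by linarith⟩
  exact (eq_of_monic_of_dvd_of_natDegree_le (minpoly.monic hint) hP (minpoly.dvd K x hx)
    (Nat.le_of_dvd (minpoly.natDegree_pos hint) h3)).symm

lemma IsDyadic.isUniformizer_adjoin (hv : IsDyadic A K v) {x : Ω} {P : K[X]}
    (hP : P.Monic) (hx : aeval x P = 0) (hvx : v x ^ P.natDegree = 2⁻¹) :
    IsUniformizer v (IntermediateField.adjoin K {x}) x := by
  refine ⟨IntermediateField.mem_adjoin_simple_self K x, ?_⟩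
  rw [IntermediateField.adjoin.finrank (Algebra.IsIntegral.isIntegral x),
    hv.minpoly_eq_of_pow_natDegree hP hx hvx, hvx]

end Ramification

/-! ### Herbrand's theorem, in terms of conjugates. -/

namespace Ramification

open Polynomial NNReal

variable {A K Ω : Type*} [CommRing A] [IsDomain A] [IsDiscreteValuationRing A] [Field K] [Field Ω]
    [Algebra A K] [IsFractionRing A K] [Algebra K Ω] [Algebra A Ω] [IsScalarTower A K Ω]
    [IsAlgClosed Ω] [Algebra.IsAlgebraic K Ω] [CharZero K]

variable {v : Valuation Ω ℝ≥0}

lemma mem_of_forall_fixed (T : IntermediateField K Ω) {c : Ω}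
    (h : ∀ τ : Ω ≃ₐ[K] Ω, (∀ t ∈ T, τ t = t) → τ c = c) : c ∈ T := by
  have : IsAlgClosure K Ω := ⟨inferInstance, inferInstance⟩
  have : IsGalois K Ω := IsAlgClosure.isGalois K Ω
  rw [← InfiniteGalois.fixedField_fixingSubgroup T, IntermediateField.mem_fixedField_iff]
  intro τ hτ
  exact h τ fun t ht ↦ (IntermediateField.mem_fixingSubgroup_iff T τ).mp hτ t ht

lemma conj_aeval (g : A[X]) (σ : Ω ≃ₐ[K] Ω) (x : Ω) : σ (aeval x g) = aeval (σ x) g := by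
  have := aeval_algHom_apply (σ.toAlgHom.restrictScalars A) x g
  exact this.symm

lemma equiv_mem_conj {x z : Ω} (σ : Ω ≃ₐ[K] Ω) (hz : z ∈ conj K x) : σ z ∈ conj K x := by
  obtain ⟨τ, rfl⟩ := (mem_conj_iff K).mp hz
  exact (mem_conj_iff K).mpr ⟨σ * τ, rfl⟩

variable (K v) in
/-- `∏ max (v (z - x)) r` over the conjugates `z` of `x`.  For a uniformizer `x` of `L`, this
is the value at `r` of the (multiplicatively written) Herbrand function of `L / K`. -/
noncomputable def herbrand (x : Ω) (r : ℝ≥0) : ℝ≥0 := ∏ z ∈ conj K x, max (v (z - x)) r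

lemma herbrand_mono (x : Ω) : Monotone (herbrand K v x) := fun _ _ h ↦
  Finset.prod_le_prod' fun _ _ ↦ max_le_max le_rfl h

variable (K) in
open Classical in
/-- The conjugates of `x` at which the polynomial `g` takes the value `w`. -/
noncomputable def conjFiber (g : A[X]) (x w : Ω) : Finset Ω := (conj K x).filter (aeval · g = w)

lemma mem_conjFiber {g : A[X]} {x w z : Ω} :
    z ∈ conjFiber K g x w ↔ z ∈ conj K x ∧ aeval z g = w := by
  simp [conjFiber]

lemma prod_conjFiber_equiv {M : Type*} [CommMonoid M] (σ : Ω ≃ₐ[K] Ω) (g : A[X]) (x w : Ω)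
    (f : Ω → M) : ∏ z ∈ conjFiber K g x (σ w), f z = ∏ z ∈ conjFiber K g x w, f (σ z) := by
  symm
  refine Finset.prod_bij (fun z _ ↦ σ z) ?_ (fun _ _ _ _ h ↦ σ.injective h) ?_ (fun _ _ ↦ rfl)
  · intro z hz
    rw [mem_conjFiber] at hz ⊢
    exact ⟨equiv_mem_conj σ hz.1, by rw [← conj_aeval, hz.2]⟩
  · intro z hz
    rw [mem_conjFiber] at hz
    refine ⟨σ.symm z, mem_conjFiber.mpr ⟨equiv_mem_conj σ.symm hz.1, ?_⟩, by simp⟩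
    rw [← conj_aeval, hz.2]; simp

namespace IsDyadic

/-- If `g` has integral coefficients and takes the value `c` at the distinct integral elements
`z ∈ s`, then `∏ (x - z)` divides `g x - c`. -/
lemma map_aeval_sub_le_prod (hv : IsDyadic A K v) (g : A[X]) {s : Finset Ω} {x c : Ω}
    (hx : v x ≤ 1) (hc : v c ≤ 1) (hs : ∀ z ∈ s, v z ≤ 1 ∧ aeval z g = c) :
    v (aeval x g - c) ≤ ∏ z ∈ s, v (z - x) := by
  classical
  let φ : A →+* v.integer := (algebraMap A Ω).codRestrict v.integer hv.map_algebraMap_le_one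
  let p : Polynomial v.integer := g.map φ - C ⟨c, hc⟩
  have hp : ∀ (z : Ω) (hz : v z ≤ 1), ((p.eval ⟨z, hz⟩ : v.integer) : Ω) = aeval z g - c := by
    intro z hz
    have h1 : (((g.map φ).eval ⟨z, hz⟩ : v.integer) : Ω) = aeval z g := by
      rw [eval_map, ← v.integer.subtype_apply, hom_eval₂]
      rfl
    rw [eval_sub, eval_C]
    simp [h1]
  by_cases hp0 : p = 0
  · have := hp x hx
    rw [hp0, eval_zero] at this
    rw [← this]; simp
  let t : Finset v.integer := s.attach.image fun z ↦ ⟨z.1, (hs z.1 z.2).1⟩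
  have ht : t.val ≤ p.roots := by
    rw [Multiset.le_iff_subset t.nodup]
    intro z hz
    obtain ⟨z, -, rfl⟩ := Finset.mem_image.mp hz
    rw [mem_roots hp0, IsRoot.def, ← Subtype.coe_inj, hp, (hs z.1 z.2).2]
    simp
  obtain ⟨q, hq⟩ := (Multiset.prod_X_sub_C_dvd_iff_le_roots hp0 t.val).mpr ht
  have h2 : aeval x g - c = (∏ z ∈ s, (x - z)) * (q.eval ⟨x, hx⟩ : v.integer) := by
    rw [← hp x hx]
    conv_lhs => rw [hq]
    rw [eval_mul]
    push_cast
    congr 1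
    have h3 : (t.val.map fun a ↦ (X - C a : Polynomial v.integer)).prod = ∏ a ∈ t, (X - C a) := rfl
    rw [h3, eval_prod, Finset.prod_image]
    · simp only [eval_sub, eval_X, eval_C]
      push_cast
      exact Finset.prod_attach s fun z ↦ x - z
    · intro a _ b _ hab
      exact Subtype.ext (congrArg (fun y : v.integer ↦ (y : Ω)) hab)
  rw [h2, map_mul, map_prod]
  refine (mul_le_of_le_one_right' (q.eval (⟨x, hx⟩ : v.integer)).2).trans_eq ?_
  exact Finset.prod_congr rfl fun z _ ↦ v.map_sub_swap _ _

variable {T L : IntermediateField K Ω} [FiniteDimensional K T] [FiniteDimensional K L] {x y : Ω}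

/-- Let `f` be the product of `X - z` over the conjugates `z` of `x` lying above `y`. Its
coefficients lie in `A[y]`, so `σ y - y` divides every coefficient of `σ f - f`; evaluating at the
root `x` of `f` gives the bound. -/
lemma prod_conjFiber_le (hv : IsDyadic A K v) (hy : IsUniformizer v T y)
    (hx : IsUniformizer v L x) {g : A[X]} (hg : aeval x g = y) (σ : Ω ≃ₐ[K] Ω) :
    ∏ z ∈ conjFiber K g x (σ y), v (z - x) ≤ v (σ y - y) := by
  set s := conjFiber K g x y with hs
  have hxs : x ∈ s := mem_conjFiber.mpr ⟨self_mem_conj K x, hg⟩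
  let f : Polynomial Ω := ∏ z ∈ s, (X - C z)
  have hsv : ∀ z ∈ s, v z ≤ 1 := fun z hz ↦
    (hv.map_conj (mem_conjFiber.mp hz).1).trans_le hx.map_lt_one.le
  have hcoef : ∀ i, v (σ (f.coeff i) - f.coeff i) ≤ v (σ y - y) := by
    intro i
    have hT : f.coeff i ∈ T := by
      refine mem_of_forall_fixed T fun τ hτ ↦ ?_
      have h1 : f.map (τ : Ω →+* Ω) = f := by
        rw [Polynomial.map_prod]
        have := prod_conjFiber_equiv τ g x y fun z ↦ (X - C z : Polynomial Ω)
        rw [hτ y hy.mem] at this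
        refine Eq.trans ?_ this.symm
        simp [s]
      conv_rhs => rw [← h1]
      rw [coeff_map]; rfl
    obtain ⟨r, hr⟩ := hy.exists_aeval_eq hv hT (map_coeff_prod_le_one hsv i)
    rw [← hr, conj_aeval]
    refine hv.map_aeval_sub_aeval_le r ?_ hy.map_lt_one.le
    rw [hv.map_equiv]
    exact hy.map_lt_one.le
  have hfx : f.eval x = 0 := by
    rw [eval_prod]
    exact Finset.prod_eq_zero hxs (by simp)
  have h2 : v ((f.map (σ : Ω →+* Ω)).eval x) = ∏ z ∈ conjFiber K g x (σ y), v (z - x) := by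
    rw [prod_conjFiber_equiv, Polynomial.map_prod, eval_prod, map_prod]
    refine Finset.prod_congr rfl fun z _ ↦ ?_
    simp [v.map_sub_swap]
  rw [← h2, ← sub_zero (eval x _), ← hfx, ← eval_sub, eval_eq_sum_range]
  refine v.map_sum_le fun i _ ↦ ?_
  rw [map_mul, map_pow, coeff_sub, coeff_map]
  exact (mul_le_of_le_one_right' (pow_le_one' hx.map_lt_one.le i)).trans (hcoef i)

/-- The valuation of `σ y - y` for a uniformizer `y` of a subfield, in terms of a uniformizer `x`
of the larger field. -/
lemma map_equiv_sub_eq_prod (hv : IsDyadic A K v) (hy : IsUniformizer v T y)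
    (hx : IsUniformizer v L x) {g : A[X]} (hg : aeval x g = y) (σ : Ω ≃ₐ[K] Ω) :
    v (σ y - y) = ∏ z ∈ conjFiber K g x (σ y), v (z - x) := by
  refine le_antisymm ?_ (hv.prod_conjFiber_le hy hx hg σ)
  have h := hv.map_aeval_sub_le_prod g (s := conjFiber K g x (σ y)) (c := σ y)
    hx.map_lt_one.le ?_ fun z hz ↦ ?_
  · rwa [hg, v.map_sub_swap] at h
  · rw [hv.map_equiv]; exact hy.map_lt_one.le
  · rw [mem_conjFiber] at hz
    exact ⟨(hv.map_conj hz.1).trans_le hx.map_lt_one.le, hz.2⟩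

lemma exists_closest {g : A[X]} (hg : aeval x g = y) {w : Ω} (hw : w ∈ conj K y) :
    ∃ z ∈ conjFiber K g x w, ∀ z' ∈ conjFiber K g x w, v (z - x) ≤ v (z' - x) := by
  refine Finset.exists_min_image _ _ ?_
  obtain ⟨σ, rfl⟩ := (mem_conj_iff K).mp hw
  exact ⟨σ x, mem_conjFiber.mpr ⟨(mem_conj_iff K).mpr ⟨σ, rfl⟩, by rw [← conj_aeval, hg]⟩⟩

lemma map_sub_eq_max {a b c : Ω} (h : v (b - c) ≤ v (a - c)) :
    v (a - c) = max (v (a - b)) (v (b - c)) := by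
  refine le_antisymm ?_ (max_le ?_ h)
  · rw [← sub_add_sub_cancel a b c]
    exact v.map_add _ _
  · rw [← sub_sub_sub_cancel_right a b c]
    exact (v.map_sub _ _).trans_eq (max_eq_left h)

/-- The fibre over `w` is a translate `σ` of the fibre over `y`. With base point the member `z = σ
x` nearest to `x`, the ultrametric inequality gives `v (σ z' - x) = max (v (z' - x)) (v (z - x))`.
-/
lemma prod_conjFiber_max (hv : IsDyadic A K v) {g : A[X]} (hg : aeval x g = y) {z w : Ω}
    (hz : z ∈ conjFiber K g x w)
    (hmin : ∀ z' ∈ conjFiber K g x w, v (z - x) ≤ v (z' - x)) (r : ℝ≥0) :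
    ∏ z' ∈ conjFiber K g x w, max (v (z' - x)) r =
      ∏ z' ∈ conjFiber K g x y, max (v (z' - x)) (max (v (z - x)) r) := by
  obtain ⟨hzx, hzw⟩ := mem_conjFiber.mp hz
  obtain ⟨σ, rfl⟩ := (mem_conj_iff K).mp hzx
  rw [← conj_aeval, hg] at hzw
  subst hzw
  rw [prod_conjFiber_equiv]
  refine Finset.prod_congr rfl fun z' hz' ↦ ?_
  have h1 : σ z' ∈ conjFiber K g x (σ y) := by
    rw [mem_conjFiber] at hz' ⊢
    exact ⟨equiv_mem_conj σ hz'.1, by rw [← conj_aeval, hz'.2]⟩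
  rw [map_sub_eq_max (hmin _ h1), ← map_sub, hv.map_equiv, max_assoc]

/-- Herbrand's theorem: compatibility of the upper numbering with passage to a subfield. -/
theorem herbrand_eq (hv : IsDyadic A K v) (hy : IsUniformizer v T y)
    (hx : IsUniformizer v L x) {g : A[X]} (hg : aeval x g = y) {w z : Ω}
    (hz : z ∈ conjFiber K g x w)
    (hmin : ∀ z' ∈ conjFiber K g x w, v (z - x) ≤ v (z' - x)) :
    herbrand K v y (v (w - y)) = herbrand K v x (v (z - x)) := by
  classical
  have hwy : w ∈ conj K y := by
    obtain ⟨hzx, rfl⟩ := mem_conjFiber.mp hz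
    obtain ⟨σ, rfl⟩ := (mem_conj_iff K).mp hzx
    exact (mem_conj_iff K).mpr ⟨σ, by rw [← conj_aeval, hg]⟩
  -- `Φ` is the Herbrand function of `L / T`, and the theorem is transitivity, `φ_{L/K} = φ_{T/K} ∘
  -- φ_{L/T}`.
  let Φ : ℝ≥0 → ℝ≥0 := fun r ↦ ∏ z' ∈ conjFiber K g x y, max (v (z' - x)) r
  have hΦ : Monotone Φ := fun _ _ h ↦ Finset.prod_le_prod' fun _ _ ↦ max_le_max le_rfl h
  have key : ∀ w' ∈ conj K y, ∀ z' ∈ conjFiber K g x w',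
      (∀ z'' ∈ conjFiber K g x w', v (z' - x) ≤ v (z'' - x)) → v (w' - y) = Φ (v (z' - x)) := by
    intro w' hw' z' hz' hmin'
    obtain ⟨σ, rfl⟩ := (mem_conj_iff K).mp hw'
    rw [hv.map_equiv_sub_eq_prod hy hx hg σ]
    have := hv.prod_conjFiber_max hg hz' hmin' 0
    simpa using this
  have hmaps : ∀ z' ∈ conj K x, aeval z' g ∈ conj K y := by
    intro z' hz'
    obtain ⟨σ, rfl⟩ := (mem_conj_iff K).mp hz'
    exact (mem_conj_iff K).mpr ⟨σ, by rw [← conj_aeval, hg]⟩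
  -- Group the conjugates of `x` by their images in `T`. Each fibre contributes a value of `Φ` at a
  -- maximum, and the monotone `Φ` commutes with `max`.
  rw [herbrand, herbrand, ← Finset.prod_fiberwise_of_maps_to hmaps]
  refine Finset.prod_congr rfl fun w' hw' ↦ ?_
  obtain ⟨z', hz', hmin'⟩ := exists_closest (v := v) hg hw'
  have h1 := hv.prod_conjFiber_max hg hz' hmin' (v (z - x))
  rw [key w' hw' z' hz' hmin', key w hwy z hz hmin, ← hΦ.map_max]
  refine h1.symm.trans ?_
  exact Finset.prod_congr (by ext; simp [conjFiber]) fun _ _ ↦ rfl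

end IsDyadic
end Ramification

/-! ### Upper breaks of subfields and composita. -/

namespace Ramification

open Polynomial NNReal

variable {A K Ω : Type*} [CommRing A] [IsDomain A] [IsDiscreteValuationRing A] [Field K] [Field Ω]
    [Algebra A K] [IsFractionRing A K] [Algebra K Ω] [Algebra A Ω] [IsScalarTower A K Ω]
    [IsAlgClosed Ω] [Algebra.IsAlgebraic K Ω] [CharZero K]

variable {v : Valuation Ω ℝ≥0}

/-- The upper ramification breaks of `L / K` are at most `h`. -/
def UpperLE (v : Valuation Ω ℝ≥0) (L : IntermediateField K Ω) (h : ℝ) : Prop :=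
  ∀ x, IsUniformizer v L x → ∀ z ∈ conj K x, z ≠ x →
    (2 : ℝ≥0) ^ (-(h + 1)) ≤ herbrand K v x (v (z - x))

/-- Some upper ramification break of `L / K` is at least `h`. -/
def UpperGE (v : Valuation Ω ℝ≥0) (L : IntermediateField K Ω) (h : ℝ) : Prop :=
  ∀ x, IsUniformizer v L x → ∃ z ∈ conj K x, z ≠ x ∧
    herbrand K v x (v (z - x)) ≤ (2 : ℝ≥0) ^ (-(h + 1))

lemma UpperLE.weaken {L : IntermediateField K Ω} {h h' : ℝ} (hL : UpperLE v L h) (hh : h ≤ h') :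
    UpperLE v L h' := fun x hx z hz hzx ↦
  (NNReal.rpow_le_rpow_of_exponent_le (by norm_num) (by linarith)).trans (hL x hx z hz hzx)

section Subfield

variable {T L : IntermediateField K Ω} [FiniteDimensional K T] [FiniteDimensional K L] {x y : Ω}

/-- Every upper break of a subfield is an upper break of the field: lift `w` to the nearest
conjugate of `x` above it. -/
lemma IsUniformizer.exists_herbrand_eq (hv : IsDyadic A K v) (hTL : T ≤ L)
    (hy : IsUniformizer v T y) (hx : IsUniformizer v L x) {w : Ω} (hw : w ∈ conj K y)
    (hwy : w ≠ y) :
    ∃ z ∈ conj K x, z ≠ x ∧ herbrand K v y (v (w - y)) = herbrand K v x (v (z - x)) := by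
  obtain ⟨g, hg⟩ := hx.exists_aeval_eq hv (hTL hy.mem) hy.map_lt_one.le
  obtain ⟨z, hz, hmin⟩ := IsDyadic.exists_closest (v := v) hg hw
  refine ⟨z, (mem_conjFiber.mp hz).1, ?_, hv.herbrand_eq hy hx hg hz hmin⟩
  rintro rfl
  exact hwy ((mem_conjFiber.mp hz).2.symm.trans hg)

/-- The index of `σ` on `T` is the best index among its extensions to `L`. A smaller value means a
larger index. -/
lemma IsUniformizer.herbrand_le (hv : IsDyadic A K v) (hTL : T ≤ L) (hy : IsUniformizer v T y)
    (hx : IsUniformizer v L x) (σ : Ω ≃ₐ[K] Ω) :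
    herbrand K v y (v (σ y - y)) ≤ herbrand K v x (v (σ x - x)) := by
  obtain ⟨g, hg⟩ := hx.exists_aeval_eq hv (hTL hy.mem) hy.map_lt_one.le
  obtain ⟨z, hz, hmin⟩ := IsDyadic.exists_closest (v := v) hg ((mem_conj_iff K).mpr ⟨σ, rfl⟩)
  rw [hv.herbrand_eq hy hx hg hz hmin]
  refine herbrand_mono x (hmin _ (mem_conjFiber.mpr ⟨(mem_conj_iff K).mpr ⟨σ, rfl⟩, ?_⟩))
  rw [← conj_aeval, hg]

lemma UpperLE.mono (hv : IsDyadic A K v) (hTL : T ≤ L) {h : ℝ} (hL : UpperLE v L h) :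
    UpperLE v T h := by
  intro y hy w hw hwy
  obtain ⟨x, hx⟩ := hv.exists_isUniformizer L
  obtain ⟨z, hz, hzx, he⟩ := hy.exists_herbrand_eq hv hTL hx hw hwy
  rw [he]
  exact hL x hx z hz hzx

lemma UpperGE.of_exists (hv : IsDyadic A K v) (hTL : T ≤ L) {h : ℝ} (hy : IsUniformizer v T y)
    (hyz : ∃ z ∈ conj K y, z ≠ y ∧ herbrand K v y (v (z - y)) ≤ (2 : ℝ≥0) ^ (-(h + 1))) :
    UpperGE v L h := by
  intro x hx
  obtain ⟨w, hw, hwy, hle⟩ := hyz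
  obtain ⟨z, hz, hzx, he⟩ := hy.exists_herbrand_eq hv hTL hx hw hwy
  exact ⟨z, hz, hzx, he ▸ hle⟩

lemma UpperGE.mono (hv : IsDyadic A K v) (hTL : T ≤ L) {h : ℝ} (hT : UpperGE v T h) :
    UpperGE v L h := by
  obtain ⟨y, hy⟩ := hv.exists_isUniformizer T
  exact UpperGE.of_exists hv hTL hy (hT y hy)

lemma map_ne_or_map_ne (hv : IsDyadic A K v) {L₁ L₂ : IntermediateField K Ω}
    [FiniteDimensional K L₁] [FiniteDimensional K L₂] {y₁ y₂ : Ω} (h₁ : IsUniformizer v L₁ y₁)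
    (h₂ : IsUniformizer v L₂ y₂) (hx : x ∈ L₁ ⊔ L₂) {σ : Ω ≃ₐ[K] Ω} (hσ : σ x ≠ x) :
    σ y₁ ≠ y₁ ∨ σ y₂ ≠ y₂ := by
  by_contra! hcon
  have h : L₁ ⊔ L₂ ≤ IntermediateField.fixedField (Subgroup.zpowers σ) := by
    rw [← h₁.adjoin_eq hv, ← h₂.adjoin_eq hv, sup_le_iff, IntermediateField.adjoin_simple_le_iff,
      IntermediateField.adjoin_simple_le_iff, IntermediateField.mem_fixedField_iff,
      IntermediateField.mem_fixedField_iff]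
    constructor
    · intro f hf
      have : Subgroup.zpowers σ ≤ MulAction.stabilizer (Ω ≃ₐ[K] Ω) y₁ := by
        rw [Subgroup.zpowers_le]; exact hcon.1
      exact this hf
    · intro f hf
      have : Subgroup.zpowers σ ≤ MulAction.stabilizer (Ω ≃ₐ[K] Ω) y₂ := by
        rw [Subgroup.zpowers_le]; exact hcon.2
      exact this hf
  exact hσ ((IntermediateField.mem_fixedField_iff _ _).mp (h hx) σ (Subgroup.mem_zpowers σ))

/-- An automorphism nontrivial on the compositum is nontrivial on one factor, where its index is at
least as large and is bounded by `h`. -/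
lemma UpperLE.sup (hv : IsDyadic A K v) {L₁ L₂ : IntermediateField K Ω}
    [FiniteDimensional K L₁] [FiniteDimensional K L₂] {h : ℝ} (h₁ : UpperLE v L₁ h)
    (h₂ : UpperLE v L₂ h) : UpperLE v (L₁ ⊔ L₂) h := by
  intro x hx z hz hzx
  obtain ⟨σ, rfl⟩ := (mem_conj_iff K).mp hz
  obtain ⟨y₁, hy₁⟩ := hv.exists_isUniformizer L₁
  obtain ⟨y₂, hy₂⟩ := hv.exists_isUniformizer L₂
  rcases map_ne_or_map_ne hv hy₁ hy₂ hx.mem hzx with hne | hne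
  · exact (h₁ y₁ hy₁ _ ((mem_conj_iff K).mpr ⟨σ, rfl⟩) hne).trans
      (hy₁.herbrand_le hv le_sup_left hx σ)
  · exact (h₂ y₂ hy₂ _ ((mem_conj_iff K).mpr ⟨σ, rfl⟩) hne).trans
      (hy₂.herbrand_le hv le_sup_right hx σ)

/-- An automorphism of index at least `h` on the compositum must be trivial on `L₂`, whose breaks
are smaller than `h`; hence it moves `L₁`, again with index at least `h`. -/
lemma UpperGE.of_sup (hv : IsDyadic A K v) {L₁ L₂ : IntermediateField K Ω}
    [FiniteDimensional K L₁] [FiniteDimensional K L₂] {h h' : ℝ} (hGE : UpperGE v (L₁ ⊔ L₂) h)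
    (h₂ : UpperLE v L₂ h') (hlt : h' < h) : UpperGE v L₁ h := by
  intro y₁ hy₁
  obtain ⟨y₂, hy₂⟩ := hv.exists_isUniformizer L₂
  obtain ⟨x, hx⟩ := hv.exists_isUniformizer (L₁ ⊔ L₂)
  obtain ⟨z, hz, hzx, hle⟩ := hGE x hx
  obtain ⟨σ, rfl⟩ := (mem_conj_iff K).mp hz
  rcases map_ne_or_map_ne hv hy₁ hy₂ hx.mem hzx with hne | hne
  · exact ⟨σ y₁, (mem_conj_iff K).mpr ⟨σ, rfl⟩, hne,
      (hy₁.herbrand_le hv le_sup_left hx σ).trans hle⟩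
  · have h1 := ((h₂ y₂ hy₂ _ ((mem_conj_iff K).mpr ⟨σ, rfl⟩) hne).trans
      (hy₂.herbrand_le hv le_sup_right hx σ)).trans hle
    exact absurd h1 (not_le.mpr (NNReal.rpow_lt_rpow_of_exponent_lt (by norm_num) (by linarith)))

/-- A lower bound for the largest upper break from the valuation of the different. -/
lemma UpperGE.of_derivative (hv : IsDyadic A K v) {h : ℝ} (hx : IsUniformizer v L x) {z : Ω}
    (hz : z ∈ conj K x) (hzx : z ≠ x)
    (hle : v (aeval x (derivative (minpoly K x))) * v (z - x) ≤ (2 : ℝ≥0) ^ (-(h + 1))) :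
    UpperGE v L h := by
  classical
  obtain ⟨z₀, hz₀, hmin⟩ := Finset.exists_min_image ((conj K x).erase x) (fun w ↦ v (w - x))
    ⟨z, Finset.mem_erase.mpr ⟨hzx, hz⟩⟩
  obtain ⟨hne, hz₀x⟩ := Finset.mem_erase.mp hz₀
  refine UpperGE.of_exists hv le_rfl hx ⟨z₀, hz₀x, hne, le_trans (le_of_eq ?_)
    ((mul_le_mul_right (hmin z (Finset.mem_erase.mpr ⟨hzx, hz⟩)) _).trans hle)⟩
  rw [herbrand, ← Finset.mul_prod_erase _ _ (self_mem_conj K x), mul_comm,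
    aeval_derivative_minpoly_eq_prod_conj, map_prod]
  congr 1
  · refine Finset.prod_congr rfl fun w hw ↦ ?_
    rw [max_eq_left (hmin w hw), v.map_sub_swap]
  · simp

end Subfield

end Ramification

/-! ### The functions `phi` and `psi` and the conductor. -/

namespace Ramification

open Polynomial NNReal

section Conductor

variable (A K L : Type*) [CommRing A] [Field K] [Field L] [Algebra A K] [Algebra K L] [Algebra A L]
  [IsScalarTower A K L] [FiniteDimensional K L]

lemma lowerGroup_antitone : Antitone (lowerGroup A K L) := by
  intro s t hst g hg π hπ
  exact Ideal.pow_le_pow_right (by gcongr) (hg π hπ)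

/-- The integrand in the definition of the Herbrand function. -/
lemma antitone_card_div : Antitone fun t : ℝ ↦
    (Nat.card (lowerGroup A K L t) : ℝ) / Nat.card (lowerGroup A K L 0) := by
  intro s t hst
  dsimp only
  gcongr
  exact Nat.card_mono (Set.toFinite _) (lowerGroup_antitone A K L hst)

lemma inv_le_card_div (t : ℝ) : (Nat.card (lowerGroup A K L 0) : ℝ)⁻¹ ≤
    (Nat.card (lowerGroup A K L t) : ℝ) / Nat.card (lowerGroup A K L 0) := by
  rw [← one_div]
  gcongr
  exact_mod_cast Nat.card_pos

lemma phi_sub_phi (s t : ℝ) : phi A K L t - phi A K L s = ∫ x in s..t,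
    (Nat.card (lowerGroup A K L x) : ℝ) / Nat.card (lowerGroup A K L 0) :=
  intervalIntegral.integral_interval_sub_left
    (antitone_card_div A K L).intervalIntegrable (antitone_card_div A K L).intervalIntegrable

lemma mul_sub_le_phi_sub {s t : ℝ} (hst : s ≤ t) :
    (Nat.card (lowerGroup A K L 0) : ℝ)⁻¹ * (t - s) ≤ phi A K L t - phi A K L s := by
  rw [phi_sub_phi, mul_comm, ← smul_eq_mul, ← intervalIntegral.integral_const]
  exact intervalIntegral.integral_mono_on hst intervalIntegrable_const
    (antitone_card_div A K L).intervalIntegrable fun x _ ↦ inv_le_card_div A K L x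

lemma phi_zero : phi A K L 0 = 0 := intervalIntegral.integral_same

lemma card_lowerGroup_inv_pos : 0 < (Nat.card (lowerGroup A K L 0) : ℝ)⁻¹ := by
  have : 0 < Nat.card (lowerGroup A K L 0) := Nat.card_pos
  positivity

lemma phi_strictMono : StrictMono (phi A K L) := by
  intro s t hst
  have h1 := mul_sub_le_phi_sub A K L hst.le
  have h2 := mul_pos (card_lowerGroup_inv_pos A K L) (sub_pos.mpr hst)
  linarith

lemma phi_continuous : Continuous (phi A K L) :=
  intervalIntegral.continuous_primitive
    (fun _ _ ↦ (antitone_card_div A K L).intervalIntegrable) 0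

/-- The integrand is bounded below by a positive constant, so `phi` is unbounded and reaches `i`;
the default value of `Function.invFunOn` never occurs. -/
lemma psi_spec {i : ℝ} (hi : 0 ≤ i) : 0 ≤ psi A K L i ∧ phi A K L (psi A K L i) = i := by
  have h : ∃ a ∈ Set.Ici (0 : ℝ), phi A K L a = i := by
    set d := (Nat.card (lowerGroup A K L 0) : ℝ)⁻¹ with hd
    have hd0 : 0 < d := card_lowerGroup_inv_pos A K L
    have h0 : 0 ≤ i / d := by positivity
    have h1 : i ≤ phi A K L (i / d) := by
      have := mul_sub_le_phi_sub A K L h0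
      rw [phi_zero, sub_zero, sub_zero, ← hd, mul_div_cancel₀ _ hd0.ne'] at this
      exact this
    obtain ⟨a, ha, hai⟩ := intermediate_value_Icc h0 (phi_continuous A K L).continuousOn
      ⟨(phi_zero A K L).trans_le hi, h1⟩
    exact ⟨a, ha.1, hai⟩
  exact ⟨Function.invFunOn_mem h, Function.invFunOn_eq h⟩

/-- If `N` is the last lower break, the set in the definition of the conductor is the closed
interval `[0, phi N]`. -/
lemma conductor_eq_phi {N : ℝ} (hN : 0 ≤ N)
    (h : ∀ t, 0 ≤ t → (lowerGroup A K L t ≠ ⊥ ↔ t ≤ N)) : conductor A K L = phi A K L N := by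
  have hset : {i : ℝ | 0 ≤ i ∧ upperGroup A K L i ≠ ⊥} = Set.Icc 0 (phi A K L N) := by
    ext i
    refine and_congr_right fun hi ↦ ?_
    obtain ⟨h1, h2⟩ := psi_spec A K L hi
    rw [upperGroup, h _ h1]
    conv_rhs => rw [← h2]
    exact (phi_strictMono A K L).le_iff_le.symm
  rw [conductor, hset, csSup_Icc]
  rw [← phi_zero A K L]
  exact (phi_strictMono A K L).monotone hN

/-- Because of the ceiling in its definition, `lowerGroup` is constant on each interval `(n, n +
1]`. -/
lemma phi_natCast (N : ℕ) : phi A K L N = ∑ j ∈ Finset.range N,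
    (Nat.card (lowerGroup A K L (j + 1 : ℕ)) : ℝ) / Nat.card (lowerGroup A K L 0) := by
  induction N with
  | zero => simp [phi_zero]
  | succ n ih =>
    rw [Finset.sum_range_succ, ← ih, ← sub_eq_iff_eq_add', phi_sub_phi]
    have h1 : ∫ x in (n : ℝ)..((n + 1 : ℕ) : ℝ),
        (Nat.card (lowerGroup A K L x) : ℝ) / Nat.card (lowerGroup A K L 0) =
        ∫ x in (n : ℝ)..((n + 1 : ℕ) : ℝ),
          (Nat.card (lowerGroup A K L (n + 1 : ℕ)) : ℝ) / Nat.card (lowerGroup A K L 0) := by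
      refine intervalIntegral.integral_congr_ae (Filter.Eventually.of_forall fun x hx ↦ ?_)
      rw [Set.uIoc_of_le (by simp)] at hx
      have h2 : ⌈x⌉₊ = n + 1 := by
        rw [Nat.ceil_eq_iff (by simp)]
        exact ⟨by simpa using hx.1, hx.2⟩
      have h3 : lowerGroup A K L x = lowerGroup A K L (n + 1 : ℕ) := by
        ext g
        change (∀ _, _ → _) ↔ (∀ _, _ → _)
        rw [h2, Nat.ceil_natCast]
      rw [h3]
    rw [h1, intervalIntegral.integral_const]
    simp

end Conductor

end Ramification

/-! ### Lower ramification groups in terms of the valuation. -/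

namespace Ramification

open Polynomial NNReal

variable {A K Ω : Type*} [CommRing A] [IsDomain A] [IsDiscreteValuationRing A] [Field K] [Field Ω]
    [Algebra A K] [IsFractionRing A K] [Algebra K Ω] [Algebra A Ω] [IsScalarTower A K Ω]
    [IsAlgClosed Ω] [Algebra.IsAlgebraic K Ω] [CharZero K]

variable {v : Valuation Ω ℝ≥0} {L : IntermediateField K Ω}

namespace IsDyadic

lemma map_coe_le_one (hv : IsDyadic A K v) (x : integralClosure A L) : v ((x : L) : Ω) ≤ 1 :=
  hv.isIntegral_iff.mp (IsIntegral.map (L.val.restrictScalars A) x.2)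

/-- An integral element of `L`, as an element of the valuation ring. -/
def mkInteger (hv : IsDyadic A K v) (x : Ω) (hx : x ∈ L) (h1 : v x ≤ 1) : integralClosure A L :=
  ⟨⟨x, hx⟩, (isIntegral_algHom_iff (L.val.restrictScalars A) (L.val.restrictScalars A).injective).mp
    (hv.isIntegral_iff.mpr h1)⟩

lemma dvd_iff (hv : IsDyadic A K v) {x y : integralClosure A L} :
    y ∣ x ↔ v ((x : L) : Ω) ≤ v ((y : L) : Ω) := by
  constructor
  · rintro ⟨z, rfl⟩
    push_cast
    rw [map_mul]
    exact mul_le_of_le_one_right' (hv.map_coe_le_one z)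
  · intro h
    by_cases hy : ((y : L) : Ω) = 0
    · rw [hy, map_zero, le_zero_iff, Valuation.zero_iff] at h
      have : x = 0 := by
        apply Subtype.ext; apply Subtype.ext; exact h
      rw [this]; exact dvd_zero y
    · refine ⟨hv.mkInteger (((x : L) : Ω) / ((y : L) : Ω)) (div_mem (x : L).2 (y : L).2) ?_, ?_⟩
      · rw [map_div₀]
        exact div_le_one_of_le₀ h zero_le
      · apply Subtype.ext; apply Subtype.ext
        change ((x : L) : Ω) = ((y : L) : Ω) * (((x : L) : Ω) / ((y : L) : Ω))
        field_simp

lemma isUnit_iff (hv : IsDyadic A K v) {x : integralClosure A L} :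
    IsUnit x ↔ v ((x : L) : Ω) = 1 := by
  rw [isUnit_iff_dvd_one, hv.dvd_iff]
  have : (((1 : integralClosure A L) : L) : Ω) = 1 := rfl
  rw [this, map_one]
  exact ⟨fun h ↦ le_antisymm (hv.map_coe_le_one x) h, fun h ↦ h.ge⟩

end IsDyadic

namespace IsUniformizer

variable [FiniteDimensional K L] {π : Ω}

lemma map_le_of_lt_one (hv : IsDyadic A K v) (h : IsUniformizer v L π) {x : Ω} (hx : x ∈ L)
    (hx1 : v x < 1) : v x ≤ v π := by
  by_cases h0 : x = 0
  · simp [h0]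
  obtain ⟨j, hj⟩ := h.exists_eq_zpow hv hx h0
  rw [hj] at hx1 ⊢
  have : 0 < j := by
    by_contra! hneg
    exact absurd hx1 (not_lt.mpr (one_le_zpow_of_nonpos₀ h.map_pos h.map_lt_one.le hneg))
  calc v π ^ j ≤ v π ^ (1 : ℤ) := zpow_le_zpow_right_of_le_one₀ h.map_pos h.map_lt_one.le this
    _ = v π := zpow_one _

lemma maxIdeal_eq (hv : IsDyadic A K v) (h : IsUniformizer v L π) :
    maxIdeal A L = Ideal.span {hv.mkInteger π h.mem h.map_lt_one.le} := by
  have : IsLocalRing (integralClosure A L) := by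
    refine IsLocalRing.of_nonunits_add fun a b ha hb ↦ ?_
    rw [mem_nonunits_iff, hv.isUnit_iff] at ha hb ⊢
    have ha' := lt_of_le_of_ne (hv.map_coe_le_one a) ha
    have hb' := lt_of_le_of_ne (hv.map_coe_le_one b) hb
    push_cast
    exact (v.map_add_lt ha' hb').ne
  rw [maxIdeal, IsLocalRing.jacobson_eq_maximalIdeal ⊥ bot_ne_top]
  ext x
  rw [IsLocalRing.mem_maximalIdeal, mem_nonunits_iff, hv.isUnit_iff, Ideal.mem_span_singleton,
    hv.dvd_iff]
  constructor
  · intro hx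
    exact h.map_le_of_lt_one hv (x : L).2 (lt_of_le_of_ne (hv.map_coe_le_one x) hx)
  · intro hx
    exact (hx.trans_lt h.map_lt_one).ne

lemma mem_maxIdeal_pow_iff (hv : IsDyadic A K v) (h : IsUniformizer v L π) (m : ℕ)
    (x : integralClosure A L) : x ∈ maxIdeal A L ^ m ↔ v ((x : L) : Ω) ≤ v π ^ m := by
  rw [h.maxIdeal_eq hv, Ideal.span_singleton_pow, Ideal.mem_span_singleton, hv.dvd_iff]
  push_cast
  rw [map_pow]
  rfl

lemma irreducible_mkInteger (hv : IsDyadic A K v) (h : IsUniformizer v L π) :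
    Irreducible (hv.mkInteger π h.mem h.map_lt_one.le) := by
  refine ⟨fun hu ↦ h.map_lt_one.ne (hv.isUnit_iff.mp hu), fun a b hab ↦ ?_⟩
  by_contra! hcon
  rw [hv.isUnit_iff, hv.isUnit_iff] at hcon
  have ha := h.map_le_of_lt_one hv (a : L).2 (lt_of_le_of_ne (hv.map_coe_le_one a) hcon.1)
  have hb := lt_of_le_of_ne (hv.map_coe_le_one b) hcon.2
  have h1 : π = ((a : L) : Ω) * ((b : L) : Ω) := congrArg (fun y : integralClosure A L ↦ ((y : L) : Ω)) hab
  have h2 : v π < v π := by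
    conv_lhs => rw [h1, map_mul]
    calc v ((a : L) : Ω) * v ((b : L) : Ω) ≤ v π * v ((b : L) : Ω) := by gcongr
      _ < v π * 1 := by
        have := h.map_pos
        gcongr
      _ = v π := mul_one _
  exact lt_irrefl _ h2

lemma coe_apply_mem_conj (g : Gal(L/K)) (x : L) : ((g x : L) : Ω) ∈ conj K (x : Ω) := by
  rw [mem_conj_iff_aeval]
  have h1 : minpoly K (x : Ω) = minpoly K x := minpoly.algebraMap_eq (algebraMap L Ω).injective x
  rw [h1]
  have h2 : aeval (g x) (minpoly K x) = 0 := by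
    rw [← AlgEquiv.coe_toAlgHom, aeval_algHom_apply, minpoly.aeval, map_zero]
  have := congrArg L.val h2
  rwa [map_zero, ← aeval_algHom_apply] at this

/-- One uniformizer suffices: any integral element is `F(π)` with `F` over `A`, and `F(g π) - F(π)`
is divisible by `g π - π`. -/
lemma mem_lowerGroup_iff (hv : IsDyadic A K v) (h : IsUniformizer v L π) (g : Gal(L/K)) (t : ℝ) :
    g ∈ lowerGroup A K L t ↔ v (((g ⟨π, h.mem⟩ : L) : Ω) - π) ≤ v π ^ (⌈t⌉₊ + 1) := by
  constructor
  · intro hg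
    have := hg _ (h.irreducible_mkInteger hv)
    rw [h.mem_maxIdeal_pow_iff hv] at this
    exact this
  · intro hg p _
    rw [h.mem_maxIdeal_pow_iff hv]
    refine le_trans ?_ hg
    obtain ⟨F, hF⟩ := h.exists_aeval_eq hv (p : L).2 (hv.map_coe_le_one p)
    have h1 : (p : L) = aeval (⟨π, h.mem⟩ : L) F := by
      apply Subtype.ext
      rw [← hF]
      exact aeval_algHom_apply (L.val.restrictScalars A) (⟨π, h.mem⟩ : L) F
    have h2 : ((g (p : L) : L) : Ω) = aeval ((g ⟨π, h.mem⟩ : L) : Ω) F := by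
      rw [h1]
      have e1 := aeval_algHom_apply (g.toAlgHom.restrictScalars A) (⟨π, h.mem⟩ : L) F
      have e2 := aeval_algHom_apply (L.val.restrictScalars A) (g ⟨π, h.mem⟩ : L) F
      exact (congrArg (fun y : L ↦ (y : Ω)) e1.symm).trans e2.symm
    have h3 : (((g • p - p : integralClosure A L) : L) : Ω) = ((g (p : L) : L) : Ω) - ((p : L) : Ω) := rfl
    rw [h3, h2, ← hF]
    refine hv.map_aeval_sub_aeval_le F ?_ h.map_lt_one.le
    rw [hv.map_conj (coe_apply_mem_conj g ⟨π, h.mem⟩)]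
    exact h.map_lt_one.le

lemma apply_eq_iff (hv : IsDyadic A K v) (h : IsUniformizer v L π) (g g' : Gal(L/K)) :
    ((g ⟨π, h.mem⟩ : L) : Ω) = ((g' ⟨π, h.mem⟩ : L) : Ω) ↔ g = g' := by
  refine ⟨fun hg ↦ ?_, fun hg ↦ by rw [hg]⟩
  let f₁ : L →ₐ[K] Ω := L.val.comp g.toAlgHom
  let f₂ : L →ₐ[K] Ω := L.val.comp g'.toAlgHom
  have hf : f₁ = f₂ := by
    have key : ∀ M : IntermediateField K Ω, M = IntermediateField.adjoin K {π} →
        ∀ (hm : π ∈ M) (f₁ f₂ : M →ₐ[K] Ω), f₁ ⟨π, hm⟩ = f₂ ⟨π, hm⟩ → f₁ = f₂ := by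
      rintro M rfl hm f₁ f₂ h12
      exact IntermediateField.algHom_ext_of_eq_adjoin _ rfl fun x hx ↦ by
        rw [Set.mem_singleton_iff] at hx
        subst hx
        exact h12
    exact key L (h.adjoin_eq hv).symm h.mem f₁ f₂ hg
  ext x
  exact congrArg (fun f : L →ₐ[K] Ω ↦ f x) hf

lemma exists_gal (h : IsUniformizer v L π) [Normal K L] {z : Ω}
    (hz : z ∈ conj K π) : ∃ g : Gal(L/K), ((g ⟨π, h.mem⟩ : L) : Ω) = z := by
  obtain ⟨σ, rfl⟩ := (mem_conj_iff K).mp hz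
  exact ⟨σ.restrictNormal L, σ.restrictNormal_commutes L ⟨π, h.mem⟩⟩

end IsUniformizer

end Ramification

/-! ### The conductor as the largest upper break. -/

namespace Ramification

open Polynomial NNReal

variable {A K Ω : Type*} [CommRing A] [IsDomain A] [IsDiscreteValuationRing A] [Field K] [Field Ω]
    [Algebra A K] [IsFractionRing A K] [Algebra K Ω] [Algebra A Ω] [IsScalarTower A K Ω]
    [IsAlgClosed Ω] [Algebra.IsAlgebraic K Ω] [CharZero K]

variable {v : Valuation Ω ℝ≥0} {L : IntermediateField K Ω} [FiniteDimensional K L] {π : Ω}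

lemma IsUniformizer.prod_conj_eq_prod_gal {M : Type*} [CommMonoid M] [IsGalois K L]
    (hv : IsDyadic A K v) (h : IsUniformizer v L π) (f : Ω → M) :
    ∏ z ∈ conj K π, f z = ∏ g : Gal(L/K), f ((g ⟨π, h.mem⟩ : L) : Ω) := by
  symm
  refine Finset.prod_bij (fun g _ ↦ ((g ⟨π, h.mem⟩ : L) : Ω))
    (fun g _ ↦ coe_apply_mem_conj g ⟨π, h.mem⟩)
    (fun g _ g' _ hg ↦ (h.apply_eq_iff hv g g').mp hg) (fun z hz ↦ ?_) (fun _ _ ↦ rfl)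
  obtain ⟨g, hg⟩ := h.exists_gal hz
  exact ⟨g, Finset.mem_univ g, hg⟩

lemma IsUniformizer.exists_map_sub_eq_pow [IsGalois K L] (hv : IsDyadic A K v)
    (h : IsUniformizer v L π) (g : Gal(L/K)) (hg : g ≠ 1) :
    ∃ n : ℕ, 1 ≤ n ∧ v (((g ⟨π, h.mem⟩ : L) : Ω) - π) = v π ^ n := by
  have hne : ((g ⟨π, h.mem⟩ : L) : Ω) - π ≠ 0 := by
    rw [sub_ne_zero]
    exact fun h0 ↦ hg ((h.apply_eq_iff hv g 1).mp h0)
  obtain ⟨j, hj⟩ := h.exists_eq_zpow hv (sub_mem (g ⟨π, h.mem⟩).2 h.mem) hne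
  have h1 : v (((g ⟨π, h.mem⟩ : L) : Ω) - π) ≤ v π :=
    v.map_sub_le (hv.map_conj (coe_apply_mem_conj g ⟨π, h.mem⟩)).le le_rfl
  have hj1 : 1 ≤ j := by
    rw [hj] at h1
    by_contra! hlt
    have := one_le_zpow_of_nonpos₀ h.map_pos h.map_lt_one.le (show j ≤ 0 by omega)
    exact absurd (this.trans h1) (not_le.mpr h.map_lt_one)
  obtain ⟨n, rfl⟩ := Int.eq_ofNat_of_zero_le (show 0 ≤ j by omega)
  exact ⟨n, by exact_mod_cast hj1, by rw [hj, zpow_natCast]⟩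

/-- With `N` the last lower break, both `e * (φ(N) + 1)` and `e * (h + 1)` equal `∑ min (i_G g) (N +
1)`. -/
theorem IsDyadic.conductor_eq [IsGalois K L] (hv : IsDyadic A K v) {h : ℝ} (hLE : UpperLE v L h)
    (hGE : UpperGE v L h) : conductor A K L = h := by
  classical
  obtain ⟨π, hπ⟩ := hv.exists_isUniformizer L
  have hI := fun g : Gal(L/K) ↦ fun hg : g ≠ 1 ↦ hπ.exists_map_sub_eq_pow hv g hg
  have hI' : ∀ g : Gal(L/K), ∃ n : ℕ, g ≠ 1 →
      1 ≤ n ∧ v (((g ⟨π, hπ.mem⟩ : L) : Ω) - π) = v π ^ n := by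
    intro g
    by_cases hg : g = 1
    · exact ⟨0, fun h ↦ absurd hg h⟩
    · obtain ⟨n, hn⟩ := hI g hg
      exact ⟨n, fun _ ↦ hn⟩
  choose I₀ hI₀ using hI'
  obtain ⟨z, hz, hzπ, hle⟩ := hGE π hπ
  obtain ⟨g₁, rfl⟩ := hπ.exists_gal hz
  have hg₁ : g₁ ≠ 1 := by
    rintro rfl
    exact hzπ rfl
  obtain ⟨g₀, hg₀, hmax⟩ := Finset.exists_max_image (Finset.univ.erase (1 : Gal(L/K))) I₀
    ⟨g₁, by simpa using hg₁⟩
  have hg₀1 : g₀ ≠ 1 := (Finset.mem_erase.mp hg₀).1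
  have hmax' : ∀ g, g ≠ 1 → I₀ g ≤ I₀ g₀ := fun g hg ↦ hmax g (by simpa using hg)
  have hpos := hπ.map_pos
  have hlt := hπ.map_lt_one
  obtain ⟨N, hN⟩ : ∃ N, I₀ g₀ = N + 1 := ⟨I₀ g₀ - 1, by have := (hI₀ g₀ hg₀1).1; omega⟩
  have hmem : ∀ g, g ≠ 1 → ∀ t : ℝ, g ∈ lowerGroup A K L t ↔ ⌈t⌉₊ + 1 ≤ I₀ g := by
    intro g hg t
    rw [hπ.mem_lowerGroup_iff hv, (hI₀ g hg).2, pow_le_pow_iff_right_of_lt_one₀ hpos hlt]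
  have hcond := conductor_eq_phi A K L (N := N) (by positivity) fun t ht ↦ by
    rw [← Nat.ceil_le]
    constructor
    · intro hne
      obtain ⟨⟨g, hg⟩, hgne⟩ := Subgroup.ne_bot_iff_exists_ne_one.mp hne
      have hg1 : g ≠ 1 := fun h ↦ hgne (Subtype.ext h)
      have h1 := (hmem g hg1 t).mp hg
      have h2 := hmax' g hg1
      omega
    · intro hle hbot
      have : g₀ ∈ lowerGroup A K L t := (hmem g₀ hg₀1 t).mpr (by omega)
      rw [hbot, Subgroup.mem_bot] at this
      exact hg₀1 this
  -- The identity, for which `i_G` is infinite, is truncated at `N + 1`, matching `max 0 r = r` in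
  -- the factor of `herbrand` at `π` itself.
  let I : Gal(L/K) → ℕ := fun g ↦ if g = 1 then N + 1 else I₀ g
  have hI1 : ∀ g, 1 ≤ I g ∧ I g ≤ N + 1 := by
    intro g
    by_cases hg : g = 1
    · simp [I, hg]
    · simp only [I, hg, if_false]
      exact ⟨(hI₀ g hg).1, hN ▸ hmax' g hg⟩
  have hmemI : ∀ g, ∀ j : ℕ, j ≤ N → (g ∈ lowerGroup A K L j ↔ j + 1 ≤ I g) := by
    intro g j hj
    by_cases hg : g = 1
    · subst hg
      simp only [one_mem, I, if_true, true_iff]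
      omega
    · rw [hmem g hg, Nat.ceil_natCast]
      simp [I, hg]
  have hcard : ∀ j : ℕ, j ≤ N → Nat.card (lowerGroup A K L j) =
      ∑ g : Gal(L/K), if j + 1 ≤ I g then 1 else 0 := by
    intro j hj
    rw [Finset.sum_boole, Nat.cast_id, ← Fintype.card_subtype, ← Nat.card_eq_fintype_card]
    exact Nat.card_congr (Equiv.subtypeEquivRight fun g ↦ hmemI g j hj)
  set e := Module.finrank K L with he
  have hGe : Nat.card Gal(L/K) = e := IsGalois.card_aut_eq_finrank K L
  have hcard0 : Nat.card (lowerGroup A K L 0) = e := by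
    have := hcard 0 (by omega)
    rw [Nat.cast_zero] at this
    rw [this, ← hGe, Nat.card_eq_fintype_card, ← Finset.card_univ, Finset.card_eq_sum_ones]
    exact Finset.sum_congr rfl fun g _ ↦ if_pos (by simpa using (hI1 g).1)
  -- Double counting: `g` lies in `I g - 1` of the groups `G_1, …, G_N`, and the summand `e`
  -- restores the missing `1` for each `g`.
  have hsum : ∑ j ∈ Finset.range N, Nat.card (lowerGroup A K L (j + 1 : ℕ)) + e =
      ∑ g, I g := by
    have h1 : ∀ j ∈ Finset.range N, Nat.card (lowerGroup A K L (j + 1 : ℕ)) =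
        ∑ g : Gal(L/K), if j + 2 ≤ I g then 1 else 0 := fun j hj ↦
      hcard (j + 1) (by have := Finset.mem_range.mp hj; omega)
    rw [Finset.sum_congr rfl h1, Finset.sum_comm, ← hGe, Nat.card_eq_fintype_card,
      ← Finset.card_univ, Finset.card_eq_sum_ones, ← Finset.sum_add_distrib]
    refine Finset.sum_congr rfl fun g _ ↦ ?_
    rw [Finset.sum_boole, Nat.cast_id]
    have h2 : (Finset.range N).filter (fun j ↦ j + 2 ≤ I g) = Finset.range (I g - 1) := by
      ext j
      have := hI1 g
      simp only [Finset.mem_filter, Finset.mem_range]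
      omega
    rw [h2, Finset.card_range]
    have := hI1 g
    omega
  have hherb : herbrand K v π (v π ^ (N + 1)) = v π ^ (∑ g, I g) := by
    rw [herbrand, hπ.prod_conj_eq_prod_gal hv, ← Finset.prod_pow_eq_pow_sum]
    refine Finset.prod_congr rfl fun g _ ↦ ?_
    by_cases hg : g = 1
    · subst hg
      simp [I]
    · rw [(hI₀ g hg).2]
      simp only [I, hg, if_false]
      refine max_eq_left ?_
      rw [pow_le_pow_iff_right_of_lt_one₀ hpos hlt, ← hN]
      exact hmax' g hg
  have heq : (2 : ℝ≥0) ^ (-(h + 1)) = v π ^ (∑ g, I g) := by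
    refine le_antisymm ?_ ?_
    · have h1 := hLE π hπ _ (IsUniformizer.coe_apply_mem_conj g₀ ⟨π, hπ.mem⟩) fun h0 ↦
        hg₀1 ((hπ.apply_eq_iff hv g₀ 1).mp h0)
      rwa [(hI₀ g₀ hg₀1).2, hN, hherb] at h1
    · rw [← hherb]
      refine (herbrand_mono π ?_).trans hle
      rw [(hI₀ g₁ hg₁).2, pow_le_pow_iff_right_of_lt_one₀ hpos hlt, ← hN]
      exact hmax' g₁ hg₁
  have hS : (h + 1) * e = (∑ g, I g : ℕ) := by
    have h1 : ((2 : ℝ≥0) ^ (-(h + 1))) ^ e = (v π ^ (∑ g, I g)) ^ e := by rw [heq]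
    rw [← pow_mul, mul_comm _ e, pow_mul, hπ.pow_finrank, ← NNReal.rpow_natCast,
      ← NNReal.rpow_mul, inv_pow, ← NNReal.rpow_natCast, ← NNReal.rpow_neg] at h1
    have h2 := congrArg (Real.logb 2) (congrArg ((↑) : ℝ≥0 → ℝ) h1)
    push_cast at h2
    rw [Real.logb_rpow (by norm_num) (by norm_num), Real.logb_rpow (by norm_num) (by norm_num)] at h2
    push_cast
    linarith
  have he0 : (0 : ℝ) < e := by exact_mod_cast (Module.finrank_pos : 0 < Module.finrank K L)
  rw [hcond, phi_natCast, hcard0, ← Finset.sum_div, div_eq_iff he0.ne']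
  have h3 : ((∑ j ∈ Finset.range N, Nat.card (lowerGroup A K L (j + 1 : ℕ)) + e : ℕ) : ℝ) =
      (∑ g, I g : ℕ) := by rw [hsum]
  rw [← hS] at h3
  push_cast at h3 ⊢
  linarith

end Ramification

/-! ### Fontaine's criterion for upper bounds. -/

namespace Ramification

open Polynomial NNReal

variable {A K Ω : Type*} [CommRing A] [IsDomain A] [IsDiscreteValuationRing A] [Field K] [Field Ω]
    [Algebra A K] [IsFractionRing A K] [Algebra K Ω] [Algebra A Ω] [IsScalarTower A K Ω]
    [IsAlgClosed Ω] [Algebra.IsAlgebraic K Ω] [CharZero K]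

variable {v : Valuation Ω ℝ≥0} {L : IntermediateField K Ω} [FiniteDimensional K L] {π : Ω}

lemma IsUniformizer.pow_eq_rpow (h : IsUniformizer v L π) (n : ℕ) :
    v π ^ n = (2 : ℝ≥0) ^ (-(n / Module.finrank K L : ℝ)) := by
  have he : Module.finrank K L ≠ 0 := Module.finrank_pos.ne'
  have he' : (Module.finrank K L : ℝ) ≠ 0 := by exact_mod_cast he
  refine (pow_left_inj₀ zero_le zero_le he).mp ?_
  rw [← pow_mul, mul_comm, pow_mul, h.pow_finrank, ← NNReal.rpow_natCast (2 ^ _),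
    ← NNReal.rpow_mul, neg_mul, div_mul_cancel₀ _ he', NNReal.rpow_neg, NNReal.rpow_natCast, inv_pow]

/-- Integral relations of `π` are multiples over `A` of its minimal polynomial, so approximate
embeddings need only be tested on that polynomial. -/
lemma IsUniformizer.map_aeval_le (hv : IsDyadic A K v) (h : IsUniformizer v L π) {G : A[X]}
    (hG : aeval π G = 0) {β : Ω} (hβ : v β ≤ 1) :
    v (aeval β G) ≤ v (aeval β (minpoly K π)) := by
  obtain ⟨P, hP, hPm⟩ := hv.exists_map_eq_minpoly h.map_lt_one.le
  have hPπ : aeval π P = 0 := by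
    rw [← aeval_map_algebraMap K, hPm, minpoly.aeval]
  have h0 : G %ₘ P = 0 := by
    have h1 : aeval π ((G %ₘ P).map (algebraMap A K)) = 0 := by
      rw [aeval_map_algebraMap, modByMonic_eq_sub_mul_div, map_sub, map_mul, hPπ, hG]
      simp
    have h2 : (G %ₘ P).map (algebraMap A K) = 0 := by
      by_contra hne
      have h3 := minpoly.degree_le_of_ne_zero K π hne h1
      rw [← hPm, hP.degree_map] at h3
      exact absurd ((h3.trans degree_map_le).trans_lt (degree_modByMonic_lt G hP)) (lt_irrefl _)
    exact (Polynomial.map_eq_zero_iff (IsFractionRing.injective A K)).mp h2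
  have h4 : G = P * (G /ₘ P) := by
    have := modByMonic_add_div G P
    rw [h0, zero_add] at this
    exact this.symm
  rw [← hPm, aeval_map_algebraMap]
  conv_lhs => rw [h4]
  rw [map_mul, map_mul]
  exact mul_le_of_le_one_right' (hv.map_aeval_le_one _ hβ)

/-- The valuation of a root of `P - 2 ^ q X ^ s`, where `P` is an Eisenstein polynomial. -/
lemma IsUniformizer.map_root_eq (hv : IsDyadic A K v) (h : IsUniformizer v L π) {β : Ω} {q s : ℕ}
    (hq : 2 ≤ q) (hs : s < Module.finrank K L) (hβ : aeval β (minpoly K π) = 2 ^ q * β ^ s) :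
    v β = v π := by
  have hq' : (2⁻¹ : ℝ≥0) ^ q < 2⁻¹ := by
    conv_rhs => rw [← pow_one (2⁻¹ : ℝ≥0)]
    exact pow_lt_pow_right_of_lt_one₀ (by norm_num) (by norm_num [inv_lt_one₀]) (by omega)
  have hvβ := congrArg v hβ
  rw [aeval_minpoly_eq_prod_conj, map_prod, map_mul, map_pow, map_pow, hv.map_two] at hvβ
  have hcard : (conj K π).card = Module.finrank K L := by
    rw [card_conj, h.natDegree_minpoly hv]
  rcases lt_trichotomy (v β) (v π) with hlt | heq | hgt
  · exfalso
    have h1 : ∏ z ∈ conj K π, v (β - z) = 2⁻¹ := by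
      rw [← h.pow_finrank, ← hcard, ← Finset.prod_const]
      refine Finset.prod_congr rfl fun z hz ↦ ?_
      rw [v.map_sub_eq_of_lt_right (by rwa [hv.map_conj hz]), hv.map_conj hz]
    rw [h1] at hvβ
    have h2 : (2⁻¹ : ℝ≥0) ^ q * v β ^ s ≤ 2⁻¹ ^ q :=
      mul_le_of_le_one_right' (pow_le_one' (hlt.trans h.map_lt_one).le s)
    rw [← hvβ] at h2
    exact absurd hq' (not_lt.mpr h2)
  · exact heq
  · exfalso
    have h1 : ∏ z ∈ conj K π, v (β - z) = v β ^ Module.finrank K L := by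
      rw [← hcard, ← Finset.prod_const]
      refine Finset.prod_congr rfl fun z hz ↦ ?_
      rw [v.map_sub_eq_of_lt_left (by rwa [hv.map_conj hz])]
    rw [h1] at hvβ
    have hpos : 0 < v β := h.map_pos.trans hgt
    rcases le_total (v β) 1 with h1 | h1
    · have h2 : (2⁻¹ : ℝ≥0) ^ q * v β ^ s ≤ 2⁻¹ ^ q := mul_le_of_le_one_right' (pow_le_one' h1 s)
      have h3 : v π ^ Module.finrank K L ≤ v β ^ Module.finrank K L := pow_le_pow_left' hgt.le _
      rw [h.pow_finrank, hvβ] at h3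
      exact absurd (h3.trans h2) (not_le.mpr hq')
    · have h2 : v β ^ s ≤ v β ^ Module.finrank K L := pow_le_pow_right₀ h1 hs.le
      have h3 : (2⁻¹ : ℝ≥0) ^ q * v β ^ s < 1 * v β ^ s := by
        have : 0 < v β ^ s := pow_pos hpos s
        gcongr
        exact hq'.trans (by norm_num [inv_lt_one₀])
      rw [← hvβ, one_mul] at h3
      exact absurd h3 (not_lt.mpr h2)

lemma IsUniformizer.mem_of_mem_conj [Normal K L] (h : IsUniformizer v L π) {z : Ω}
    (hz : z ∈ conj K π) : z ∈ L := by
  obtain ⟨g, rfl⟩ := h.exists_gal hz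
  exact (g ⟨π, h.mem⟩).2

lemma IsUniformizer.exists_herbrand_eq_pow [IsGalois K L] (hv : IsDyadic A K v)
    (h : IsUniformizer v L π) {z₀ : Ω} (hz₀ : z₀ ∈ conj K π) (hne : z₀ ≠ π) :
    ∃ n : ℕ, herbrand K v π (v (z₀ - π)) = v π ^ n := by
  have key : ∀ z ∈ conj K π, z ≠ π → ∃ n : ℕ, v (z - π) = v π ^ n := by
    intro z hz hzne
    obtain ⟨g, rfl⟩ := h.exists_gal hz
    obtain ⟨n, -, hn⟩ := h.exists_map_sub_eq_pow hv g (by rintro rfl; exact hzne rfl)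
    exact ⟨n, hn⟩
  refine Finset.prod_induction _ (fun r ↦ ∃ n : ℕ, r = v π ^ n) ?_ ⟨0, by simp⟩ ?_
  · rintro _ _ ⟨a, rfl⟩ ⟨b, rfl⟩
    exact ⟨a + b, (pow_add _ _ _).symm⟩
  · intro z hz
    by_cases hzπ : z = π
    · obtain ⟨n, hn⟩ := key z₀ hz₀ hne
      exact ⟨n, by rw [hzπ, sub_self, map_zero, hn]; simp⟩
    · rcases max_choice (v (z - π)) (v (z₀ - π)) with h1 | h1
      · rw [h1]; exact key z hz hzπ
      · rw [h1]; exact key z₀ hz₀ hne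

/-- Factor the minimal polynomial over the conjugates and measure distances to `β` through the
nearest one, `z₁`. -/
lemma IsUniformizer.herbrand_eq_map_aeval (hv : IsDyadic A K v) {β z₁ : Ω}
    (hz₁ : z₁ ∈ conj K π) (hmin : ∀ z ∈ conj K π, v (z₁ - β) ≤ v (z - β)) :
    v (aeval β (minpoly K π)) = herbrand K v π (v (z₁ - β)) := by
  obtain ⟨σ, rfl⟩ := (mem_conj_iff K).mp hz₁
  rw [aeval_minpoly_eq_prod_conj, map_prod, herbrand]
  symm
  refine Finset.prod_bij (fun z _ ↦ σ z) (fun z hz ↦ equiv_mem_conj σ hz)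
    (fun _ _ _ _ h ↦ σ.injective h)
    (fun z hz ↦ ⟨σ.symm z, equiv_mem_conj σ.symm hz, by simp⟩) fun z hz ↦ ?_
  rw [v.map_sub_swap β, IsDyadic.map_sub_eq_max (hmin _ (equiv_mem_conj σ hz)), ← map_sub σ,
    hv.map_equiv]

/-- If the value of the Herbrand function at the last break is `v π ^ n`, then the minimal
polynomial of `π` takes no value of valuation `v π ^ (n - 1)` on `L`. -/
lemma IsUniformizer.map_aeval_minpoly_ne [IsGalois K L] (hv : IsDyadic A K v)
    (h : IsUniformizer v L π) {z₀ : Ω} (hz₀ : z₀ ∈ conj K π) (hne : z₀ ≠ π) {n : ℕ}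
    (hn : herbrand K v π (v (z₀ - π)) = v π ^ (n + 1)) {β : Ω} (hβ : β ∈ L) :
    v (aeval β (minpoly K π)) ≠ v π ^ n := by
  classical
  intro hcon
  have hpos := h.map_pos
  have hlt := h.map_lt_one
  obtain ⟨z₁, hz₁, hmin⟩ := Finset.exists_min_image (conj K π) (fun z ↦ v (z - β))
    ⟨π, self_mem_conj K π⟩
  rw [herbrand_eq_map_aeval hv hz₁ hmin] at hcon
  rcases le_or_gt (v (z₁ - β)) (v (z₀ - π)) with hle | hgt
  · have h1 := herbrand_mono (K := K) (v := v) π hle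
    rw [hcon, hn, pow_le_pow_iff_right_of_lt_one₀ hpos hlt] at h1
    omega
  -- Both differences lie in `L`, so a strict inequality of values gains a full factor `v π`.
  · have h1 : v (z₀ - π) ≤ v π * v (z₁ - β) := by
      have hp : 0 < v (z₁ - β) := zero_le.trans_lt hgt
      have h2 : v ((z₀ - π) / (z₁ - β)) ≤ v π := by
        refine h.map_le_of_lt_one hv (div_mem (sub_mem (h.mem_of_mem_conj hz₀) h.mem)
          (sub_mem (h.mem_of_mem_conj hz₁) hβ)) ?_
        rw [map_div₀]
        exact (div_lt_one hp).mpr hgt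
      rwa [map_div₀, div_le_iff₀ hp] at h2
    -- The gain occurs in at least two factors, those of `π` and of `z₀`; the exponents therefore
    -- differ by at least `2`, whereas they should differ by `1`.
    have h2 : herbrand K v π (v (z₀ - π)) ≤ v π ^ 2 * herbrand K v π (v (z₁ - β)) := by
      have hc : ∏ z ∈ conj K π, (if z ∈ ({π, z₀} : Finset Ω) then v π else 1) = v π ^ 2 := by
        rw [Finset.prod_ite_mem, Finset.inter_eq_right.mpr, Finset.prod_const,
          Finset.card_pair hne.symm]
        intro z hz
        rcases Finset.mem_insert.mp hz with rfl | hz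
        · exact self_mem_conj K z
        · rwa [Finset.mem_singleton.mp hz]
      rw [← hc, herbrand, herbrand, ← Finset.prod_mul_distrib]
      refine Finset.prod_le_prod' fun z hz ↦ ?_
      split_ifs with hmem
      · refine le_trans ?_ (mul_le_mul_right (le_max_right _ _) _)
        refine le_trans (max_le ?_ le_rfl) h1
        rcases Finset.mem_insert.mp hmem with rfl | hz
        · simp
        · rw [Finset.mem_singleton.mp hz]
      · rw [one_mul]
        exact max_le_max le_rfl hgt.le
    rw [hcon, hn, ← pow_add, pow_le_pow_iff_right_of_lt_one₀ hpos hlt] at h2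
    omega

/-- A criterion, due to Fontaine, for an upper bound on the upper ramification breaks: it suffices
that homomorphisms modulo `2 ^ m` from the valuation ring of `L` to that of another extension
can only exist if `L` embeds into that extension. -/
theorem UpperLE.of_forall [IsGalois K L] (hv : IsDyadic A K v) {m : ℝ} (hm : 2 ≤ m)
    (hme : ∃ j : ℕ, m * Module.finrank K L = j)
    (H : ∀ π, IsUniformizer v L π → ∀ β : Ω, v β ≤ 1 →
      (∀ G : A[X], aeval π G = 0 → v (aeval β G) ≤ (2 : ℝ≥0) ^ (-m)) →
        L ≤ IntermediateField.adjoin K {β}) : UpperLE v L (m - 1) := by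
  classical
  intro π hπ z hz hzπ
  rw [sub_add_cancel]
  by_contra! hcon
  have hpos := hπ.map_pos
  have hlt := hπ.map_lt_one
  obtain ⟨j, hj⟩ := hme
  set e := Module.finrank K L with he
  have he0 : 0 < e := Module.finrank_pos
  have he0' : (0 : ℝ) < e := by exact_mod_cast he0
  have hpowm : v π ^ j = (2 : ℝ≥0) ^ (-m) := by
    rw [hπ.pow_eq_rpow, ← hj, mul_div_cancel_right₀ _ he0'.ne']
  obtain ⟨z₀, hz₀, hmin⟩ := Finset.exists_min_image ((conj K π).erase π) (fun w ↦ v (w - π))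
    ⟨z, Finset.mem_erase.mpr ⟨hzπ, hz⟩⟩
  obtain ⟨hne, hz₀c⟩ := Finset.mem_erase.mp hz₀
  obtain ⟨S, hS⟩ := hπ.exists_herbrand_eq_pow hv hz₀c hne
  have hSj : j < S := by
    have h1 := (herbrand_mono (K := K) (v := v) π
      (hmin z (Finset.mem_erase.mpr ⟨hzπ, hz⟩))).trans_lt hcon
    rw [hS, ← hpowm] at h1
    exact (pow_lt_pow_iff_right_of_lt_one₀ hpos hlt).mp h1
  -- The exponent `r`, one below that of the last break, is never attained by the minimal polynomial
  -- on `L`, yet `r ≥ j` makes it small enough for the hypothesis `H`. The element `β` is built to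
  -- attain it.
  obtain ⟨r, rfl⟩ : ∃ r, S = r + 1 := ⟨S - 1, by omega⟩
  have h2e : 2 * e ≤ j := by
    have : (2 * e : ℝ) ≤ j := by rw [← hj]; gcongr
    exact_mod_cast this
  have hqr : r = r / e * e + r % e := by rw [mul_comm]; exact (Nat.div_add_mod r e).symm
  set q := r / e with hq
  set s := r % e with hs
  -- This is where `2 ≤ m` enters: the perturbation `2 ^ q X ^ s` must be too small to affect the
  -- Eisenstein shape.
  have hq2 : 2 ≤ q := (Nat.le_div_iff_mul_le he0).mpr (by omega)
  have hse : s < e := Nat.mod_lt _ he0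
  have hdeg : (minpoly K π).natDegree = e := hπ.natDegree_minpoly hv
  have hint : IsIntegral K π := Algebra.IsIntegral.isIntegral π
  let Q : K[X] := minpoly K π - C (2 ^ q) * X ^ s
  have hdegQ : Q.degree = e := by
    have h1 : (minpoly K π).degree = e := by
      rw [degree_eq_natDegree (minpoly.ne_zero hint), hdeg]
    rw [← h1]
    refine degree_sub_eq_left_of_degree_lt ?_
    rw [h1]
    exact (degree_C_mul_X_pow_le s _).trans_lt (by exact_mod_cast hse)
  obtain ⟨β, hβ⟩ := IsAlgClosed.exists_aeval_eq_zero Ω Q (by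
    rw [hdegQ]; exact_mod_cast he0.ne')
  have hβP : aeval β (minpoly K π) = 2 ^ q * β ^ s := by
    simp only [Q, map_sub, map_mul, map_pow, map_ofNat, aeval_X, sub_eq_zero] at hβ
    exact hβ
  have hvβ := hπ.map_root_eq hv hq2 hse hβP
  have hβr : v (aeval β (minpoly K π)) = v π ^ r := by
    rw [hβP, map_mul, map_pow, map_pow, hvβ, hv.map_two, ← hπ.pow_finrank, ← pow_mul, ← pow_add,
      ← he, mul_comm, ← hqr]
  have hle := H π hπ β (hvβ.trans_le hlt.le) fun G hG ↦ by
    refine (hπ.map_aeval_le hv hG (hvβ.trans_le hlt.le)).trans ?_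
    rw [hβr, ← hpowm, pow_le_pow_iff_right_of_lt_one₀ hpos hlt]
    omega
  have hfin : Module.finrank K (IntermediateField.adjoin K {β}) ≤ e := by
    rw [IntermediateField.adjoin.finrank (Algebra.IsIntegral.isIntegral β)]
    have hQ0 : Q ≠ 0 := by
      intro h0
      rw [h0, degree_zero] at hdegQ
      exact absurd hdegQ (by simp)
    have := natDegree_le_natDegree (minpoly.degree_le_of_ne_zero K β hQ0 hβ)
    rwa [natDegree_eq_of_degree_eq_some hdegQ] at this
  have : FiniteDimensional K (IntermediateField.adjoin K {β}) :=
    IntermediateField.adjoin.finiteDimensional (Algebra.IsIntegral.isIntegral β)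
  -- As `β` has degree at most `[L : K]`, the inclusion supplied by `H` is an equality and puts `β`
  -- in `L`.
  have heq : L = IntermediateField.adjoin K {β} :=
    IntermediateField.eq_of_le_of_finrank_le hle hfin
  have hβL : β ∈ L := by
    rw [heq]
    exact IntermediateField.mem_adjoin_simple_self K β
  exact hπ.map_aeval_minpoly_ne hv hz₀c hne hS hβL hβr

end Ramification

/-! ### Exact roots from approximate ones. -/

namespace Ramification

open Polynomial NNReal

variable {A K Ω : Type*} [CommRing A] [IsDomain A] [IsDiscreteValuationRing A] [Field K] [Field Ω]
    [Algebra A K] [IsFractionRing A K] [Algebra K Ω] [Algebra A Ω] [IsScalarTower A K Ω]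
    [IsAlgClosed Ω] [Algebra.IsAlgebraic K Ω] [CharZero K]

variable {v : Valuation Ω ℝ≥0}

namespace IsDyadic

lemma map_two_lt_one (hv : IsDyadic A K v) : v 2 < 1 := by
  rw [hv.map_two]; norm_num [inv_lt_one₀]

/-- Artin–Schreier: the roots `y` and `-1 - y` differ modulo the maximal ideal, while an
automorphism over `E` acts trivially on residues and so fixes each of them. -/
lemma exists_sq_add_self_eq (hv : IsDyadic A K v) (E : IntermediateField K Ω) {d : Ω} (hd : d ∈ E)
    (hd1 : v d ≤ 1) : ∃ y ∈ E, y ^ 2 + y = d ∧ v y ≤ v d := by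
  obtain ⟨y, hy, hyd⟩ : ∃ y : Ω, y ^ 2 + y = d ∧ v y ≤ v d := by
    obtain ⟨y, hy⟩ := IsAlgClosed.exists_aeval_eq_zero Ω (X ^ 2 + X - C d : Polynomial Ω) (by
      have : (X ^ 2 + X - C d : Polynomial Ω).degree = 2 := by compute_degree!
      rw [this]; norm_num)
    have hy' : y ^ 2 + y = d := by
      simpa [sub_eq_zero] using hy
    have hmul : v y * v (y + 1) = v d := by
      rw [← map_mul, ← hy']
      congr 1; ring
    rcases lt_trichotomy (v y) 1 with h | h | h
    · refine ⟨y, hy', ?_⟩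
      have : v (y + 1) = 1 := by
        rw [v.map_add_eq_of_lt_right (by rwa [map_one]), map_one]
      rw [this, mul_one] at hmul
      exact hmul.le
    · refine ⟨-1 - y, by rw [← hy']; ring, ?_⟩
      rw [h, one_mul] at hmul
      rw [← hmul, ← v.map_neg]
      exact le_of_eq (by congr 1; ring)
    · exfalso
      have : v (y + 1) = v y := v.map_add_eq_of_lt_left (by rwa [map_one])
      rw [this] at hmul
      exact absurd hd1 (not_le.mpr (hmul ▸ one_lt_mul'' h h))
  refine ⟨y, mem_of_forall_fixed E fun τ hτ ↦ ?_, hy, hyd⟩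
  have hτy : (τ y) ^ 2 + τ y = y ^ 2 + y := by
    rw [hy, ← map_pow, ← map_add, hy, hτ d hd]
  have hy1 : v y ≤ 1 := hyd.trans hd1
  obtain ⟨a, ha⟩ := hv.exists_map_sub_lt_one hy1
  have ha' : v (τ y - algebraMap A Ω a) < 1 := by
    rw [← hv.map_equiv τ, map_sub, IsScalarTower.algebraMap_apply A K Ω, AlgEquiv.commutes] at ha
    rwa [IsScalarTower.algebraMap_apply A K Ω]
  have hlt : v (τ y - y) < 1 := by
    rw [← sub_sub_sub_cancel_right _ _ (algebraMap A Ω a)]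
    exact v.map_sub_lt ha' ha
  have h0 : (τ y - y) * (τ y + y + 1) = 0 := by linear_combination hτy
  rcases mul_eq_zero.mp h0 with h | h
  · exact sub_eq_zero.mp h
  · exfalso
    have h1 : τ y - y = -(1 + 2 * y) := by linear_combination h
    have h2 : v (2 * y) < v 1 := by
      rw [map_mul, map_one]
      exact (mul_le_of_le_one_right' hy1).trans_lt hv.map_two_lt_one
    rw [h1, v.map_neg, v.map_add_eq_of_lt_left h2, map_one] at hlt
    exact lt_irrefl _ hlt

/-- Write `w = 1 + 4 d = (1 + 2 y) ^ 2` with `y ^ 2 + y = d`: each square root costs one factor `2`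
of precision. Solvability of the Artin–Schreier equation allows the boundary exponent `n + 1`. -/
lemma exists_pow_two_pow_eq_of_map_sub_one_le (hv : IsDyadic A K v) (E : IntermediateField K Ω)
    (n : ℕ) {w : Ω} (hw : w ∈ E) (hw1 : v (w - 1) ≤ 2⁻¹ ^ (n + 1)) :
    ∃ t ∈ E, t ^ 2 ^ n = w := by
  have h2 := hv.two_ne_zero
  induction n generalizing w with
  | zero => exact ⟨w, hw, by simp⟩
  | succ n ih =>
    have hd : v ((w - 1) / 2 ^ 2) ≤ 2⁻¹ ^ n := by
      rw [map_div₀, map_pow, hv.map_two, div_le_iff₀ (by positivity), ← pow_add]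
      exact hw1
    obtain ⟨y, hy, hyd, hvy⟩ := hv.exists_sq_add_self_eq E
      (div_mem (sub_mem hw (one_mem E)) (pow_mem (ofNat_mem E 2) 2))
      (hd.trans (pow_le_one' (by norm_num [inv_le_one₀]) n))
    have hy2 : (1 + 2 * y) ^ 2 = w := by
      have : 2 ^ 2 * (y ^ 2 + y) = w - 1 := by
        rw [hyd]; exact mul_div_cancel₀ _ (pow_ne_zero 2 h2)
      linear_combination this
    obtain ⟨t, ht, htw⟩ := ih (w := 1 + 2 * y)
      (add_mem (one_mem E) (mul_mem (ofNat_mem E 2) hy)) (by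
        rw [add_sub_cancel_left, map_mul, hv.map_two, pow_succ']
        gcongr
        exact hvy.trans hd)
    exact ⟨t, ht, by rw [pow_succ, pow_mul, htw, hy2]⟩

/-- Approximate `2 ^ n`-th roots can be corrected to exact ones. -/
lemma exists_pow_two_pow_eq (hv : IsDyadic A K v) (E : IntermediateField K Ω) (n : ℕ) {z u : Ω}
    (hz : z ∈ E) (hu : u ∈ E) (hu0 : u ≠ 0) (h : v (z ^ 2 ^ n - u) ≤ 2⁻¹ ^ (n + 1) * v u) :
    ∃ t ∈ E, t ^ 2 ^ n = u := by
  obtain ⟨t, ht, htw⟩ := hv.exists_pow_two_pow_eq_of_map_sub_one_le E n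
    (w := u⁻¹ * z ^ 2 ^ n) (mul_mem (inv_mem hu) (pow_mem hz _)) (by
      have : u⁻¹ * z ^ 2 ^ n - 1 = (z ^ 2 ^ n - u) / u := by field_simp
      rw [this, map_div₀, div_le_iff₀ (v.pos_iff.mpr hu0)]
      exact h)
  have hz0 : z ^ 2 ^ n ≠ 0 := by
    intro h0
    rw [h0, zero_sub, v.map_neg] at h
    have h1 : (2⁻¹ : ℝ≥0) ^ (n + 1) < 1 :=
      pow_lt_one₀ (by positivity) (by norm_num [inv_lt_one₀]) (by omega)
    have h3 : (2⁻¹ : ℝ≥0) ^ (n + 1) * v u < 1 * v u := by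
      have := v.pos_iff.mpr hu0
      gcongr
    rw [one_mul] at h3
    exact absurd h (not_le.mpr h3)
  refine ⟨z / t, div_mem hz ht, ?_⟩
  rw [div_pow, htw]
  field_simp

end IsDyadic

section Roots

lemma mem_of_pow_eq_pow {E : IntermediateField K Ω} {N : ℕ} (hN : N ≠ 0) {ζ x y : Ω}
    (hζ : IsPrimitiveRoot ζ N) (hζE : ζ ∈ E) (hy : y ∈ E) (h : x ^ N = y ^ N) : x ∈ E := by
  have : NeZero N := ⟨hN⟩
  by_cases hy0 : y = 0
  · rw [hy0, zero_pow hN] at h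
    rw [pow_eq_zero_iff hN |>.mp h]
    exact zero_mem E
  · obtain ⟨j, -, hj⟩ := hζ.eq_pow_of_pow_eq_one (ξ := x / y) (by
      rw [div_pow, h, div_self (pow_ne_zero N hy0)])
    have : x = ζ ^ j * y := by rw [hj]; field_simp
    rw [this]
    exact mul_mem (pow_mem hζE j) hy

instance finiteDimensional_adjoin_pair (x y : Ω) :
    FiniteDimensional K (IntermediateField.adjoin K {x, y}) :=
  IntermediateField.finiteDimensional_adjoin fun z _ ↦ Algebra.IsIntegral.isIntegral z

instance finiteDimensional_adjoin_singleton (x : Ω) :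
    FiniteDimensional K (IntermediateField.adjoin K {x}) :=
  IntermediateField.adjoin.finiteDimensional (Algebra.IsIntegral.isIntegral x)

lemma adjoin_pair_le_iff {E : IntermediateField K Ω} {x y : Ω} :
    IntermediateField.adjoin K {x, y} ≤ E ↔ x ∈ E ∧ y ∈ E := by
  rw [IntermediateField.adjoin_le_iff, Set.insert_subset_iff, Set.singleton_subset_iff]
  rfl

lemma left_mem_adjoin_pair (x y : Ω) : x ∈ IntermediateField.adjoin K {x, y} :=
  (adjoin_pair_le_iff.mp le_rfl).1

lemma right_mem_adjoin_pair (x y : Ω) : y ∈ IntermediateField.adjoin K {x, y} :=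
  (adjoin_pair_le_iff.mp le_rfl).2

lemma isGalois_adjoin_pair {N : ℕ} (hN : N ≠ 0) {ζ x : Ω} (hζ : IsPrimitiveRoot ζ N) {a : K}
    (hx : x ^ N = algebraMap K Ω a) : IsGalois K (IntermediateField.adjoin K {ζ, x}) := by
  have : IsAlgClosure K Ω := ⟨inferInstance, inferInstance⟩
  have : Normal K Ω := IsAlgClosure.normal K Ω
  have hn : Normal K (IntermediateField.adjoin K {ζ, x}) := by
    rw [IntermediateField.normal_iff_forall_map_le']
    intro σ
    rw [IntermediateField.adjoin_map, Set.image_pair, adjoin_pair_le_iff]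
    have hζm := left_mem_adjoin_pair (K := K) ζ x
    have hxm := right_mem_adjoin_pair (K := K) ζ x
    constructor
    · refine mem_of_pow_eq_pow hN hζ hζm (one_mem _) ?_
      change (σ ζ) ^ N = 1 ^ N
      rw [← map_pow, hζ.pow_eq_one, map_one, one_pow]
    · refine mem_of_pow_eq_pow hN hζ hζm hxm ?_
      change (σ x) ^ N = x ^ N
      rw [← map_pow, hx, AlgEquiv.commutes]
  exact ⟨⟩

lemma isPrimitiveRoot_of_pow_eq_neg_one [CharZero Ω] {c : ℕ} (hc : 1 ≤ c) {ζ : Ω}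
    (h : ζ ^ 2 ^ (c - 1) = -1) : IsPrimitiveRoot ζ (2 ^ c) := by
  obtain ⟨d, rfl⟩ : ∃ d, c = d + 1 := ⟨c - 1, by omega⟩
  rw [Nat.add_sub_cancel] at h
  rw [IsPrimitiveRoot.iff_orderOf]
  refine orderOf_eq_prime_pow ?_ ?_
  · rw [h]; norm_num
  · rw [pow_succ, pow_mul, h]; norm_num

lemma pow_eq_neg_one_of_isPrimitiveRoot {c : ℕ} (hc : 1 ≤ c) {ζ : Ω}
    (h : IsPrimitiveRoot ζ (2 ^ c)) : ζ ^ 2 ^ (c - 1) = -1 := by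
  obtain ⟨d, rfl⟩ : ∃ d, c = d + 1 := ⟨c - 1, by omega⟩
  rw [Nat.add_sub_cancel]
  have h1 : (ζ ^ 2 ^ d - 1) * (ζ ^ 2 ^ d + 1) = 0 := by
    have : ζ ^ 2 ^ d * ζ ^ 2 ^ d = 1 := by
      rw [← pow_two, ← pow_mul, ← pow_succ, h.pow_eq_one]
    linear_combination this
  rcases mul_eq_zero.mp h1 with h0 | h0
  · exfalso
    have := h.dvd_of_pow_eq_one _ (sub_eq_zero.mp h0)
    have := Nat.le_of_dvd (by positivity) this
    exact absurd this (not_le.mpr (Nat.pow_lt_pow_right (by norm_num) (by omega)))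
  · exact eq_neg_of_add_eq_zero_left h0

end Roots

/-- Lifting an integral element of `L` through an approximate embedding of `L`. -/
lemma IsUniformizer.exists_approx (hv : IsDyadic A K v) {L : IntermediateField K Ω}
    [FiniteDimensional K L] {π β : Ω} (h : IsUniformizer v L π) (hβ : v β ≤ 1) {r : ℝ≥0}
    (H : ∀ G : A[X], aeval π G = 0 → v (aeval β G) ≤ r) {x : Ω} (hx : x ∈ L) (hx1 : v x ≤ 1) :
    ∃ x' ∈ IntermediateField.adjoin K {β}, v x' ≤ 1 ∧
      ∀ G : A[X], aeval x G = 0 → v (aeval x' G) ≤ r := by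
  obtain ⟨F, rfl⟩ := h.exists_aeval_eq hv hx hx1
  refine ⟨aeval β F, IsDyadic.aeval_mem F (IntermediateField.mem_adjoin_simple_self K β),
    hv.map_aeval_le_one F hβ, fun G hG ↦ ?_⟩
  rw [← aeval_comp] at hG ⊢
  exact H _ hG

end Ramification

/-! ### Upper bounds for the model extensions. -/

namespace Ramification

open Polynomial NNReal

variable {A K Ω : Type*} [CommRing A] [IsDomain A] [IsDiscreteValuationRing A] [Field K] [Field Ω]
    [Algebra A K] [IsFractionRing A K] [Algebra K Ω] [Algebra A Ω] [IsScalarTower A K Ω]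
    [IsAlgClosed Ω] [Algebra.IsAlgebraic K Ω] [CharZero K]

variable {v : Valuation Ω ℝ≥0}

lemma map_eq_one_of_pow_eq_one {N : ℕ} (hN : N ≠ 0) {x : Ω} (hx : v (x ^ N) = 1) : v x = 1 := by
  rw [map_pow] at hx
  exact (pow_eq_one_iff_of_nonneg zero_le hN).mp hx

lemma IsPrimitiveRoot.map_eq_one {N : ℕ} (hN : N ≠ 0) {ζ : Ω} (hζ : IsPrimitiveRoot ζ N) :
    v ζ = 1 :=
  map_eq_one_of_pow_eq_one hN (by rw [hζ.pow_eq_one, map_one])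

lemma two_rpow_neg_natCast (n : ℕ) : (2 : ℝ≥0) ^ (-(n : ℝ)) = 2⁻¹ ^ n := by
  rw [NNReal.rpow_neg, NNReal.rpow_natCast, inv_pow]

/-- There are no breaks for the trivial extension. -/
lemma UpperLE.of_le_bot {L : IntermediateField K Ω} (hL : L ≤ ⊥) (h : ℝ) :
    UpperLE v L h := by
  intro x hx z hz hzx
  obtain ⟨σ, rfl⟩ := (mem_conj_iff K).mp hz
  obtain ⟨a, rfl⟩ := IntermediateField.mem_bot.mp (hL hx.mem)
  exact absurd (σ.commutes a) hzx

section Approx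

variable {L : IntermediateField K Ω} [FiniteDimensional K L] {π β : Ω}

/-- The image of `ζ` is a `2 ^ (c - 1)`-th root of `-1` up to `2 ^ c`, exactly the precision at
which such roots lift. -/
lemma IsUniformizer.exists_isPrimitiveRoot (hv : IsDyadic A K v) (h : IsUniformizer v L π)
    (hβ : v β ≤ 1) {r : ℝ≥0} (H : ∀ G : A[X], aeval π G = 0 → v (aeval β G) ≤ r) {c : ℕ}
    (hc : 1 ≤ c) (hr : r ≤ 2⁻¹ ^ c) {ζ : Ω} (hζ : IsPrimitiveRoot ζ (2 ^ c)) (hζL : ζ ∈ L) :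
    ∃ ζ' ∈ IntermediateField.adjoin K {β}, IsPrimitiveRoot ζ' (2 ^ c) := by
  have : CharZero Ω := charZero_of_injective_algebraMap (algebraMap K Ω).injective
  obtain ⟨z, hz, -, hG⟩ := h.exists_approx hv hβ H hζL
    (IsPrimitiveRoot.map_eq_one (by positivity) hζ).le
  have h1 := hG (X ^ 2 ^ (c - 1) + 1) (by
    simp [pow_eq_neg_one_of_isPrimitiveRoot hc hζ])
  obtain ⟨t, ht, htp⟩ := hv.exists_pow_two_pow_eq _ (c - 1) hz
    (neg_mem (one_mem (IntermediateField.adjoin K {β}))) (by simp) (by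
      rw [Nat.sub_add_cancel hc, v.map_neg, map_one, mul_one, sub_neg_eq_add]
      refine le_trans ?_ (h1.trans hr)
      simp)
  exact ⟨t, ht, isPrimitiveRoot_of_pow_eq_neg_one hc htp⟩

end Approx

/-- Adjoining `2 ^ (c - 1)`-th roots of units and `2 ^ c`-th roots of unity. -/
theorem upperLE_adjoin_root_unit (hv : IsDyadic A K v) {c : ℕ} (hc : 1 ≤ c) {ζ x : Ω}
    (hζ : IsPrimitiveRoot ζ (2 ^ c)) {u : K} (hu : v (algebraMap K Ω u) = 1)
    (hx : x ^ 2 ^ (c - 1) = algebraMap K Ω u) :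
    UpperLE v (IntermediateField.adjoin K {ζ, x}) (c - 1) := by
  have hxc : x ^ 2 ^ c = algebraMap K Ω (u ^ 2) := by
    obtain ⟨d, rfl⟩ : ∃ d, c = d + 1 := ⟨c - 1, by omega⟩
    rw [Nat.add_sub_cancel] at hx
    rw [pow_succ, pow_mul, hx, map_pow]
  -- The criterion is applied with `m = c` and needs `m ≥ 2`; for `c = 1` both generators lie in
  -- `K`.
  rcases hc.eq_or_lt with rfl | hc2
  · refine UpperLE.of_le_bot ?_ _
    rw [adjoin_pair_le_iff]
    have h1 := pow_eq_neg_one_of_isPrimitiveRoot le_rfl hζ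
    simp only [tsub_self, pow_zero, pow_one] at h1 hx
    exact ⟨h1 ▸ neg_mem (one_mem _), hx ▸ IntermediateField.algebraMap_mem _ _⟩
  have := isGalois_adjoin_pair (by positivity) hζ hxc
  refine UpperLE.of_forall hv (m := c) (by exact_mod_cast hc2)
    ⟨c * Module.finrank K (IntermediateField.adjoin K {ζ, x}), by push_cast; rfl⟩ ?_
  intro π hπ β hβ H
  rw [two_rpow_neg_natCast] at H
  obtain ⟨ζ', hζ', hζp⟩ := hπ.exists_isPrimitiveRoot hv hβ H hc le_rfl hζ (left_mem_adjoin_pair ζ x)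
  have hx1 : v x = 1 := map_eq_one_of_pow_eq_one (N := 2 ^ (c - 1)) (by positivity) (by rw [hx, hu])
  obtain ⟨z, hz, -, hG⟩ := hπ.exists_approx hv hβ H (right_mem_adjoin_pair ζ x) hx1.le
  obtain ⟨a, ha⟩ := (hv.le_one_iff u).mp hu.le
  have ha' : algebraMap A Ω a = algebraMap K Ω u := by
    rw [IsScalarTower.algebraMap_apply A K Ω, ha]
  have h1 := hG (X ^ 2 ^ (c - 1) - C a) (by simp [hx, ha'])
  obtain ⟨t, ht, htp⟩ := hv.exists_pow_two_pow_eq _ (c - 1) hz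
    (IntermediateField.algebraMap_mem _ u) (by
      intro h0; rw [h0, map_zero] at hu; exact absurd hu (by norm_num)) (by
      rw [Nat.sub_add_cancel hc, hu, mul_one]
      refine le_trans ?_ h1
      simp [ha'])
  rw [adjoin_pair_le_iff]
  refine ⟨mem_of_pow_eq_pow (by positivity) hζp hζ' (one_mem _) (by rw [hζ.pow_eq_one, one_pow]),
    mem_of_pow_eq_pow (by positivity) hζp hζ' ht ?_⟩
  obtain ⟨d, rfl⟩ : ∃ d, c = d + 1 := ⟨c - 1, by omega⟩
  rw [Nat.add_sub_cancel] at hx htp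
  rw [pow_succ, pow_mul, pow_mul, hx, htp]

/-- Adjoining `2 ^ c`-th roots of `2` and `2 ^ c`-th roots of unity. -/
theorem upperLE_adjoin_root_two (hv : IsDyadic A K v) {c : ℕ} {ζ x : Ω}
    (hζ : IsPrimitiveRoot ζ (2 ^ c)) (hx : x ^ 2 ^ c = 2) :
    UpperLE v (IntermediateField.adjoin K {ζ, x}) (c + 1) := by
  rcases Nat.eq_zero_or_pos c with rfl | hc
  · refine UpperLE.of_le_bot ?_ _
    rw [adjoin_pair_le_iff]
    have h1 := hζ.pow_eq_one
    simp only [pow_zero, pow_one] at h1 hx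
    exact ⟨h1 ▸ one_mem _, hx ▸ ofNat_mem _ 2⟩
  have := isGalois_adjoin_pair (by positivity) hζ (hx.trans (map_ofNat (algebraMap K Ω) 2).symm)
  have heq : (c + 1 : ℝ) = ((c + 2 : ℕ) : ℝ) - 1 := by push_cast; ring
  rw [heq]
  -- Lifting a `2 ^ c`-th root needs relative precision `2 ^ (c + 1)`, and the radicand `2` itself
  -- costs one more.
  refine UpperLE.of_forall hv (m := (c + 2 : ℕ)) (by push_cast; linarith [(Nat.cast_nonneg c : (0 : ℝ) ≤ c)])
    ⟨(c + 2) * Module.finrank K (IntermediateField.adjoin K {ζ, x}), by push_cast; rfl⟩ ?_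
  intro π hπ β hβ H
  rw [two_rpow_neg_natCast] at H
  obtain ⟨ζ', hζ', hζp⟩ := hπ.exists_isPrimitiveRoot hv hβ H hc
    (pow_le_pow_right_of_le_one' (by norm_num [inv_le_one₀]) (by omega)) hζ
    (left_mem_adjoin_pair ζ x)
  have hx1 : v x ≤ 1 := by
    rw [← pow_le_one_iff (n := 2 ^ c) (by positivity), ← map_pow, hx]
    exact hv.map_two_lt_one.le
  obtain ⟨z, hz, -, hG⟩ := hπ.exists_approx hv hβ H (right_mem_adjoin_pair ζ x) hx1
  have e2 : ∀ y : Ω, aeval y (2 : A[X]) = 2 := fun y ↦ map_ofNat _ 2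
  have h1 := hG (X ^ 2 ^ c - 2) (by simp [hx, e2])
  obtain ⟨t, ht, htp⟩ := hv.exists_pow_two_pow_eq _ c hz
    (ofNat_mem (IntermediateField.adjoin K {β}) 2) hv.two_ne_zero (by
      refine le_trans (le_trans (le_of_eq ?_) h1) (le_of_eq ?_)
      · have : aeval z (X ^ 2 ^ c - 2 : A[X]) = z ^ 2 ^ c - 2 := by simp [e2]
        rw [this]
      · exact (pow_succ _ _).trans (congrArg _ hv.map_two.symm))
  rw [adjoin_pair_le_iff]
  exact ⟨mem_of_pow_eq_pow (by positivity) hζp hζ' (one_mem _) (by rw [hζ.pow_eq_one, one_pow]),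
    mem_of_pow_eq_pow (by positivity) hζp hζ' ht (hx.trans htp.symm)⟩

section SqrtNegOne

variable {i : Ω}

lemma IsDyadic.map_one_add_sq (hv : IsDyadic A K v) (hi : i ^ 2 = -1) : v (1 + i) ^ 2 = 2⁻¹ := by
  have h1 : (1 + i) ^ 2 = 2 * i := by linear_combination hi
  have h2 : v i = 1 := map_eq_one_of_pow_eq_one (N := 2) (by norm_num) (by rw [hi]; simp)
  rw [← map_pow, h1, map_mul, h2, mul_one, hv.map_two]

lemma IsDyadic.map_one_add (hv : IsDyadic A K v) (hi : i ^ 2 = -1) :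
    v (1 + i) = (2 : ℝ≥0) ^ (-(1 / 2) : ℝ) := by
  refine (pow_left_inj₀ zero_le zero_le (by norm_num : (2 : ℕ) ≠ 0)).mp ?_
  rw [hv.map_one_add_sq hi, ← NNReal.rpow_natCast (2 ^ _), ← NNReal.rpow_mul, ← NNReal.rpow_neg_one]
  norm_num

lemma one_add_pow_four (hi : i ^ 2 = -1) : (1 + i) ^ 4 = -4 := by
  have h1 : (1 + i) ^ 2 = 2 * i := by linear_combination hi
  calc (1 + i) ^ 4 = ((1 + i) ^ 2) ^ 2 := by ring
    _ = -4 := by rw [h1]; linear_combination 4 * hi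

/-- The value of `1 + i` is `2 ^ (-1/2)`, which forces even ramification. -/
lemma IsDyadic.even_finrank (hv : IsDyadic A K v) (hi : i ^ 2 = -1) (L : IntermediateField K Ω)
    [FiniteDimensional K L] (hiL : i ∈ L) : Even (Module.finrank K L) := by
  have hne : 1 + i ≠ 0 := by
    intro h
    have := hv.map_one_add_sq hi
    rw [h, map_zero] at this
    exact absurd this (by norm_num)
  obtain ⟨n, hn⟩ := hv.exists_pow_finrank_eq L (add_mem (one_mem L) hiL) hne
  have h1 : (2 : ℝ≥0) ^ (n * 2) = 2 ^ (-(Module.finrank K L : ℤ)) := by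
    rw [zpow_mul, ← hn, zpow_ofNat, ← pow_mul, mul_comm, pow_mul, hv.map_one_add_sq hi, zpow_neg,
      zpow_natCast, inv_pow]
  have h2 := zpow_right_injective₀ (by norm_num) (by norm_num) h1
  rw [← Int.even_coe_nat]
  exact ⟨-n, by linarith⟩

/-- An approximate square root of `-1` is close to an exact one. -/
lemma IsDyadic.exists_sign_close (hv : IsDyadic A K v) (hi : i ^ 2 = -1) {y : Ω} {r : ℝ≥0}
    (hr : r < 2⁻¹ ^ 2) (hy : v (y ^ 2 + 1) ≤ r) :
    ∃ i', i' ^ 2 = -1 ∧ (i' = i ∨ i' = -i) ∧ v (y - i') ≤ 2 * r := by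
  have key : ∀ j : Ω, j ^ 2 = -1 → v (y - j) < 2⁻¹ → v (y - j) ≤ 2 * r := by
    intro j hj hlt
    have hj1 : v j = 1 := map_eq_one_of_pow_eq_one (N := 2) (by norm_num) (by rw [hj]; simp)
    have h1 : v (2 * j) = 2⁻¹ := by rw [map_mul, hj1, mul_one, hv.map_two]
    have h2 : v (y + j) = 2⁻¹ := by
      have : y + j = (y - j) + 2 * j := by ring
      rw [this, v.map_add_eq_of_lt_right (by rwa [h1]), h1]
    have h3 : y ^ 2 + 1 = (y - j) * (y + j) := by linear_combination hj
    rw [h3, map_mul, h2] at hy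
    calc v (y - j) = 2 * (v (y - j) * 2⁻¹) := by field_simp
      _ ≤ 2 * r := by gcongr
  rcases lt_or_ge (v (y - i)) 2⁻¹ with h | h
  · exact ⟨i, hi, Or.inl rfl, key i hi h⟩
  · have hi' : (-i) ^ 2 = -1 := by rw [neg_sq, hi]
    rcases lt_or_ge (v (y - -i)) 2⁻¹ with h' | h'
    · exact ⟨-i, hi', Or.inr rfl, key _ hi' h'⟩
    · exfalso
      have h3 : y ^ 2 + 1 = (y - i) * (y - -i) := by linear_combination hi
      rw [h3, map_mul] at hy
      have : (2⁻¹ : ℝ≥0) ^ 2 ≤ v (y - i) * v (y - -i) := by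
        rw [pow_two]; gcongr
      exact absurd (this.trans hy) (not_le.mpr hr)

/-- Adjoining `2 ^ (c - 2)`-th roots of `1 + √-1` and `2 ^ c`-th roots of unity. -/
theorem upperLE_adjoin_root_one_add (hv : IsDyadic A K v) {c : ℕ} (hc : 2 ≤ c) {ζ x : Ω}
    (hζ : IsPrimitiveRoot ζ (2 ^ c)) (hi : i ^ 2 = -1) (hx : x ^ 2 ^ (c - 2) = 1 + i) :
    UpperLE v (IntermediateField.adjoin K {ζ, x}) (c - 1 / 2) := by
  have hpow : (2 : ℕ) ^ c = 2 ^ (c - 2) * 4 := by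
    obtain ⟨d, rfl⟩ : ∃ d, c = d + 2 := ⟨c - 2, by omega⟩
    rw [Nat.add_sub_cancel, pow_add]; norm_num
  have hxc : x ^ 2 ^ c = algebraMap K Ω (-4) := by
    rw [hpow, pow_mul, hx, one_add_pow_four hi, map_neg, map_ofNat]
  have hic : i ^ 2 ^ c = 1 := by
    rw [hpow, mul_comm, pow_mul]
    have : i ^ 4 = 1 := by
      calc i ^ 4 = (i ^ 2) ^ 2 := by ring
        _ = 1 := by rw [hi]; norm_num
    rw [this, one_pow]
  have hiL : i ∈ IntermediateField.adjoin K {ζ, x} :=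
    mem_of_pow_eq_pow (by positivity) hζ (left_mem_adjoin_pair ζ x) (one_mem _)
      (by rw [hic, one_pow])
  have := isGalois_adjoin_pair (by positivity) hζ hxc
  have heq : (c - 1 / 2 : ℝ) = (c + 1 / 2 : ℝ) - 1 := by ring
  have hc' : (2 : ℝ) ≤ c := by exact_mod_cast hc
  rw [heq]
  obtain ⟨e, he⟩ := hv.even_finrank hi _ hiL
  -- The degree is even, so `m * [L : K]` is an integer. Separating `i'` from `-i'` loses a factor
  -- `2`, leaving error `2 ^ (-(c - 1/2))`, which is `2 ^ (-(c - 1)) * v (1 + i')`: just enough for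
  -- a `2 ^ (c - 2)`-th root.
  refine UpperLE.of_forall hv (m := c + 1 / 2) (by linarith)
    ⟨c * (e + e) + e, by rw [he]; push_cast; ring⟩ ?_
  intro π hπ β hβ H
  set E := IntermediateField.adjoin K {β} with hE
  have hrc : (2 : ℝ≥0) ^ (-(c + 1 / 2) : ℝ) ≤ 2⁻¹ ^ c := by
    rw [← two_rpow_neg_natCast]
    exact NNReal.rpow_le_rpow_of_exponent_le (by norm_num) (by linarith)
  obtain ⟨ζ', hζ', hζp⟩ := hπ.exists_isPrimitiveRoot hv hβ H (by omega) hrc hζ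
    (left_mem_adjoin_pair ζ x)
  have hiE : i ∈ E := mem_of_pow_eq_pow (by positivity) hζp hζ' (one_mem _) (by rw [hic, one_pow])
  have hx1 : v x ≤ 1 := by
    rw [← pow_le_one_iff (n := 2 ^ (c - 2)) (by positivity), ← map_pow, hx, hv.map_one_add hi]
    exact NNReal.rpow_le_one_of_one_le_of_nonpos (by norm_num) (by norm_num)
  obtain ⟨z, hz, -, hG⟩ := hπ.exists_approx hv hβ H (right_mem_adjoin_pair ζ x) hx1
  have h1 := hG ((X ^ 2 ^ (c - 2) - 1) ^ 2 + 1) (by simp [hx, hi])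
  have hr : (2 : ℝ≥0) ^ (-(c + 1 / 2) : ℝ) < 2⁻¹ ^ 2 := by
    rw [← two_rpow_neg_natCast]
    exact NNReal.rpow_lt_rpow_of_exponent_lt (by norm_num) (by push_cast; linarith)
  obtain ⟨i', hi', hor, hclose⟩ := hv.exists_sign_close hi hr (y := z ^ 2 ^ (c - 2) - 1)
    (by simpa using h1)
  have hi'E : i' ∈ E := by
    rcases hor with rfl | rfl
    · exact hiE
    · exact neg_mem hiE
  obtain ⟨t, ht, htp⟩ := hv.exists_pow_two_pow_eq E (c - 2) hz
    (add_mem (one_mem E) hi'E) (by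
      intro h
      have := hv.map_one_add_sq hi'
      rw [h, map_zero] at this
      exact absurd this (by norm_num)) (by
      rw [← sub_sub, hv.map_one_add hi']
      refine hclose.trans (le_of_eq ?_)
      rw [← two_rpow_neg_natCast, ← NNReal.rpow_add (by norm_num)]
      conv_lhs => rw [← NNReal.rpow_one 2, ← NNReal.rpow_mul, ← NNReal.rpow_add (by norm_num)]
      congr 1
      have : ((c - 2 + 1 : ℕ) : ℝ) = c - 1 := by
        rw [Nat.cast_add, Nat.cast_sub hc]; push_cast; ring
      rw [this]; ring)
  rw [adjoin_pair_le_iff]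
  refine ⟨mem_of_pow_eq_pow (by positivity) hζp hζ' (one_mem _) (by rw [hζ.pow_eq_one, one_pow]),
    mem_of_pow_eq_pow (by positivity) hζp hζ' ht ?_⟩
  rw [hpow, pow_mul, pow_mul, hx, htp, one_add_pow_four hi, one_add_pow_four hi']

end SqrtNegOne

end Ramification

/-! ### Lower bounds for the model extensions. -/

namespace Ramification

open Polynomial NNReal

variable {A K Ω : Type*} [CommRing A] [IsDomain A] [IsDiscreteValuationRing A] [Field K] [Field Ω]
    [Algebra A K] [IsFractionRing A K] [Algebra K Ω] [Algebra A Ω] [IsScalarTower A K Ω]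
    [IsAlgClosed Ω] [Algebra.IsAlgebraic K Ω] [CharZero K]

variable {v : Valuation Ω ℝ≥0}

/-- A lower bound for the largest break of `K(x)`, for a root `x` of an Eisenstein polynomial. -/
lemma UpperGE.of_eisenstein (hv : IsDyadic A K v) {x z : Ω} {P : K[X]} (hP : P.Monic)
    (hx : aeval x P = 0) (hvx : v x ^ P.natDegree = 2⁻¹) (hz : aeval z P = 0) (hzx : z ≠ x) {h : ℝ}
    (hle : v (aeval x (derivative P)) * v (z - x) = (2 : ℝ≥0) ^ (-(h + 1))) :
    UpperGE v (IntermediateField.adjoin K {x}) h := by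
  have hmin := hv.minpoly_eq_of_pow_natDegree hP hx hvx
  refine UpperGE.of_derivative hv (hv.isUniformizer_adjoin hP hx hvx) (z := z) ?_ hzx ?_
  · rw [mem_conj_iff_aeval, hmin, hz]
  · rw [hmin]; exact hle.le

lemma IsDyadic.map_two_pow (hv : IsDyadic A K v) (n : ℕ) : v (2 ^ n) = 2⁻¹ ^ n := by
  rw [map_pow, hv.map_two]

/-- Induction through `ζ ^ 2 - 1 = (ζ - 1) (ζ + 1)`: the two factors differ by `2`, which is smaller
than either, so they have equal value. -/
lemma IsDyadic.map_primitiveRoot_sub_one (hv : IsDyadic A K v) (d : ℕ) {ζ : Ω}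
    (hζ : ζ ^ 2 ^ d = -1) : v (ζ - 1) ^ 2 ^ d = 2⁻¹ := by
  induction d generalizing ζ with
  | zero =>
    simp only [pow_zero, pow_one] at hζ ⊢
    have : ζ - 1 = -2 := by rw [hζ]; ring
    rw [this, v.map_neg, hv.map_two]
  | succ d ih =>
    have hsq : (ζ ^ 2) ^ 2 ^ d = -1 := by rw [← pow_mul, ← pow_succ', hζ]
    have h1 := ih hsq
    have hζ1 : v ζ = 1 :=
      map_eq_one_of_pow_eq_one (N := 2 ^ (d + 1)) (by positivity) (by rw [hζ]; simp)
    have hfac : ζ ^ 2 - 1 = (ζ - 1) * (ζ + 1) := by ring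
    have hadd : v (ζ + 1) = v (ζ - 1) := by
      have hlt : 2⁻¹ < v (ζ - 1) := by
        by_contra! hle
        have h2 : v (ζ + 1) ≤ 2⁻¹ := by
          have : ζ + 1 = (ζ - 1) + 2 := by ring
          rw [this]
          exact v.map_add_le hle hv.map_two.le
        have h3 : v (ζ ^ 2 - 1) < 2⁻¹ := by
          rw [hfac, map_mul]
          calc v (ζ - 1) * v (ζ + 1) ≤ 2⁻¹ * 2⁻¹ := by gcongr
            _ < 2⁻¹ * 1 := by gcongr; norm_num [inv_lt_one₀]
            _ = 2⁻¹ := mul_one _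
        have h4 : v (ζ ^ 2 - 1) ^ 2 ^ d ≤ v (ζ ^ 2 - 1) :=
          pow_le_of_le_one zero_le (h3.le.trans (by norm_num [inv_le_one₀])) (by positivity)
        rw [h1] at h4
        exact absurd h3 (not_lt.mpr h4)
      have : ζ + 1 = 2 + (ζ - 1) := by ring
      rw [this]
      exact v.map_add_eq_of_lt_right (by rwa [hv.map_two])
    rw [hfac, map_mul, hadd, ← pow_two, ← pow_mul, ← pow_succ'] at h1
    exact h1

/-- Use the uniformizer `ζ - 1`, a root of `(X + 1) ^ N + 1` with `N = 2 ^ (c - 1)`. The derivative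
has value `v N`, and the conjugate `-ζ - 1` is at distance `v 2`; together they give `2 ^ (-c)`. -/
theorem upperGE_adjoin_primitiveRoot (hv : IsDyadic A K v) {c : ℕ} (hc : 2 ≤ c) {ζ : Ω}
    (hζ : IsPrimitiveRoot ζ (2 ^ c)) : UpperGE v (IntermediateField.adjoin K {ζ}) (c - 1) := by
  obtain ⟨d, rfl⟩ : ∃ d, c = d + 2 := ⟨c - 2, by omega⟩
  have hpow := pow_eq_neg_one_of_isPrimitiveRoot (by omega) hζ
  have hsub : d + 2 - 1 = d + 1 := by omega
  rw [hsub] at hpow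
  have hζ1 : v ζ = 1 := IsPrimitiveRoot.map_eq_one (by positivity) hζ
  have hζ0 : ζ ≠ 0 := hζ.ne_zero (by positivity)
  set N := 2 ^ (d + 1) with hN
  have hNe : Even N := ⟨2 ^ d, by rw [hN]; ring⟩
  let P : K[X] := (X + 1) ^ N + 1
  have hP : P.Monic := by
    refine Monic.add_of_left ((monic_X_add_C 1).pow N) ?_
    rw [degree_pow, ← C_1, degree_X_add_C, degree_C one_ne_zero]
    simp [hN]
  have hdeg : P.natDegree = N := by
    rw [natDegree_add_eq_left_of_natDegree_lt]
    · rw [natDegree_pow, ← C_1, natDegree_X_add_C, mul_one]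
    · rw [natDegree_pow, natDegree_one, ← C_1, natDegree_X_add_C, mul_one]
      positivity
  have hGE := UpperGE.of_eisenstein (h := d + 2 - 1) hv (x := ζ - 1) (z := -ζ - 1) hP
    (by simp [P, hpow]) (by rw [hdeg]; exact hv.map_primitiveRoot_sub_one (d + 1) hpow)
    (by simp [P, hNe.neg_pow, hpow])
    (by
      intro h
      have : 2 * ζ = 0 := by linear_combination -h
      exact (mul_ne_zero hv.two_ne_zero hζ0) this)
    (by
      have e1 : aeval (ζ - 1) (derivative P) = 2 ^ (d + 1) * ζ ^ (N - 1) := by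
        have e0 : algebraMap K Ω 2 = 2 := map_ofNat _ 2
        simp [P, derivative_pow, hN, e0]
      have e2 : -ζ - 1 - (ζ - 1) = -(2 * ζ) := by ring
      rw [e1, e2, v.map_neg, map_mul, map_mul, hv.map_two_pow, map_pow, hζ1, one_pow, mul_one,
        mul_one, hv.map_two, ← pow_succ, ← two_rpow_neg_natCast]
      congr 1
      push_cast; ring)
  have hle : IntermediateField.adjoin K {ζ - 1} ≤ IntermediateField.adjoin K {ζ} := by
    rw [IntermediateField.adjoin_simple_le_iff]
    exact sub_mem (IntermediateField.mem_adjoin_simple_self K ζ) (one_mem _)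
  push_cast
  exact hGE.mono hv hle

/-- For `X ^ N - 2` with `N = 2 ^ c`, the derivative at `x` times the difference `2 x` with the
conjugate `-x` is `2 N x ^ N = 2 ^ (c + 2)`. -/
theorem upperGE_adjoin_root_two (hv : IsDyadic A K v) {c : ℕ} (hc : 1 ≤ c) {x : Ω}
    (hx : x ^ 2 ^ c = 2) : UpperGE v (IntermediateField.adjoin K {x}) (c + 1) := by
  have hx0 : x ≠ 0 := by
    rintro rfl
    rw [zero_pow (by positivity)] at hx
    exact hv.two_ne_zero hx.symm
  set N := 2 ^ c with hN
  have hN0 : N ≠ 0 := by positivity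
  have hNe : Even N := (Nat.even_pow.mpr ⟨even_two, by omega⟩)
  have e2 : algebraMap K Ω 2 = 2 := map_ofNat _ 2
  refine UpperGE.of_eisenstein hv (P := X ^ N - C 2) (z := -x) (monic_X_pow_sub_C _ hN0)
    (by simp [hx, e2]) (by rw [natDegree_X_pow_sub_C, ← map_pow, hx, hv.map_two])
    (by simp [hNe.neg_pow, hx, e2]) ?_ ?_
  · intro h
    have : 2 * x = 0 := by linear_combination -h
    exact (mul_ne_zero hv.two_ne_zero hx0) this
  · have e1 : aeval x (derivative (X ^ N - C 2 : K[X])) = 2 ^ c * x ^ (N - 1) := by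
      simp [derivative_X_pow, hN, e2]
    have e3 : -x - x = -(2 * x) := by ring
    rw [e1, e3, v.map_neg, ← map_mul]
    have e4 : (2 : Ω) ^ c * x ^ (N - 1) * (2 * x) = 2 ^ (c + 2) := by
      have : x ^ (N - 1) * x = 2 := by rw [← pow_succ, Nat.sub_add_cancel (Nat.one_le_iff_ne_zero.mpr hN0), hx]
      calc (2 : Ω) ^ c * x ^ (N - 1) * (2 * x) = 2 ^ c * 2 * (x ^ (N - 1) * x) := by ring
        _ = 2 ^ (c + 2) := by rw [this]; ring
    rw [e4, hv.map_two_pow, ← two_rpow_neg_natCast]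
    congr 1
    push_cast; ring

/-- For `(X ^ N - 1) ^ 2 + 1` with `N = 2 ^ (c - 2)`, the derivative at `x` times `2 x` is `i * 2 ^
c * (1 + i)`, and the factor `1 + i` produces the half. Evenness of `N`, needed for `-x` to be a
conjugate, requires `c ≥ 3`. -/
theorem upperGE_adjoin_root_one_add (hv : IsDyadic A K v) {c : ℕ} (hc : 3 ≤ c) {x i : Ω}
    (hi : i ^ 2 = -1) (hx : x ^ 2 ^ (c - 2) = 1 + i) :
    UpperGE v (IntermediateField.adjoin K {x}) (c - 1 / 2) := by
  obtain ⟨d, rfl⟩ : ∃ d, c = d + 2 := ⟨c - 2, by omega⟩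
  rw [Nat.add_sub_cancel] at hx
  have hi1 : v i = 1 := map_eq_one_of_pow_eq_one (N := 2) (by norm_num) (by rw [hi]; simp)
  have hx0 : x ≠ 0 := by
    rintro rfl
    rw [zero_pow (by positivity)] at hx
    have := hv.map_one_add_sq hi
    rw [← hx, map_zero] at this
    exact absurd this (by norm_num)
  set N := 2 ^ d with hN
  have hN0 : N ≠ 0 := by positivity
  have hNe : Even N := (Nat.even_pow.mpr ⟨even_two, by omega⟩)
  let P : K[X] := (X ^ N - C 1) ^ 2 + 1
  have hP1 : ((X ^ N - C 1 : K[X]) ^ 2).Monic := (monic_X_pow_sub_C 1 hN0).pow 2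
  have hd1 : ((X ^ N - C 1 : K[X]) ^ 2).natDegree = 2 * N := by
    rw [natDegree_pow, natDegree_X_pow_sub_C]
  have hP : P.Monic := by
    refine hP1.add_of_left ?_
    rw [degree_one, degree_eq_natDegree hP1.ne_zero, hd1]
    exact_mod_cast (by omega : 0 < 2 * N)
  have hdeg : P.natDegree = 2 * N := by
    rw [natDegree_add_eq_left_of_natDegree_lt, hd1]
    rw [hd1, natDegree_one]; omega
  refine UpperGE.of_eisenstein hv (P := P) (z := -x) hP (by simp [P, hx, hi]) ?_
    (by simp [P, hNe.neg_pow, hx, hi]) ?_ ?_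
  · rw [hdeg, mul_comm, pow_mul, ← map_pow, hx, hv.map_one_add_sq hi]
  · intro h
    have : 2 * x = 0 := by linear_combination -h
    exact (mul_ne_zero hv.two_ne_zero hx0) this
  · have e0 : algebraMap K Ω 2 = 2 := map_ofNat _ 2
    have e1 : aeval x (derivative P) = 2 * i * (2 ^ d * x ^ (N - 1)) := by
      have hx' : x ^ 2 ^ d = 1 + i := hx
      simp [P, derivative_pow, hx', hN, e0]
    have e3 : -x - x = -(2 * x) := by ring
    rw [e1, e3, v.map_neg, ← map_mul]
    have e4 : 2 * i * (2 ^ d * x ^ (N - 1)) * (2 * x) = i * (2 ^ (d + 2) * (1 + i)) := by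
      have : x ^ (N - 1) * x = 1 + i := by rw [← pow_succ, Nat.sub_add_cancel (Nat.one_le_iff_ne_zero.mpr hN0), hx]
      calc 2 * i * (2 ^ d * x ^ (N - 1)) * (2 * x) = i * (2 ^ (d + 2) * (x ^ (N - 1) * x)) := by ring
        _ = _ := by rw [this]
    rw [e4, map_mul, hi1, one_mul, map_mul, hv.map_two_pow, ← two_rpow_neg_natCast,
      hv.map_one_add hi, ← NNReal.rpow_add (by norm_num)]
    congr 1
    push_cast; ring

end Ramification

/-! ### Decomposing the radicand into model cases. -/

namespace Ramification

open Polynomial NNReal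

section Kummer

variable {A K Ω : Type*} [CommRing A] [IsDomain A] [IsDiscreteValuationRing A] [Field K] [Field Ω]
    [Algebra A K] [IsFractionRing A K] [Algebra K Ω] [Algebra A Ω] [IsScalarTower A K Ω]
    [IsAlgClosed Ω] [Algebra.IsAlgebraic K Ω] [CharZero K]

variable {v : Valuation Ω ℝ≥0}

lemma mem_of_pow_odd_mem {E : IntermediateField K Ω} {x : Ω} {m c : ℕ} (hm : Odd m)
    (h1 : x ^ m ∈ E) (h2 : x ^ 2 ^ c ∈ E) : x ∈ E := by
  by_cases hx : x = 0
  · rw [hx]; exact zero_mem E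
  have hco : Nat.Coprime m (2 ^ c) := (Nat.coprime_two_right.mpr hm).pow_right c
  have hb := Nat.gcd_eq_gcd_ab m (2 ^ c)
  rw [hco] at hb
  have : x = (x ^ m) ^ (Nat.gcdA m (2 ^ c)) * (x ^ 2 ^ c) ^ (Nat.gcdB m (2 ^ c)) := by
    rw [← zpow_natCast, ← zpow_natCast, ← zpow_mul, ← zpow_mul, ← zpow_add₀ hx, ← hb]
    simp
  rw [this]
  exact mul_mem (zpow_mem h1 _) (zpow_mem h2 _)

/-- With `a = 1 + 4 d`, the root is `1 + 2 w` where `w ^ 2 + w = d` is solved in `K` itself. -/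
lemma IsDyadic.exists_sq_eq (hv : IsDyadic A K v) {a : A} (ha : 4 ∣ a - 1) :
    ∃ u : K, v (algebraMap K Ω u) = 1 ∧ u ^ 2 = algebraMap A K a := by
  obtain ⟨d, hd⟩ := ha
  obtain ⟨y, hy, hyd, hvy⟩ := hv.exists_sq_add_self_eq ⊥ (algebraMap_mem ⊥ d)
    (hv.map_algebraMap_le_one d)
  obtain ⟨w, rfl⟩ := IntermediateField.mem_bot.mp hy
  refine ⟨1 + 2 * w, ?_, ?_⟩
  · rw [map_add, map_mul, map_one, map_ofNat]
    have h2 : v (2 * algebraMap K Ω w) < v 1 := by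
      rw [map_mul, map_one]
      exact (mul_le_of_le_one_right' (hvy.trans (hv.map_algebraMap_le_one d))).trans_lt
        hv.map_two_lt_one
    rw [v.map_add_eq_of_lt_left h2, map_one]
  · have h1 : w ^ 2 + w = algebraMap A K d := by
      apply (algebraMap K Ω).injective
      rw [map_add, map_pow, ← IsScalarTower.algebraMap_apply]
      exact hyd
    have h2 : algebraMap A K a - 1 = 4 * algebraMap A K d := by
      have := congrArg (algebraMap A K) hd
      rwa [map_sub, map_one, map_mul, map_ofNat] at this
    linear_combination 4 * h1 - h2

lemma exists_isPrimitiveRoot_two_pow (F E : Type*) [Field F] [CharZero F] [Field E] [Algebra F E]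
    [IsAlgClosed E] (c : ℕ) : ∃ ζ : E, IsPrimitiveRoot ζ (2 ^ c) := by
  have : CharZero E := charZero_of_injective_algebraMap (algebraMap F E).injective
  rcases Nat.eq_zero_or_pos c with rfl | hc
  · exact ⟨1, by simp⟩
  · obtain ⟨ζ, hζ⟩ := IsAlgClosed.exists_pow_nat_eq (-1 : E) (n := 2 ^ (c - 1)) (by positivity)
    exact ⟨ζ, isPrimitiveRoot_of_pow_eq_neg_one hc hζ⟩

lemma exists_root (x : Ω) (c : ℕ) : ∃ y : Ω, y ^ 2 ^ c = x :=
  IsAlgClosed.exists_pow_nat_eq x (by positivity)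

variable {c n : ℕ} {ζ α : Ω}

/-- The root of `u ^ 2` and the field it generates with the roots of unity. -/
lemma IsDyadic.exists_root_unit (hv : IsDyadic A K v) (hc : 1 ≤ c) (hζ : IsPrimitiveRoot ζ (2 ^ c))
    {u : K} (hu : v (algebraMap K Ω u) = 1) :
    ∃ β : Ω, β ≠ 0 ∧ β ^ 2 ^ c = algebraMap K Ω u ^ 2 ∧
      UpperLE v (IntermediateField.adjoin K {ζ, β}) (c - 1) := by
  obtain ⟨β, hβ⟩ := exists_root (algebraMap K Ω u) (c - 1)
  refine ⟨β, ?_, ?_, upperLE_adjoin_root_unit hv hc hζ hu hβ⟩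
  · rintro rfl
    rw [zero_pow (by positivity)] at hβ
    rw [← hβ, map_zero] at hu
    exact absurd hu (by norm_num)
  · obtain ⟨d, rfl⟩ : ∃ d, c = d + 1 := ⟨c - 1, by omega⟩
    rw [Nat.add_sub_cancel] at hβ
    rw [pow_succ, pow_mul, hβ]

lemma mem_sup_of_pow_eq {L₁ L₂ : IntermediateField K Ω} (hζ : IsPrimitiveRoot ζ (2 ^ c))
    (hζL : ζ ∈ L₁) {x y z : Ω} (hy : y ∈ L₁) (hz : z ∈ L₂) (h : x ^ 2 ^ c = (y * z) ^ 2 ^ c) :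
    x ∈ L₁ ⊔ L₂ := by
  have h1 : L₁ ≤ L₁ ⊔ L₂ := le_sup_left
  have h2 : L₂ ≤ L₁ ⊔ L₂ := le_sup_right
  exact mem_of_pow_eq_pow (by positivity) hζ (h1 hζL) (mul_mem (h1 hy) (h2 hz)) h

/-- The radicand has odd valuation. -/
theorem upper_of_odd (hv : IsDyadic A K v) (hc : 1 ≤ c) (hζ : IsPrimitiveRoot ζ (2 ^ c))
    (hn : Odd n) {u : K} (hu : v (algebraMap K Ω u) = 1)
    (hα : α ^ 2 ^ c = 2 ^ n * algebraMap K Ω u) :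
    UpperLE v (IntermediateField.adjoin K {ζ, α}) (c + 1) ∧
      UpperGE v (IntermediateField.adjoin K {ζ, α}) (c + 1) := by
  obtain ⟨ξ, hξ⟩ := exists_isPrimitiveRoot_two_pow K Ω (c + 1)
  obtain ⟨β, hβ⟩ := exists_root (algebraMap K Ω u) c
  obtain ⟨ρ, hρ⟩ := exists_root (2 : Ω) c
  have hβ0 : β ≠ 0 := by
    rintro rfl
    rw [zero_pow (by positivity)] at hβ
    rw [← hβ, map_zero] at hu
    exact absurd hu (by norm_num)
  -- A `2 ^ c`-th root of a unit is the unit model at level `c + 1`; its breaks stay below the `c +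
  -- 1` contributed by the root of `2`.
  have hB : UpperLE v (IntermediateField.adjoin K {ξ, β}) c := by
    have := upperLE_adjoin_root_unit hv (c := c + 1) (by omega) hξ hu hβ
    simpa using this
  have hR := upperLE_adjoin_root_two hv hζ hρ
  have hζL := left_mem_adjoin_pair (K := K) ζ α
  constructor
  · refine UpperLE.mono hv ?_ (hR.sup hv (hB.weaken (by linarith)))
    rw [adjoin_pair_le_iff]
    refine ⟨(le_sup_left : _ ≤ _ ⊔ IntermediateField.adjoin K {ξ, β}) (left_mem_adjoin_pair ζ ρ),
      mem_sup_of_pow_eq hζ (left_mem_adjoin_pair ζ ρ)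
        (pow_mem (right_mem_adjoin_pair ζ ρ) n) (right_mem_adjoin_pair ξ β) ?_⟩
    rw [hα, mul_pow, hβ, ← pow_mul, mul_comm n, pow_mul, hρ]
  -- Dividing out `β` recovers `ρ ^ n` up to a root of unity, and the odd exponent `n` is removed by
  -- Bézout against `ρ ^ 2 ^ c = 2`.
  · refine UpperGE.of_sup hv ((upperGE_adjoin_root_two hv hc hρ).mono hv ?_) hB (by linarith)
    rw [IntermediateField.adjoin_simple_le_iff]
    refine mem_of_pow_odd_mem (c := c) hn (mem_sup_of_pow_eq hζ hζL
      (right_mem_adjoin_pair ζ α) (inv_mem (right_mem_adjoin_pair ξ β)) ?_) ?_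
    · rw [mul_pow, inv_pow, hα, hβ, ← pow_mul, mul_comm n, pow_mul, hρ]
      have : algebraMap K Ω u ≠ 0 := hβ ▸ pow_ne_zero _ hβ0
      field_simp
    · rw [hρ]; exact ofNat_mem _ 2

/-- The radicand is `2 ^ (4 * m)` times the square of a unit. -/
theorem upper_of_four_dvd (hv : IsDyadic A K v) (hc : 2 ≤ c) (hζ : IsPrimitiveRoot ζ (2 ^ c))
    (hn : 4 ∣ n) {u : K} (hu : v (algebraMap K Ω u) = 1)
    (hα : α ^ 2 ^ c = 2 ^ n * algebraMap K Ω u ^ 2) :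
    UpperLE v (IntermediateField.adjoin K {ζ, α}) (c - 1) ∧
      UpperGE v (IntermediateField.adjoin K {ζ, α}) (c - 1) := by
  constructor
  · obtain ⟨m, rfl⟩ := hn
    obtain ⟨β, -, hβ, hB⟩ := hv.exists_root_unit (by omega) hζ hu
    obtain ⟨d, rfl⟩ : ∃ d, c = d + 2 := ⟨c - 2, by omega⟩
    obtain ⟨ξ, hξ⟩ := exists_isPrimitiveRoot_two_pow K Ω d
    obtain ⟨ρ, hρ⟩ := exists_root (2 : Ω) d
    have hR := upperLE_adjoin_root_two hv hξ hρ
    refine UpperLE.mono hv ?_ (hB.sup hv (hR.weaken (by push_cast; linarith)))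
    rw [adjoin_pair_le_iff]
    refine ⟨(le_sup_left : _ ≤ _ ⊔ IntermediateField.adjoin K {ξ, ρ}) (left_mem_adjoin_pair ζ β),
      mem_sup_of_pow_eq hζ (left_mem_adjoin_pair ζ β) (right_mem_adjoin_pair ζ β)
        (pow_mem (right_mem_adjoin_pair ξ ρ) m) ?_⟩
    -- Divisibility by `4` reduces the root of `2` to level `c - 2`, whose breaks are at most `c -
    -- 1`, no more than those of the roots of unity.
    have h1 : (ρ ^ m) ^ 2 ^ (d + 2) = 2 ^ (4 * m) := by
      calc (ρ ^ m) ^ 2 ^ (d + 2) = (ρ ^ 2 ^ d) ^ (4 * m) := by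
            rw [← pow_mul, ← pow_mul]; congr 1; ring
        _ = _ := by rw [hρ]
    rw [hα, mul_pow, hβ, h1, mul_comm]
  · refine (upperGE_adjoin_primitiveRoot hv hc hζ).mono hv ?_
    rw [IntermediateField.adjoin_simple_le_iff]
    exact left_mem_adjoin_pair ζ α

/-- The radicand is `-2 ^ (4 * m)` times the square of a unit. -/
theorem upper_of_four_dvd_neg (hv : IsDyadic A K v) (hc : 2 ≤ c) (hζ : IsPrimitiveRoot ζ (2 ^ c))
    (hn : 4 ∣ n) {u : K} (hu : v (algebraMap K Ω u) = 1)
    (hα : α ^ 2 ^ c = -(2 ^ n * algebraMap K Ω u ^ 2)) :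
    UpperLE v (IntermediateField.adjoin K {ζ, α}) c ∧
      UpperGE v (IntermediateField.adjoin K {ζ, α}) c := by
  obtain ⟨ξ, hξ⟩ := exists_isPrimitiveRoot_two_pow K Ω (c + 1)
  have hξ1 : ξ ^ 2 ^ c = -1 := pow_eq_neg_one_of_isPrimitiveRoot (by omega) hξ
  have hξ0 : ξ ≠ 0 := hξ.ne_zero (by positivity)
  obtain ⟨α', hα'⟩ := exists_root (2 ^ n * algebraMap K Ω u ^ 2) c
  have hu0 : algebraMap K Ω u ≠ 0 := by
    intro h
    rw [h, map_zero] at hu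
    exact absurd hu (by norm_num)
  have hα'0 : α' ≠ 0 := by
    rintro rfl
    rw [zero_pow (by positivity)] at hα'
    exact (mul_ne_zero (pow_ne_zero _ hv.two_ne_zero) (pow_ne_zero _ hu0)) hα'.symm
  have hB := (upper_of_four_dvd hv hc hζ hn hu hα').1
  constructor
  · have hZ : UpperLE v (IntermediateField.adjoin K {ξ, 1}) c := by
      have := upperLE_adjoin_root_unit hv (c := c + 1) (by omega) hξ (u := 1) (x := 1)
        (by simp) (by simp)
      simpa using this
    refine UpperLE.mono hv ?_ ((hB.weaken (by linarith)).sup hv hZ)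
    rw [adjoin_pair_le_iff]
    refine ⟨(le_sup_left : _ ≤ _ ⊔ IntermediateField.adjoin K {ξ, 1}) (left_mem_adjoin_pair ζ α'),
      mem_sup_of_pow_eq hζ (left_mem_adjoin_pair ζ α') (right_mem_adjoin_pair ζ α')
        (left_mem_adjoin_pair ξ 1) ?_⟩
    rw [hα, mul_pow, hα', hξ1, mul_neg_one]
  · have hGE := upperGE_adjoin_primitiveRoot hv (c := c + 1) (by omega) hξ
    rw [Nat.cast_add, Nat.cast_one, add_sub_cancel_right] at hGE
    refine UpperGE.of_sup hv (hGE.mono hv ?_) hB (by linarith)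
    rw [IntermediateField.adjoin_simple_le_iff]
    refine mem_sup_of_pow_eq hζ (left_mem_adjoin_pair ζ α) (right_mem_adjoin_pair ζ α)
      (inv_mem (right_mem_adjoin_pair ζ α')) ?_
    rw [mul_pow, inv_pow, hα, hα', hξ1]
    have h2 : (2 : Ω) ^ n ≠ 0 := pow_ne_zero _ hv.two_ne_zero
    field_simp

/-- The radicand is `2 ^ (2 * m)`, `m` odd, times the square of a unit. -/
theorem upper_of_two_mul_odd (hv : IsDyadic A K v) (hc : 2 ≤ c) (hζ : IsPrimitiveRoot ζ (2 ^ c))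
    {m : ℕ} (hm : Odd m) {u : K} (hu : v (algebraMap K Ω u) = 1)
    (hα : α ^ 2 ^ c = 2 ^ (2 * m) * algebraMap K Ω u ^ 2) :
    UpperLE v (IntermediateField.adjoin K {ζ, α}) c ∧
      UpperGE v (IntermediateField.adjoin K {ζ, α}) c := by
  obtain ⟨β, hβ0, hβ, hB⟩ := hv.exists_root_unit (by omega) hζ hu
  obtain ⟨d, rfl⟩ : ∃ d, c = d + 1 := ⟨c - 1, by omega⟩
  obtain ⟨ξ, hξ⟩ := exists_isPrimitiveRoot_two_pow K Ω d
  obtain ⟨ρ, hρ⟩ := exists_root (2 : Ω) d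
  have h1 : (ρ ^ m) ^ 2 ^ (d + 1) = 2 ^ (2 * m) := by
    calc (ρ ^ m) ^ 2 ^ (d + 1) = (ρ ^ 2 ^ d) ^ (2 * m) := by
          rw [← pow_mul, ← pow_mul]; congr 1; ring
      _ = _ := by rw [hρ]
  constructor
  · have hR := upperLE_adjoin_root_two hv hξ hρ
    rw [Nat.cast_add, Nat.cast_one]
    refine UpperLE.mono hv ?_ ((hB.weaken (by push_cast; linarith)).sup hv hR)
    rw [adjoin_pair_le_iff]
    refine ⟨(le_sup_left : _ ≤ _ ⊔ IntermediateField.adjoin K {ξ, ρ}) (left_mem_adjoin_pair ζ β),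
      mem_sup_of_pow_eq hζ (left_mem_adjoin_pair ζ β) (right_mem_adjoin_pair ζ β)
        (pow_mem (right_mem_adjoin_pair ξ ρ) m) ?_⟩
    rw [hα, mul_pow, hβ, h1, mul_comm]
  · have hGE := upperGE_adjoin_root_two hv (by omega) hρ
    rw [Nat.cast_add, Nat.cast_one]
    refine UpperGE.of_sup hv (hGE.mono hv ?_) hB (by push_cast; linarith)
    rw [IntermediateField.adjoin_simple_le_iff]
    refine mem_of_pow_odd_mem (c := d) hm (mem_sup_of_pow_eq hζ (left_mem_adjoin_pair ζ α)
      (right_mem_adjoin_pair ζ α) (inv_mem (right_mem_adjoin_pair ζ β)) ?_) ?_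
    · rw [h1, mul_pow, inv_pow, hα, hβ]
      have : algebraMap K Ω u ^ 2 ≠ 0 := hβ ▸ pow_ne_zero _ hβ0
      rw [mul_assoc, mul_inv_cancel₀ this, mul_one]
    · rw [hρ]; exact ofNat_mem _ 2

/-- The sign is absorbed so that `-4 = (1 + i) ^ 4` can be used. -/
lemma two_pow_two_mul_neg {m : ℕ} (hm : Odd m) (w : Ω) :
    -(2 ^ (2 * m) * w) = (-4) ^ m * w := by
  rw [hm.neg_pow, pow_mul]
  norm_num

/-- The radicand is `-2 ^ (2 * m)`, `m` odd, times the square of a unit, and `c = 2`. -/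
theorem upper_of_two_mul_odd_neg_two (hv : IsDyadic A K v) (hζ : IsPrimitiveRoot ζ (2 ^ 2))
    {m : ℕ} (hm : Odd m) {u : K} (hu : v (algebraMap K Ω u) = 1)
    (hα : α ^ 2 ^ 2 = -(2 ^ (2 * m) * algebraMap K Ω u ^ 2)) :
    UpperLE v (IntermediateField.adjoin K {ζ, α}) 1 ∧
      UpperGE v (IntermediateField.adjoin K {ζ, α}) 1 := by
  obtain ⟨β, hβ0, hβ, hB⟩ := hv.exists_root_unit (by omega) hζ hu
  have hi : ζ ^ 2 = -1 := pow_eq_neg_one_of_isPrimitiveRoot (c := 2) (by omega) hζ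
  have h21 : ((2 : ℕ) : ℝ) - 1 = 1 := by norm_num
  rw [h21] at hB
  constructor
  · refine UpperLE.mono hv ?_ hB
    rw [adjoin_pair_le_iff]
    have hζm := left_mem_adjoin_pair (K := K) ζ β
    refine ⟨hζm, mem_of_pow_eq_pow (by positivity) hζ hζm
      (mul_mem (pow_mem (add_mem (one_mem _) hζm) m) (right_mem_adjoin_pair ζ β)) ?_⟩
    rw [hα, two_pow_two_mul_neg hm, mul_pow, hβ, ← pow_mul, mul_comm m, pow_mul]
    norm_num [one_add_pow_four hi]
  · have hGE := upperGE_adjoin_primitiveRoot hv le_rfl hζ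
    rw [h21] at hGE
    refine hGE.mono hv ?_
    rw [IntermediateField.adjoin_simple_le_iff]
    exact left_mem_adjoin_pair ζ α

/-- The radicand is `-2 ^ (2 * m)`, `m` odd, times the square of a unit, and `c > 2`. -/
theorem upper_of_two_mul_odd_neg (hv : IsDyadic A K v) (hc : 3 ≤ c)
    (hζ : IsPrimitiveRoot ζ (2 ^ c)) {m : ℕ} (hm : Odd m) {u : K} (hu : v (algebraMap K Ω u) = 1)
    (hα : α ^ 2 ^ c = -(2 ^ (2 * m) * algebraMap K Ω u ^ 2)) :
    UpperLE v (IntermediateField.adjoin K {ζ, α}) (c - 1 / 2) ∧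
      UpperGE v (IntermediateField.adjoin K {ζ, α}) (c - 1 / 2) := by
  obtain ⟨β, hβ0, hβ, hB⟩ := hv.exists_root_unit (by omega) hζ hu
  obtain ⟨i, hi⟩ := IsAlgClosed.exists_pow_nat_eq (-1 : Ω) (n := 2) (by norm_num)
  obtain ⟨x, hx⟩ := exists_root (1 + i) (c - 2)
  have hxc : x ^ 2 ^ c = -4 := by
    have hpow : (2 : ℕ) ^ c = 2 ^ (c - 2) * 4 := by
      obtain ⟨d, rfl⟩ : ∃ d, c = d + 2 := ⟨c - 2, by omega⟩
      rw [Nat.add_sub_cancel, pow_add]; norm_num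
    rw [hpow, pow_mul, hx, one_add_pow_four hi]
  have hxm : (x ^ m) ^ 2 ^ c = (-4) ^ m := by rw [← pow_mul, mul_comm m, pow_mul, hxc]
  rw [two_pow_two_mul_neg hm] at hα
  constructor
  · have hR := upperLE_adjoin_root_one_add hv (by omega) hζ hi hx
    refine UpperLE.mono hv ?_ ((hB.weaken (by linarith)).sup hv hR)
    rw [adjoin_pair_le_iff]
    refine ⟨(le_sup_left : _ ≤ _ ⊔ IntermediateField.adjoin K {ζ, x}) (left_mem_adjoin_pair ζ β),
      mem_sup_of_pow_eq hζ (left_mem_adjoin_pair ζ β) (right_mem_adjoin_pair ζ β)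
        (pow_mem (right_mem_adjoin_pair ζ x) m) ?_⟩
    rw [hα, mul_pow, hβ, hxm, mul_comm]
  · have hGE := upperGE_adjoin_root_one_add hv hc hi hx
    refine UpperGE.of_sup hv (hGE.mono hv ?_) hB (by linarith)
    rw [IntermediateField.adjoin_simple_le_iff]
    refine mem_of_pow_odd_mem (c := c) hm (mem_sup_of_pow_eq hζ (left_mem_adjoin_pair ζ α)
      (right_mem_adjoin_pair ζ α) (inv_mem (right_mem_adjoin_pair ζ β)) ?_) ?_
    · rw [hxm, mul_pow, inv_pow, hα, hβ]
      have : algebraMap K Ω u ^ 2 ≠ 0 := hβ ▸ pow_ne_zero _ hβ0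
      rw [mul_assoc, mul_inv_cancel₀ this, mul_one]
    · rw [hxc]; exact neg_mem (ofNat_mem _ 4)

/-- The square root of minus the square of a unit. -/
theorem upper_of_sq_eq_neg_sq (hv : IsDyadic A K v) (hζ : IsPrimitiveRoot ζ 2)
    {u : K} (hu : v (algebraMap K Ω u) = 1) (hα : α ^ 2 = -algebraMap K Ω u ^ 2) :
    UpperLE v (IntermediateField.adjoin K {ζ, α}) 1 ∧
      UpperGE v (IntermediateField.adjoin K {ζ, α}) 1 := by
  have : CharZero Ω := charZero_of_injective_algebraMap (algebraMap K Ω).injective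
  have hu0 : algebraMap K Ω u ≠ 0 := by
    intro h
    rw [h, map_zero] at hu
    exact absurd hu (by norm_num)
  have hi : (α / algebraMap K Ω u) ^ 2 = -1 := by
    rw [div_pow, hα]; field_simp
  have hprim : IsPrimitiveRoot (α / algebraMap K Ω u) (2 ^ 2) :=
    isPrimitiveRoot_of_pow_eq_neg_one (by norm_num) (by simpa using hi)
  have h21 : ((2 : ℕ) : ℝ) - 1 = 1 := by norm_num
  constructor
  · have hZ := upperLE_adjoin_root_unit hv (c := 2) (by norm_num) hprim (u := 1) (x := 1)
      (by simp) (by simp)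
    rw [h21] at hZ
    refine UpperLE.mono hv ?_ hZ
    rw [adjoin_pair_le_iff]
    constructor
    · rw [hζ.eq_neg_one_of_two_right]
      exact neg_mem (one_mem _)
    · have h := mul_mem (left_mem_adjoin_pair (K := K) (α / algebraMap K Ω u) (1 : Ω))
        (IntermediateField.algebraMap_mem _ u)
      rwa [div_mul_cancel₀ _ hu0] at h
  · have hGE := upperGE_adjoin_primitiveRoot hv le_rfl hprim
    rw [h21] at hGE
    refine hGE.mono hv ?_
    rw [IntermediateField.adjoin_simple_le_iff]
    exact div_mem (right_mem_adjoin_pair ζ α) (IntermediateField.algebraMap_mem _ u)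

end Kummer

end Ramification

/-! ### The unit part of the radicand and the main theorem. -/

namespace Ramification

open Polynomial NNReal

section Kummer

variable {A K Ω : Type*} [CommRing A] [IsDomain A] [IsDiscreteValuationRing A] [Field K] [Field Ω]
    [Algebra A K] [IsFractionRing A K] [Algebra K Ω] [Algebra A Ω] [IsScalarTower A K Ω]
    [IsAlgClosed Ω] [Algebra.IsAlgebraic K Ω] [CharZero K]

variable {v : Valuation Ω ℝ≥0}

lemma IsDyadic.map_eq_one_of_two_dvd_sub_one (hv : IsDyadic A K v) {b : A} (hb : 2 ∣ b - 1) :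
    v (algebraMap A Ω b) = 1 := by
  obtain ⟨d, hd⟩ := hb
  have h2 : v (2 * algebraMap A Ω d) < v 1 := by
    rw [map_mul, map_one]
    exact (mul_le_of_le_one_right' (hv.map_algebraMap_le_one d)).trans_lt hv.map_two_lt_one
  rw [← add_sub_cancel 1 b, hd, map_add, map_mul, map_one, map_ofNat,
    v.map_add_eq_of_lt_left h2, map_one]

lemma adjoin_pair_eq_bot {ζ α : Ω} (hζ : IsPrimitiveRoot ζ 2) {u : K}
    (hα : α ^ 2 = algebraMap K Ω u ^ 2) : IntermediateField.adjoin K {ζ, α} = ⊥ := by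
  rw [eq_bot_iff, adjoin_pair_le_iff, hζ.eq_neg_one_of_two_right]
  refine ⟨neg_mem (one_mem _), ?_⟩
  rcases sq_eq_sq_iff_eq_or_eq_neg.mp hα with rfl | rfl
  · exact IntermediateField.algebraMap_mem _ u
  · exact neg_mem (IntermediateField.algebraMap_mem _ u)

end Kummer

end Ramification

theorem theorem5p1 (k : Type*) [Field k] [IsAlgClosed k] [CharP k 2]
    (c n : ℕ) (hc : 1 ≤ c) (hn : n < 2 ^ c)
    (b : WittVector 2 k) (hb : (2 : WittVector 2 k) ∣ b - 1)
    (ζ α : AlgebraicClosure (Ramification.WittField k)) (hζ : IsPrimitiveRoot ζ (2 ^ c))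
    (hα : α ^ (2 ^ c) = algebraMap (WittVector 2 k) (AlgebraicClosure (Ramification.WittField k)) (2 ^ n * b))
    (K : IntermediateField (Ramification.WittField k) (AlgebraicClosure (Ramification.WittField k)))
    (hK : K = IntermediateField.adjoin (Ramification.WittField k) {ζ, α}) :
    FiniteDimensional (Ramification.WittField k) K ∧ IsGalois (Ramification.WittField k) K ∧
    (Odd n → Ramification.conductor (WittVector 2 k) (Ramification.WittField k) K = c + 1) ∧
    (Even n →
      (c = 1 → 4 ∣ b - 1 → K = ⊥) ∧
      (c = 1 → 4 ∣ b - 3 → Ramification.conductor (WittVector 2 k) (Ramification.WittField k) K = 1) ∧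
      (4 ∣ n → 1 < c → 4 ∣ b - 1 → Ramification.conductor (WittVector 2 k) (Ramification.WittField k) K = c - 1) ∧
      (4 ∣ n → 1 < c → 4 ∣ b - 3 → Ramification.conductor (WittVector 2 k) (Ramification.WittField k) K = c) ∧
      (¬ 4 ∣ n → 1 < c → 4 ∣ b - 1 → Ramification.conductor (WittVector 2 k) (Ramification.WittField k) K = c) ∧
      (¬ 4 ∣ n → c = 2 → 4 ∣ b - 3 → Ramification.conductor (WittVector 2 k) (Ramification.WittField k) K = 1) ∧
      (¬ 4 ∣ n → 2 < c → 4 ∣ b - 3 →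
        Ramification.conductor (WittVector 2 k) (Ramification.WittField k) K = c - 1 / 2)) := by
  obtain ⟨v, hv⟩ := Ramification.exists_isDyadic_wittField k
  subst hK
  have hgal : IsGalois (Ramification.WittField k)
      (IntermediateField.adjoin (Ramification.WittField k) {ζ, α}) :=
    Ramification.isGalois_adjoin_pair (by positivity) hζ
      (a := algebraMap (WittVector 2 k) (Ramification.WittField k) (2 ^ n * b))
      (by rw [hα, ← IsScalarTower.algebraMap_apply])
  rw [map_mul, map_pow, map_ofNat] at hα
  have hpos : 4 ∣ b - 1 → ∃ u : Ramification.WittField k, v (algebraMap _ _ u) = 1 ∧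
      α ^ 2 ^ c = 2 ^ n * algebraMap _ _ u ^ 2 := by
    intro h
    obtain ⟨u, hu, hub⟩ := hv.exists_sq_eq h
    refine ⟨u, hu, ?_⟩
    rw [hα, ← map_pow, hub, ← IsScalarTower.algebraMap_apply]
  have hneg : 4 ∣ b - 3 → ∃ u : Ramification.WittField k, v (algebraMap _ _ u) = 1 ∧
      α ^ 2 ^ c = -(2 ^ n * algebraMap _ _ u ^ 2) := by
    rintro ⟨d, hd⟩
    -- From `b = 3 + 4 d` one gets `-b - 1 = 4 (-d - 1)`.
    obtain ⟨u, hu, hub⟩ := hv.exists_sq_eq (a := -b) ⟨-d - 1, by linear_combination -hd⟩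
    refine ⟨u, hu, ?_⟩
    rw [hα, ← map_pow, hub, ← IsScalarTower.algebraMap_apply, map_neg]
    ring
  have hodd : Even n → ¬ 4 ∣ n → ∃ m, Odd m ∧ n = 2 * m := by
    rintro ⟨m, rfl⟩ h4
    refine ⟨m, ?_, by ring⟩
    rw [← Nat.not_even_iff_odd]
    rintro ⟨l, rfl⟩
    exact h4 ⟨l, by ring⟩
  refine ⟨inferInstance, hgal, fun hn' ↦ ?_, fun hn' ↦ ⟨?_, ?_, ?_, ?_, ?_, ?_, ?_⟩⟩
  · have hu := hv.map_eq_one_of_two_dvd_sub_one hb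
    rw [IsScalarTower.algebraMap_apply _ (Ramification.WittField k)] at hu hα
    obtain ⟨h1, h2⟩ := Ramification.upper_of_odd hv hc hζ hn' hu hα
    exact hv.conductor_eq h1 h2
  · rintro rfl h
    obtain rfl : n = 0 := by obtain ⟨m, rfl⟩ := hn'; omega
    obtain ⟨u, -, hu⟩ := hpos h
    exact Ramification.adjoin_pair_eq_bot (by simpa using hζ) (by simpa using hu)
  · rintro rfl h
    obtain rfl : n = 0 := by obtain ⟨m, rfl⟩ := hn'; omega
    obtain ⟨u, hu1, hu⟩ := hneg h
    obtain ⟨h1, h2⟩ := Ramification.upper_of_sq_eq_neg_sq hv (by simpa using hζ) hu1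
      (by simpa using hu)
    exact hv.conductor_eq h1 h2
  · intro h4 hc' h
    obtain ⟨u, hu1, hu⟩ := hpos h
    obtain ⟨h1, h2⟩ := Ramification.upper_of_four_dvd hv hc' hζ h4 hu1 hu
    exact hv.conductor_eq h1 h2
  · intro h4 hc' h
    obtain ⟨u, hu1, hu⟩ := hneg h
    obtain ⟨h1, h2⟩ := Ramification.upper_of_four_dvd_neg hv hc' hζ h4 hu1 hu
    exact hv.conductor_eq h1 h2
  · intro h4 hc' h
    obtain ⟨m, hm, rfl⟩ := hodd hn' h4
    obtain ⟨u, hu1, hu⟩ := hpos h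
    obtain ⟨h1, h2⟩ := Ramification.upper_of_two_mul_odd hv hc' hζ hm hu1 hu
    exact hv.conductor_eq h1 h2
  · rintro h4 rfl h
    obtain ⟨m, hm, rfl⟩ := hodd hn' h4
    obtain ⟨u, hu1, hu⟩ := hneg h
    obtain ⟨h1, h2⟩ := Ramification.upper_of_two_mul_odd_neg_two hv hζ hm hu1 hu
    exact hv.conductor_eq h1 h2
  · intro h4 hc' h
    obtain ⟨m, hm, rfl⟩ := hodd hn' h4
    obtain ⟨u, hu1, hu⟩ := hneg h
    obtain ⟨h1, h2⟩ := Ramification.upper_of_two_mul_odd_neg hv hc' hζ hm hu1 hu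
    exact hv.conductor_eq h1 h2
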